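/- Let $\omega=\frac{-1+\sqrt{-3}}2$, $K=\mathbb{Q}(\sqrt{-3})\subset\mathbb{C}$ with ring of integers $\mathcal{O}_K=\mathbb{Z}[\omega]$, and let $E$ be the curve $Y^2+Y=X^3-7$, equivalently $y^2=4x^3-27$ (with $x=X$, $y=2Y+1$). Let $\mathcal{L}\subset\mathbb{C}$ be the period lattice of $E$, i.e. the lattice with $g_2(\mathcal{L})=0$ and $g_3(\mathcal{L})=27$, and let $\Omega_0$ be the least positive real element of $\mathcal{L}$. Let $\Omega\in\{\Omega_0,-\Omega_0\}$, and put $\epsilon=1$ if $\Omega=\Omega_0$ and $\epsilon=-1$ if $\Omega=-\Omega_0$. Write $\wp,\wp'$ for the Weierstrass functions of $\mathcal{L}$, and let $\mathcal{E}_1^*(z,\mathcal{L})=H_1(z,1,\mathcal{L})$, where $H_1(z,s,\mathcal{L})$ is the analytic continuation in $s$ of $$\sum_{w\in\mathcal{L},\,w\neq -z}\frac{\overline{z}+\overline{w}}{|z+w|^{2s}}\qquad(\mathrm{Re}(s)>3/2).$$ For $m\in\{2,3\}$, a nonzero $a\in\mathcal{O}_K$ and an ideal $\mathfrak{b}$ of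 $K$ all of whose prime factors are unramified in $K(\sqrt[m]{a})$, let $\left(\frac a{\mathfrak b}\right)_m\in\boldsymbol\mu_m$ be the power residue symbol, given by $(\sqrt[m]{a})^{\sigma_{\mathfrak b}}=\left(\frac a{\mathfrak b}\right)_m\sqrt[m]{a}$ with $\sigma_{\mathfrak b}$ the Artin symbol of $\mathfrak{b}$ for $K(\sqrt[m]{a})/K$. (1) *Quadratic twists.* Let $n\geq 1$, and let $\mathfrak{p}_1,\dots,\mathfrak{p}_n$ be distinct prime ideals of $K$, each lying above a rational prime that splits completely in $K(x(E[4]))$, the field obtained by adjoining to $K$ the $x$-coordinates of the nonzero $4$-division points of $E$. Suppose $\mathfrak{p}_j=(\pi_j)$ with $\pi_j\equiv 1\bmod 4$, and let $D=\pi_1\cdots\pi_n$. Let $\mathcal{C}\subset\mathcal{O}_K$ be a finite set with $-\mathcal{C}=\mathcal{C}$ that represents every class of $(\mathcal{O}_K/D\mathcal{O}_K)^\times$ exactly once, and let $V$ be the set of all $c\in\mathcal{C}$ such that $\left(\frac{\pi_j}{(3c+D)}\right)_2=1$ for all $j$. Then $$\sum_{c\in V}\mathcal{E}_1^*\left(\frac{c\Omega}{D}+\frac{\Omega}{3},\mathcal{L}\right)=-\epsilon\left(\frac12\sum_{c\in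 V}\frac{9}{3-\wp\left(\frac{c\Omega}{D}\right)}-\#(V)\right).$$ (2) *Cubic twists.* Call a nonzero prime ideal of $K$ cubic-special if it splits completely in $K(E[27])$ but not in $K(E[27])\big((1-\omega)^{1/9}\big)$. Let $n\geq1$, let $(\pi_1),\dots,(\pi_n)$ be distinct cubic-special prime ideals of $K$ with generators $\pi_j\equiv 1\bmod 3$, and let $D=\pi_1^{\alpha_1}\cdots\pi_n^{\alpha_n}$ with all $\alpha_j\in\{1,2\}$. Let $\mathcal{C}\subset\mathcal{O}_K$ be a finite set with $\omega\mathcal{C}=\mathcal{C}$ that represents every class of $(\mathcal{O}_K/D\mathcal{O}_K)^\times$ exactly once, and let $V$ be the set of all $c\in\mathcal{C}$ such that $\left(\frac{\pi_j}{(3c+D)}\right)_3=1$ for all $j$. Then $$\sum_{c\in V}\mathcal{E}_1^*\left(\frac{c\Omega}{D}+\frac{\Omega}{3},\mathcal{L}\right)=-\epsilon\left(\frac12\sum_{c\in V}\frac{9-\wp'\left(\frac{c\Omega}{D}\right)}{3-\wp\left(\frac{c\Omega}{D}\right)}-\#(V)\right).$$ -/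

import Mathlib

open scoped NumberField ComplexConjugate

namespace EisensteinTwists

noncomputable section

/-! ### The field `K = ℚ(√-3)` inside `ℂ` -/

/-- The primitive cube root of unity `ω = (-1 + √-3) / 2`. -/
def ω : ℂ := (-1 + (Real.sqrt 3 : ℂ) * Complex.I) / 2

theorem omega_sq : ω ^ 2 + ω + 1 = 0 := by
  have h : ((Real.sqrt 3 : ℝ) : ℂ) ^ 2 = 3 := by
    rw [← Complex.ofReal_pow, Real.sq_sqrt (by norm_num)]; norm_num
  have hI := Complex.I_sq
  unfold ω
  linear_combination (1 / 4 : ℂ) * Complex.I ^ 2 * h + (3 / 4 : ℂ) * hI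

theorem isIntegral_omega {R : Type*} [CommRing R] [Algebra R ℂ] : IsIntegral R ω := by
  refine IsIntegral.of_pow (n := 3) (by norm_num) ?_
  have : ω ^ 3 = 1 := by linear_combination (ω - 1) * omega_sq
  rw [this]
  exact isIntegral_one

/-- The field `K = ℚ(ω) = ℚ(√-3)`, as a subfield of `ℂ`. -/
abbrev K : IntermediateField ℚ ℂ := IntermediateField.adjoin ℚ {ω}

instance : NumberField K where
  to_charZero := inferInstance
  to_finiteDimensional := IntermediateField.adjoin.finiteDimensional isIntegral_omega

/-- `ω` as an element of the ring of integers of `K`. -/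
def ωO : 𝓞 K :=
  ⟨⟨ω, IntermediateField.mem_adjoin_simple_self ℚ ω⟩,
    (isIntegral_algHom_iff (K.val.restrictScalars ℤ) Subtype.val_injective).mp isIntegral_omega⟩

/-! ### The curve `E : Y² + Y = X³ - 7`, its division fields, and special primes -/

/-- The curve `E : Y² + Y = X³ - 7` over `ℂ`; with `x = X`, `y = 2Y + 1` it is `y² = 4x³ - 27`. -/
def E : WeierstrassCurve.Affine ℂ := { a₁ := 0, a₂ := 0, a₃ := 1, a₄ := 0, a₆ := -7 }

open Classical in
/-- The `X`-coordinates of the nonzero points of `E[N]`. -/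
def torsionX (N : ℕ) : Set ℂ :=
  {x | ∃ (y : ℂ) (h : E.Nonsingular x y), N • (WeierstrassCurve.Affine.Point.some x y h) = 0}

open Classical in
/-- The `Y`-coordinates of the nonzero points of `E[N]`. -/
def torsionY (N : ℕ) : Set ℂ :=
  {y | ∃ (x : ℂ) (h : E.Nonsingular x y), N • (WeierstrassCurve.Affine.Point.some x y h) = 0}

/-- A prime ideal `p` of `R` splits completely in `S`: every prime of `S` above `p` has
ramification index `1` and residue degree `1`. -/
def SplitsCompletely {R : Type*} [CommRing R] (p : Ideal R) (S : Type*) [CommRing S]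
    [Algebra R S] : Prop :=
  ∀ P : Ideal S, P.IsPrime → P.LiesOver p → P.ramificationIdx R = 1 ∧ P.inertiaDeg R = 1

/-- A rational prime `p` is special split if it splits completely in `K(x(E[4]))`. -/
def IsSpecialSplit (p : ℕ) : Prop :=
  p.Prime ∧
    SplitsCompletely (Ideal.span {(p : ℤ)}) (𝓞 (IntermediateField.adjoin K (torsionX 4)))

/-- A nonzero prime `𝔭` of `K` is cubic-special if it splits completely in `K(E[27])`, but not in
`K(E[27])((1 - ω)^{1/9})`. -/
def IsCubicSpecial (𝔭 : Ideal (𝓞 K)) : Prop :=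
  𝔭.IsPrime ∧ 𝔭 ≠ ⊥ ∧
    SplitsCompletely 𝔭 (𝓞 (IntermediateField.adjoin K (torsionX 27 ∪ torsionY 27))) ∧
    ¬ SplitsCompletely 𝔭
      (𝓞 (IntermediateField.adjoin K (torsionX 27 ∪ torsionY 27 ∪ {z : ℂ | z ^ 9 = 1 - ω})))

/-! ### Power residue symbols -/

/-- The Kummer extension `K(a^{1/m})` of `K`. -/
abbrev kummer (m : ℕ) (a : 𝓞 K) : IntermediateField K ℂ :=
  IntermediateField.adjoin K {z : ℂ | z ^ m = ((a : K) : ℂ)}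

/-- `φ` is a Frobenius element of `K(a^{1/m}) / K` for a prime `𝔓` above `𝔭`. -/
def IsFrobenius {m : ℕ} {a : 𝓞 K} (𝔭 : Ideal (𝓞 K)) (φ : kummer m a ≃ₐ[K] kummer m a) : Prop :=
  ∃ 𝔓 : Ideal (𝓞 (kummer m a)), 𝔓.IsPrime ∧ 𝔓.LiesOver 𝔭 ∧
    ∀ x : 𝓞 (kummer m a), φ • x - x ^ Nat.card (𝓞 K ⧸ 𝔭) ∈ 𝔓

/-- `ζ` is the value at the prime `𝔭` of the `m`-th power residue symbol of `a`: the Frobenius of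
`𝔭` multiplies the `m`-th roots of `a` by `ζ`. -/
def IsResidueSymbolAt (m : ℕ) (a : 𝓞 K) (𝔭 : Ideal (𝓞 K)) (ζ : ℂ) : Prop :=
  ∃ φ : kummer m a ≃ₐ[K] kummer m a, IsFrobenius 𝔭 φ ∧
    ∀ α : kummer m a, (α : ℂ) ^ m = ((a : K) : ℂ) → (φ α : ℂ) = ζ * (α : ℂ)

open Classical in
/-- The `m`-th power residue symbol `(a / 𝔭)_m` at a prime `𝔭`. It is meaningful for `μ_m ⊆ K`,
`a ≠ 0` and `𝔭` unramified in `K(a^{1/m})`, and then independent of the choice of the Frobenius. -/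
def residueSymbolAt (m : ℕ) (a : 𝓞 K) (𝔭 : Ideal (𝓞 K)) : ℂ :=
  if h : ∃ ζ : ℂ, IsResidueSymbolAt m a 𝔭 ζ then h.choose else 0

open Classical in
/-- The `m`-th power residue symbol `(a / 𝔟)_m`, for which the Artin symbol `σ_𝔟` satisfies
`σ_𝔟 (a^{1/m}) = (a / 𝔟)_m a^{1/m}`: the product of the symbols over the prime factors of `𝔟`. -/
def residueSymbol (m : ℕ) (a : 𝓞 K) (𝔟 : Ideal (𝓞 K)) : ℂ :=
  ((UniqueFactorizationMonoid.normalizedFactors 𝔟).map (residueSymbolAt m a)).prod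

/-! ### The sets `𝒞` and `V` -/

/-- `C` represents every class of `(𝓞_K / D)^×` exactly once. -/
def RepresentsUnits (D : 𝓞 K) (C : Finset (𝓞 K)) : Prop :=
  Set.BijOn (Ideal.Quotient.mk (Ideal.span {D})) C {u | IsUnit u}

open Classical in
/-- The set `V` of all `c ∈ C` with `(π_j / (3c + D))_m = 1` for all `j`. -/
def V (m : ℕ) {n : ℕ} (π : Fin n → 𝓞 K) (D : 𝓞 K) (C : Finset (𝓞 K)) : Finset (𝓞 K) :=
  C.filter fun c => ∀ j, residueSymbol m (π j) (Ideal.span {3 * c + D}) = 1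

/-! ### Kronecker–Eisenstein series -/

/-- The series `∑_{w ∈ Λ} (z̄ + w̄) / |z + w|^{2s}` (without `w = -z`), convergent for
`Re s > 3/2`. -/
def kroneckerSeries (Λ : Submodule ℤ ℂ) (z s : ℂ) : ℂ :=
  open Classical in
  ∑' w : Λ, if z + w = 0 then 0 else conj (z + (w : ℂ)) / ((‖z + (w : ℂ)‖ : ℝ) : ℂ) ^ (2 * s)

/-- `v` is the value at `s` of the analytic continuation of the series: some function that is
holomorphic on a half plane containing `s`, and given by the series where `Re > 3/2`, takes the
value `v` at `s`. By the identity theorem there is at most one such `v`. -/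
def IsContinuationValue (Λ : Submodule ℤ ℂ) (z s v : ℂ) : Prop :=
  ∃ (σ : ℝ) (F : ℂ → ℂ), σ < s.re ∧ DifferentiableOn ℂ F {t : ℂ | σ < t.re} ∧
    (∀ t : ℂ, σ < t.re → 3 / 2 < t.re → F t = kroneckerSeries Λ z t) ∧ F s = v

open Classical in
/-- The Kronecker–Eisenstein series `H₁(z, s, Λ)`, continued analytically in `s`. -/
def H₁ (z s : ℂ) (Λ : Submodule ℤ ℂ) : ℂ :=
  if h : ∃ v : ℂ, IsContinuationValue Λ z s v then h.choose else 0

/-- The non-holomorphic Eisenstein series `ℰ₁*(z, Λ) = H₁(z, 1, Λ)`. -/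
def E₁star (z : ℂ) (Λ : Submodule ℤ ℂ) : ℂ := H₁ z 1 Λ

end

end EisensteinTwists

/-!
Both formulas are averages of one identity. For `z`, `z ± Ω / 3` outside the lattice,
`ℰ₁*(z + Ω / 3) + ℰ₁*(-z + Ω / 3) = -sgn(Ω) (9 / (3 - ℘(z)) - 2)`
(`E₁star_add_div_three_add_E₁star_neg_add_div_three`). If a set of residues modulo `D` is stable
under `c ↦ -c`, summing over `z = c Ω / D` gives the stated value of the sum of `ℰ₁*`, and the odd
function `℘' / (3 - ℘)` sums to zero, which accounts for the additional term in the cubic case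
(`sum_E₁star_eq`). So the arithmetic input is that `V` is stable under negation modulo `D`.

*The identity.* Subtracting from the Kronecker–Eisenstein series the part of its expansion in
`z / w` that is not absolutely summable at `s = 1` leaves a series that is holomorphic for
`Re s > 1 / 2` and equal to the Weierstrass zeta function `ζ(z)` at `s = 1`. As the lattice is
stable under `ω`, only `(1 - s) z̄` times the Epstein zeta function has to be added back, and
periodicity in `z` expresses that product through the regularized series itself. Hence
`ℰ₁*(z) = ζ(z) - κ z̄` for a constant `κ` (`isContinuationValue_one`, `E₁star_eq`). The addition
formula `ζ(z + t) - ζ(z - t) - 2 ζ(t) = -℘'(t) / (℘(z) - ℘(t))` (`zetaDiff_mul`) follows from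
Liouville's theorem, and at `t = Ω / 3` it becomes the identity, by `℘(t) = 3`,
`℘'(t) = -9 sgn(Ω)` and `ℰ₁*(t) = sgn(Ω)`. For these values one needs the symmetries of the lattice
under `ω` and under complex conjugation, which hold because a lattice is determined by its
invariants (`lattice_eq_of_g₂_of_g₃`). The addition formula at `z = ω t` gives `℘'(t)² = 3 ℘(t)³`
and `3 ℘(t) ℰ₁*(t) = -℘'(t)`; with `℘'² = 4 ℘³ - 27` this leaves a sign, and `℘'` is negative on
the first half of the least real period.

*Stability of `V`.* By reciprocity the symbol `(π / (3c + D))_m` is the `m`-th power residue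
character modulo `π` of `3c + D ≡ 3c` (`residueSymbol_two_eq`, `residueSymbol_three_eq`), and that
character is trivial at `-1`. Reciprocity is needed only between a prime `π` as in the statement and
another prime.

For `m = 3` it is proved by Eisenstein's method (`powerChar_three_reciprocity`). On the lattice
`ℤ[ω]`, Gauss's lemma writes the character as a quotient of products of values `℘(r / l)` over
representatives of the residues modulo the action of `ω`, and a multiplication formula for `℘`
turns the quotient into a double product that is symmetric in the two primes.

For `m = 2`, a prime `π = a + bω ≡ 1` modulo `4` has prime norm `p ≡ 1` modulo `4`. Reducing to
rational residues, the law for another prime of prime norm becomes an identity between Jacobi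
symbols, provable by quadratic reciprocity over `ℤ` (`jacobiSym_form_reciprocity`). At an odd inert
prime `l` one uses `π ^ (l + 1) ≡ p`, and at the prime `2` the symbol is read off from the action of
Frobenius on `(1 + √π) / 2`.
-/

/-! ### Elliptic functions -/

namespace PeriodPair

open Filter Topology

variable (L : PeriodPair)

/-- **Liouville's theorem for elliptic functions**: an elliptic function without poles is constant
(away from the points where its value is a junk value). -/
theorem exists_forall_eq_of_meromorphicOrderAt_nonneg {f : ℂ → ℂ} (hf : Meromorphic f)
    (hper : ∀ z, ∀ w ∈ L.lattice, ∀ᶠ x in 𝓝[≠] z, f (x + w) = f x)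
    (hord : ∀ z, 0 ≤ meromorphicOrderAt f z) :
    ∃ c, ∀ z, Tendsto f (𝓝[≠] z) (𝓝 c) := by
  have hf' : MeromorphicOn f Set.univ := fun z _ => hf z
  set F := toMeromorphicNFOn f Set.univ with hF
  have hFf : ∀ z, f =ᶠ[𝓝[≠] z] F := fun z =>
    (hf'.toMeromorphicNFOn_eq_self_on_nhdsNE (Set.mem_univ z)).symm
  have hFa : ∀ z, AnalyticAt ℂ F z := fun z => by
    rw [← (meromorphicNFOn_toMeromorphicNFOn f Set.univ
      (Set.mem_univ z)).meromorphicOrderAt_nonneg_iff_analyticAt,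
      ← meromorphicOrderAt_congr (hFf z)]
    exact hord z
  have hFper : ∀ z, ∀ w ∈ L.lattice, F (z + w) = F z := by
    intro z w hw
    have h1 : Tendsto (fun x => F (x + w)) (𝓝[≠] z) (𝓝 (F (z + w))) :=
      ((hFa _).continuousAt.comp_of_eq (continuous_add_const w).continuousAt rfl).tendsto.mono_left
        nhdsWithin_le_nhds
    have h2 : Tendsto F (𝓝[≠] z) (𝓝 (F z)) := (hFa z).continuousAt.tendsto.mono_left
      nhdsWithin_le_nhds
    refine tendsto_nhds_unique_of_eventuallyEq h1 h2 ?_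
    have h3 : Tendsto (fun x => x + w) (𝓝[≠] z) (𝓝[≠] (z + w)) :=
      tendsto_nhdsWithin_of_tendsto_nhds_of_eventually_within _
        ((continuous_add_const w).tendsto z |>.mono_left nhdsWithin_le_nhds)
        (by filter_upwards [self_mem_nhdsWithin] with x hx using by simpa using hx)
    filter_upwards [hFf z, h3.eventually (hFf (z + w)), hper z w hw] with x hx hx' hx''
    rw [← hx', hx'', hx]
  have hd : Differentiable ℂ F := fun z => (hFa z).differentiableAt
  refine ⟨F 0, fun z => ?_⟩
  rw [hd.apply_eq_apply_of_bounded (IsZLattice.isCompact_range_of_periodic L.lattice _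
    hd.continuous hFper).isBounded 0 z]
  exact ((hFa z).continuousAt.tendsto.mono_left nhdsWithin_le_nhds).congr' (hFf z).symm

lemma lattice_compl_mem_nhds {z : ℂ} (hz : z ∉ L.lattice) : (L.lattice : Set ℂ)ᶜ ∈ 𝓝 z :=
  L.isClosed_lattice.isOpen_compl.mem_nhds hz

lemma eventually_notMem_lattice (z : ℂ) : ∀ᶠ x in 𝓝[≠] z, x ∉ L.lattice := by
  filter_upwards [self_mem_nhdsWithin, mem_nhdsWithin_of_mem_nhds
    (L.compl_lattice_sdiff_singleton_mem_nhds z)] with x hx hx' h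
  exact hx' ⟨h, hx⟩

/-- The Weierstrass zeta function `ζ(z) = 1 / z + ∑ (1 / (z - l) + 1 / l + z / l²)`; the term
`1 / z` is the summand of `l = 0`, since division by zero gives zero. -/
noncomputable def weierstrassZeta (z : ℂ) : ℂ :=
  ∑' l : L.lattice, (1 / (z - l) + 1 / (l : ℂ) + z / (l : ℂ) ^ 2)

open Classical in
/-- The regular part `ζ(z) - 1 / z` of the Weierstrass zeta function at the origin. -/
noncomputable def weierstrassZetaExcept (z : ℂ) : ℂ :=
  ∑' l : L.lattice, if l = 0 then 0 else (1 / (z - l) + 1 / (l : ℂ) + z / (l : ℂ) ^ 2)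

lemma weierstrassZeta_bound (r : ℝ) (s : ℂ) (hs : ‖s‖ < r) (l : ℂ) (h : 2 * r ≤ ‖l‖) :
    ‖1 / (s - l) + 1 / l + s / l ^ 2‖ ≤ 2 * r ^ 2 * ‖l‖ ^ (-3 : ℝ) := by
  have hr : 0 < r := (norm_nonneg _).trans_lt hs
  have hl : 0 < ‖l‖ := by linarith
  have hl0 : l ≠ 0 := norm_pos_iff.mp hl
  have hsl : s - l ≠ 0 := by
    intro e; rw [sub_eq_zero.mp e] at hs; linarith
  have h1 : 1 / (s - l) + 1 / l + s / l ^ 2 = s ^ 2 / ((s - l) * l ^ 2) := by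
    field_simp; ring
  have h2 : ‖l‖ / 2 ≤ ‖s - l‖ := by
    rw [norm_sub_rev]; exact .trans (by linarith) (norm_sub_norm_le l s)
  have h3 : ‖l‖ ^ (-3 : ℝ) = (‖l‖ ^ 3)⁻¹ := by
    rw [Real.rpow_neg hl.le]; norm_cast
  rw [h1, norm_div, norm_pow, norm_mul, norm_pow, h3]
  calc ‖s‖ ^ 2 / (‖s - l‖ * ‖l‖ ^ 2) ≤ r ^ 2 / (‖l‖ / 2 * ‖l‖ ^ 2) := by gcongr
    _ = _ := by field_simp

open Classical in
lemma hasSumLocallyUniformly_weierstrassZetaExcept :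
    HasSumLocallyUniformly (fun (l : L.lattice) (z : ℂ) ↦
      if l = 0 then 0 else (1 / (z - l) + 1 / (l : ℂ) + z / (l : ℂ) ^ 2))
      L.weierstrassZetaExcept := by
  refine L.hasSumLocallyUniformly_aux (u := (2 * · ^ 2 * ‖·‖ ^ (-3 : ℝ))) _
    (fun _ _ ↦ (ZLattice.summable_norm_rpow _ _ (by simp; norm_num)).mul_left _) fun r hr ↦
    Filter.eventually_atTop.mpr ⟨2 * r, ?_⟩
  rintro _ h s hs l rfl
  split_ifs with hl
  · simp only [norm_zero]; positivity
  · exact weierstrassZeta_bound r s hs l h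

open Classical in
lemma differentiableOn_weierstrassZetaExcept :
    DifferentiableOn ℂ L.weierstrassZetaExcept ((L.lattice : Set ℂ) \ {0})ᶜ := by
  refine L.hasSumLocallyUniformly_weierstrassZetaExcept.hasSumLocallyUniformlyOn.differentiableOn
    (.of_forall fun s ↦ .fun_sum fun i hi ↦ ?_) L.isOpen_compl_lattice_sdiff
  split_ifs with h
  · simp
  · refine .add (.add (.div (by fun_prop) (by fun_prop) fun x hx e => hx ?_) (by fun_prop))
      (by fun_prop)
    rw [sub_eq_zero.mp e]
    exact ⟨i.2, by simpa using h⟩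

lemma hasSum_weierstrassZetaExcept (z : ℂ) : HasSum (fun (l : L.lattice) ↦
      open Classical in if l = 0 then 0 else (1 / (z - l) + 1 / (l : ℂ) + z / (l : ℂ) ^ 2))
      (L.weierstrassZetaExcept z) :=
  L.hasSumLocallyUniformly_weierstrassZetaExcept.hasSum

lemma hasSum_weierstrassZetaExcept_add (z : ℂ) :
    HasSum (fun l : L.lattice ↦ (1 / (z - l) + 1 / (l : ℂ) + z / (l : ℂ) ^ 2))
      (L.weierstrassZetaExcept z + 1 / z) := by
  classical
  have := (L.hasSum_weierstrassZetaExcept z).add (hasSum_ite_eq (0 : L.lattice) (1 / z))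
  refine this.congr_fun ?_
  intro l
  by_cases h : l = 0 <;> simp [h]

lemma weierstrassZeta_eq (z : ℂ) : L.weierstrassZeta z = L.weierstrassZetaExcept z + 1 / z :=
  (L.hasSum_weierstrassZetaExcept_add z).tsum_eq

lemma analyticAt_weierstrassZetaExcept_zero : AnalyticAt ℂ L.weierstrassZetaExcept 0 :=
  L.differentiableOn_weierstrassZetaExcept.analyticAt
    (L.isOpen_compl_lattice_sdiff.mem_nhds (by simp))

lemma analyticAt_weierstrassZeta {z : ℂ} (hz : z ∉ L.lattice) :
    AnalyticAt ℂ L.weierstrassZeta z := by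
  have h0 : z ≠ 0 := by rintro rfl; exact hz (zero_mem _)
  have : AnalyticAt ℂ L.weierstrassZetaExcept z :=
    L.differentiableOn_weierstrassZetaExcept.analyticAt
      (L.isOpen_compl_lattice_sdiff.mem_nhds (fun h => hz h.1))
  rw [show L.weierstrassZeta = fun z => L.weierstrassZetaExcept z + 1 / z from
    funext L.weierstrassZeta_eq]
  fun_prop (disch := exact h0)

lemma deriv_weierstrassZeta {z : ℂ} (hz : z ∉ L.lattice) :
    deriv L.weierstrassZeta z = -L.weierstrassP z := by
  have hopen : IsOpen ((L.lattice : Set ℂ)ᶜ) := L.isClosed_lattice.isOpen_compl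
  have hl : ∀ s ∈ (L.lattice : Set ℂ)ᶜ, ∀ l : L.lattice, s - (l : ℂ) ≠ 0 := fun s hs l e => hs (by
    rw [sub_eq_zero.mp e]; exact l.2)
  classical
  have hlu : TendstoLocallyUniformlyOn (fun (s : Finset L.lattice) (z : ℂ) =>
      ∑ l ∈ s, (1 / (z - (l : ℂ)) + 1 / (l : ℂ) + z / (l : ℂ) ^ 2))
      L.weierstrassZeta atTop (L.lattice : Set ℂ)ᶜ := by
    have h1 := L.hasSumLocallyUniformly_weierstrassZetaExcept.tendstoLocallyUniformlyOn
      (s := (L.lattice : Set ℂ)ᶜ)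
    have h2 : TendstoLocallyUniformlyOn (fun (s : Finset L.lattice) (z : ℂ) =>
      ∑ l ∈ s, if l = 0 then 1 / z else 0) (fun z => 1 / z) atTop (L.lattice : Set ℂ)ᶜ := by
      intro u hu x hx
      refine ⟨Set.univ, Filter.univ_mem, ?_⟩
      filter_upwards [eventually_ge_atTop {0}] with s hs y _
      rw [Finset.sum_ite_eq' , if_pos (hs (by simp))]
      exact refl_mem_uniformity hu
    have h3 := h1.add h2
    refine (h3.congr ?_).congr_right ?_
    · intro s z hz
      simp only [Pi.add_apply]
      rw [← Finset.sum_add_distrib]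
      refine Finset.sum_congr rfl fun l _ => ?_
      by_cases h : l = 0 <;> simp [h]
    · intro z hz
      simp [weierstrassZeta_eq]
  refine (hlu.deriv (.of_forall fun s ↦ ?_) hopen).unique
    (g := fun z => -L.weierstrassP z) ?_ hz
  · refine .fun_sum fun i _ ↦ ?_
    refine .add (.add (.div (by fun_prop) (by fun_prop) fun x hx => hl x hx i) (by fun_prop))
      (by fun_prop)
  · have := L.hasSumLocallyUniformly_weierstrassP.tendstoLocallyUniformlyOn
      (s := (L.lattice : Set ℂ)ᶜ)
    refine this.neg.congr ?_
    intro s z hz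
    simp only [Function.comp_apply, Pi.neg_apply]
    rw [deriv_fun_sum]
    · rw [← Finset.sum_neg_distrib]
      refine Finset.sum_congr rfl fun i _ => ?_
      have h0 := hl z hz i
      have : HasDerivAt (fun x : ℂ => 1 / (x - (i : ℂ)) + 1 / (i : ℂ) + x / (i : ℂ) ^ 2)
          (-1 / (z - i) ^ 2 + 1 / (i : ℂ) ^ 2) z := by
        have h1 : HasDerivAt (fun x : ℂ => 1 / (x - (i : ℂ))) (-1 / (z - i) ^ 2) z := by
          simpa using ((hasDerivAt_id z).sub_const (i : ℂ)).fun_inv h0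
        exact (h1.add_const _).add ((hasDerivAt_id z).div_const _)
      rw [this.deriv]; ring
    · intro i _
      have h0 := hl z hz i
      fun_prop (disch := exact h0)

lemma hasDerivAt_weierstrassZeta {z : ℂ} (hz : z ∉ L.lattice) :
    HasDerivAt L.weierstrassZeta (-L.weierstrassP z) z := by
  rw [← L.deriv_weierstrassZeta hz]
  exact (L.analyticAt_weierstrassZeta hz).differentiableAt.hasDerivAt

@[simp] lemma weierstrassZeta_neg (z : ℂ) : L.weierstrassZeta (-z) = -L.weierstrassZeta z := by
  simp only [weierstrassZeta]
  rw [← (Equiv.neg L.lattice).tsum_eq, ← tsum_neg]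
  congr with l
  have : (-z - -(l : ℂ)) = -(z - l) := by ring
  simp only [Equiv.neg_apply, NegMemClass.coe_neg, this, one_div, inv_neg, neg_sq]
  ring

lemma exists_weierstrassZeta_add {w : ℂ} (hw : w ∈ L.lattice) :
    ∃ η, ∀ z ∉ L.lattice, L.weierstrassZeta (z + w) = L.weierstrassZeta z + η := by
  obtain ⟨a, ha⟩ : ∃ a, a ∉ L.lattice := ⟨_, L.ω₁_div_two_notMem_lattice⟩
  refine ⟨L.weierstrassZeta (a + w) - L.weierstrassZeta a, fun z hz => ?_⟩
  have hmem : ∀ x ∉ L.lattice, x + w ∉ L.lattice := fun x hx h => hx (by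
    simpa using sub_mem h hw)
  have hconn : IsPreconnected ((L.lattice : Set ℂ)ᶜ) :=
    (Set.Countable.isConnected_compl_of_one_lt_rank (by simp)
      (countable_of_Lindelof_of_discrete (X := L.lattice))).2
  have := L.isClosed_lattice.isOpen_compl.eqOn_of_deriv_eq (𝕜 := ℂ) hconn
    (f := fun x => L.weierstrassZeta (x + w))
    (g := fun x => L.weierstrassZeta x + (L.weierstrassZeta (a + w) - L.weierstrassZeta a))
    (fun x hx => by
      refine DifferentiableAt.differentiableWithinAt ?_
      exact ((L.hasDerivAt_weierstrassZeta (hmem x hx)).comp_add_const x w).differentiableAt)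
    (fun x hx => by
      refine DifferentiableAt.differentiableWithinAt ?_
      exact ((L.hasDerivAt_weierstrassZeta hx).add_const _).differentiableAt)
    (fun x hx => by
      rw [((L.hasDerivAt_weierstrassZeta (hmem x hx)).comp_add_const x w).deriv,
        ((L.hasDerivAt_weierstrassZeta hx).add_const _).deriv]
      rw [L.weierstrassP_add_coe x ⟨w, hw⟩])
    (x := a) ha (by simp)
  exact this hz

/-- Around a lattice point the zeta function is a translate of its expansion at the origin. -/
lemma exists_weierstrassZeta_eventuallyEq {l : ℂ} (hl : l ∈ L.lattice) :
    ∃ η, L.weierstrassZeta =ᶠ[𝓝[≠] l]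
      fun z => L.weierstrassZetaExcept (z - l) + η + (z - l) ^ (-1 : ℤ) := by
  obtain ⟨η, hη⟩ := L.exists_weierstrassZeta_add hl
  refine ⟨η, ?_⟩
  filter_upwards [L.eventually_notMem_lattice l] with z hz
  have h1 : z - l ∉ L.lattice := fun h => hz (by simpa using add_mem h hl)
  have := hη (z - l) h1
  rw [sub_add_cancel] at this
  rw [this, weierstrassZeta_eq, zpow_neg_one, one_div]
  ring

lemma analyticAt_weierstrassZetaExcept_sub (l η : ℂ) :
    AnalyticAt ℂ (fun z => L.weierstrassZetaExcept (z - l) + η) l := by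
  refine AnalyticAt.add ?_ analyticAt_const
  exact L.analyticAt_weierstrassZetaExcept_zero.comp_of_eq (f := fun z => z - l) (by fun_prop)
    (by simp)

lemma meromorphic_weierstrassZeta : Meromorphic L.weierstrassZeta := by
  intro z
  by_cases hz : z ∈ L.lattice
  · obtain ⟨η, h⟩ := L.exists_weierstrassZeta_eventuallyEq hz
    refine MeromorphicAt.congr ?_ h.symm
    have := (L.analyticAt_weierstrassZetaExcept_sub z η).meromorphicAt
    fun_prop
  · exact (L.analyticAt_weierstrassZeta hz).meromorphicAt

lemma neg_one_le_meromorphicOrderAt_weierstrassZeta (z : ℂ) :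
    ((-1 : ℤ) : WithTop ℤ) ≤ meromorphicOrderAt L.weierstrassZeta z := by
  by_cases hz : z ∈ L.lattice
  · obtain ⟨η, h⟩ := L.exists_weierstrassZeta_eventuallyEq hz
    have h1 := L.analyticAt_weierstrassZetaExcept_sub z η
    rw [meromorphicOrderAt_congr h]
    refine le_trans (le_min ?_ ?_) (meromorphicOrderAt_add h1.meromorphicAt (by fun_prop))
    · exact le_trans (by norm_cast) h1.meromorphicOrderAt_nonneg
    · rw [fun_meromorphicOrderAt_zpow_id_sub_const]
  · exact le_trans (by norm_cast) (L.analyticAt_weierstrassZeta hz).meromorphicOrderAt_nonneg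

lemma tendsto_sub_mul_weierstrassZeta {l : ℂ} (hl : l ∈ L.lattice) :
    Tendsto (fun z => (z - l) * L.weierstrassZeta z) (𝓝[≠] l) (𝓝 1) := by
  obtain ⟨η, h⟩ := L.exists_weierstrassZeta_eventuallyEq hl
  have h1 := (L.analyticAt_weierstrassZetaExcept_sub l η).continuousAt
  have h2 : Tendsto (fun z => (z - l) * (L.weierstrassZetaExcept (z - l) + η) + 1) (𝓝[≠] l)
      (𝓝 1) := by
    have : ContinuousAt (fun z => (z - l) * (L.weierstrassZetaExcept (z - l) + η) + 1) l :=
      (ContinuousAt.mul (by fun_prop) h1).add continuousAt_const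
    simpa using this.tendsto.mono_left nhdsWithin_le_nhds
  refine h2.congr' ?_
  filter_upwards [h, self_mem_nhdsWithin] with z hz hz'
  have : z - l ≠ 0 := sub_ne_zero.mpr hz'
  rw [hz, zpow_neg_one]
  field_simp

lemma hasDerivAt_weierstrassP {z : ℂ} (hz : z ∉ L.lattice) :
    HasDerivAt L.weierstrassP (L.derivWeierstrassP z) z := by
  rw [← deriv_weierstrassP]
  exact (L.analyticOnNhd_weierstrassP z hz).differentiableAt.hasDerivAt

/-- The difference `ζ(z + t) - ζ(z - t) - 2 ζ(t)`, an elliptic function of `z`. -/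
noncomputable def zetaDiff (t z : ℂ) : ℂ :=
  L.weierstrassZeta (z + t) - L.weierstrassZeta (z - t) - 2 * L.weierstrassZeta t

lemma eventually_add_notMem_lattice (z t : ℂ) : ∀ᶠ x in 𝓝[≠] z, x + t ∉ L.lattice := by
  have h3 : Tendsto (fun x => x + t) (𝓝[≠] z) (𝓝[≠] (z + t)) :=
    tendsto_nhdsWithin_of_tendsto_nhds_of_eventually_within _
      ((continuous_add_const t).tendsto z |>.mono_left nhdsWithin_le_nhds)
      (by filter_upwards [self_mem_nhdsWithin] with x hx using by simpa using hx)
  exact h3.eventually (L.eventually_notMem_lattice (z + t))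

lemma zetaDiff_add {t z w : ℂ} (hw : w ∈ L.lattice) (h1 : z + t ∉ L.lattice)
    (h2 : z - t ∉ L.lattice) : L.zetaDiff t (z + w) = L.zetaDiff t z := by
  obtain ⟨η, hη⟩ := L.exists_weierstrassZeta_add hw
  have e1 := hη _ h1
  have e2 := hη _ h2
  rw [zetaDiff, zetaDiff, show z + w + t = z + t + w by ring,
    show z + w - t = z - t + w by ring, e1, e2]
  ring

lemma meromorphic_comp_add {f : ℂ → ℂ} (hf : Meromorphic f) (t : ℂ) :
    Meromorphic (fun z => f (z + t)) := fun z =>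
  (hf (z + t)).comp_analyticAt (g := fun z => z + t) (by fun_prop)

lemma meromorphic_zetaDiff (t : ℂ) : Meromorphic (L.zetaDiff t) := by
  have h1 := meromorphic_comp_add L.meromorphic_weierstrassZeta t
  have h2 := meromorphic_comp_add L.meromorphic_weierstrassZeta (-t)
  simp only [← sub_eq_add_neg] at h2
  intro z
  exact ((h1 z).sub (h2 z)).sub (MeromorphicAt.const _ _)

lemma analyticAt_zetaDiff {t z : ℂ} (h1 : z + t ∉ L.lattice) (h2 : z - t ∉ L.lattice) :
    AnalyticAt ℂ (L.zetaDiff t) z := by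
  refine AnalyticAt.sub (AnalyticAt.sub ?_ ?_) analyticAt_const
  · exact (L.analyticAt_weierstrassZeta h1).comp_of_eq (f := fun z => z + t) (by fun_prop) rfl
  · exact (L.analyticAt_weierstrassZeta h2).comp_of_eq (f := fun z => z - t) (by fun_prop) rfl

lemma hasDerivAt_zetaDiff {t z : ℂ} (h1 : z + t ∉ L.lattice) (h2 : z - t ∉ L.lattice) :
    HasDerivAt (L.zetaDiff t) (-L.weierstrassP (z + t) + L.weierstrassP (z - t)) z := by
  have := (((L.hasDerivAt_weierstrassZeta h1).comp_add_const z t).sub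
    ((L.hasDerivAt_weierstrassZeta h2).comp_sub_const z t)).sub_const
    (2 * L.weierstrassZeta t)
  exact this.congr_deriv (by ring)

/-- The function `ζ(z + t) - ζ(z - t) - 2 ζ(t)` vanishes to order two at the origin. -/
lemma two_le_meromorphicOrderAt_zetaDiff {t : ℂ} (ht : t ∉ L.lattice) :
    ((2 : ℤ) : WithTop ℤ) ≤ meromorphicOrderAt (L.zetaDiff t) 0 := by
  have h1 : 0 + t ∉ L.lattice := by simpa
  have h2 : 0 - t ∉ L.lattice := by simpa
  have ha := L.analyticAt_zetaDiff h1 h2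
  have h : ((2 : ℕ) : ℕ∞) ≤ analyticOrderAt (L.zetaDiff t) 0 := by
    rw [natCast_le_analyticOrderAt_iff_iteratedDeriv_eq_zero ha]
    intro i hi
    interval_cases i
    · simp [zetaDiff, two_mul]
    · rw [iteratedDeriv_one, (L.hasDerivAt_zetaDiff h1 h2).deriv]; simp
  rw [ha.meromorphicOrderAt_eq]
  have := ENat.monotone_map_iff.mpr (Nat.mono_cast (α := ℤ)) h
  simpa using this

lemma neg_one_le_meromorphicOrderAt_zetaDiff (t z : ℂ) :
    ((-1 : ℤ) : WithTop ℤ) ≤ meromorphicOrderAt (L.zetaDiff t) z := by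
  have h1 := meromorphic_comp_add L.meromorphic_weierstrassZeta t
  have h2 := meromorphic_comp_add L.meromorphic_weierstrassZeta (-t)
  have o1 : ((-1 : ℤ) : WithTop ℤ) ≤
      meromorphicOrderAt (fun z => L.weierstrassZeta (z + t)) z :=
    (L.neg_one_le_meromorphicOrderAt_weierstrassZeta (z + t)).trans_eq
      meromorphicOrderAt_comp_add_const_eq_meromorphicOrderAt.symm
  have o2 : ((-1 : ℤ) : WithTop ℤ) ≤
      meromorphicOrderAt (fun z => -L.weierstrassZeta (z + -t)) z := by
    rw [← meromorphicOrderAt_fun_neg]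
    exact (L.neg_one_le_meromorphicOrderAt_weierstrassZeta (z + -t)).trans_eq
      meromorphicOrderAt_comp_add_const_eq_meromorphicOrderAt.symm
  have o3 : ((-1 : ℤ) : WithTop ℤ) ≤
      meromorphicOrderAt (fun _ : ℂ => -(2 * L.weierstrassZeta t)) z :=
    le_trans (by norm_cast) (analyticAt_const (x := z)).meromorphicOrderAt_nonneg
  have e : L.zetaDiff t = (fun z => L.weierstrassZeta (z + t)) +
      (fun z => -L.weierstrassZeta (z + -t)) + fun _ => -(2 * L.weierstrassZeta t) := by
    funext x
    simp only [zetaDiff, Pi.add_apply]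
    rw [sub_eq_add_neg x t]
    ring
  have h12 := meromorphicOrderAt_add (h1 z) (h2 z).neg
  rw [e]
  refine le_trans (le_min (le_trans (le_min o1 o2) h12) o3)
    (meromorphicOrderAt_add ((h1 z).add (h2 z).neg) (MeromorphicAt.const _ _))

lemma meromorphicOrderAt_weierstrassP_sub_nonneg {z : ℂ} (hz : z ∉ L.lattice) (a : ℂ) :
    0 ≤ meromorphicOrderAt (fun z => L.weierstrassP z - a) z :=
  ((L.analyticOnNhd_weierstrassP z hz).sub analyticAt_const).meromorphicOrderAt_nonneg

lemma one_le_meromorphicOrderAt_weierstrassP_sub {z : ℂ} (hz : z ∉ L.lattice) {a : ℂ}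
    (h : L.weierstrassP z = a) :
    ((1 : ℤ) : WithTop ℤ) ≤ meromorphicOrderAt (fun z => L.weierstrassP z - a) z := by
  have ha : AnalyticAt ℂ (fun z => L.weierstrassP z - a) z :=
    (L.analyticOnNhd_weierstrassP z hz).sub analyticAt_const
  have h : ((1 : ℕ) : ℕ∞) ≤ analyticOrderAt (fun z => L.weierstrassP z - a) z := by
    rw [natCast_le_analyticOrderAt_iff_iteratedDeriv_eq_zero ha]
    intro i hi
    interval_cases i
    simp [h]
  rw [ha.meromorphicOrderAt_eq]
  have := ENat.monotone_map_iff.mpr (Nat.mono_cast (α := ℤ)) h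
  simpa using this

lemma meromorphic_weierstrassP_sub (a : ℂ) : Meromorphic (fun z => L.weierstrassP z - a) :=
  fun z => (L.meromorphic_weierstrassP z).sub (MeromorphicAt.const _ _)

lemma neg_two_le_meromorphicOrderAt_weierstrassP_sub_zero (a : ℂ) :
    ((-2 : ℤ) : WithTop ℤ) ≤ meromorphicOrderAt (fun z => L.weierstrassP z - a) 0 := by
  have e : (fun z => L.weierstrassP z - a) = L.weierstrassP + fun _ => -a := by
    funext z; simp [sub_eq_add_neg]
  rw [e]
  refine le_trans (le_min ?_ ?_)
    (meromorphicOrderAt_add (L.meromorphic_weierstrassP 0) (MeromorphicAt.const _ _))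
  · exact (L.order_weierstrassP 0 (zero_mem _)).ge
  · exact le_trans (by norm_cast) (analyticAt_const (x := (0 : ℂ))).meromorphicOrderAt_nonneg

lemma exists_tendsto_zetaDiff_mul {t : ℂ} (ht : t ∉ L.lattice) : ∃ c, ∀ z,
    Tendsto (fun z => L.zetaDiff t z * (L.weierstrassP z - L.weierstrassP t)) (𝓝[≠] z)
      (𝓝 c) := by
  have hm1 := L.meromorphic_zetaDiff t
  have hm2 := L.meromorphic_weierstrassP_sub (L.weierstrassP t)
  have hper : ∀ z, ∀ w ∈ L.lattice, ∀ᶠ x in 𝓝[≠] z,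
      L.zetaDiff t (x + w) * (L.weierstrassP (x + w) - L.weierstrassP t) =
      L.zetaDiff t x * (L.weierstrassP x - L.weierstrassP t) := by
    intro z w hw
    filter_upwards [L.eventually_add_notMem_lattice z t, L.eventually_add_notMem_lattice z (-t)]
      with x h1 h2
    rw [← sub_eq_add_neg] at h2
    rw [L.zetaDiff_add hw h1 h2, L.weierstrassP_add_coe x ⟨w, hw⟩]
  refine L.exists_forall_eq_of_meromorphicOrderAt_nonneg (fun z => (hm1 z).mul (hm2 z)) hper
    fun z => ?_
  by_cases hz : z ∈ L.lattice
  · -- by periodicity it is enough to look at the origin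
    have h0 : meromorphicOrderAt
        (fun z => L.zetaDiff t z * (L.weierstrassP z - L.weierstrassP t)) z =
        meromorphicOrderAt
        (fun z => L.zetaDiff t z * (L.weierstrassP z - L.weierstrassP t)) 0 := by
      rw [← meromorphicOrderAt_congr (hper 0 z hz)]
      have := meromorphicOrderAt_comp_add_const_eq_meromorphicOrderAt (x := (0 : ℂ)) (c := z)
        (f := fun z => L.zetaDiff t z * (L.weierstrassP z - L.weierstrassP t))
      rw [zero_add] at this
      exact this.symm
    rw [h0, fun_meromorphicOrderAt_mul (hm1 0) (hm2 0)]
    exact le_trans (by norm_cast) (add_le_add (L.two_le_meromorphicOrderAt_zetaDiff ht)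
      (L.neg_two_le_meromorphicOrderAt_weierstrassP_sub_zero _))
  rw [fun_meromorphicOrderAt_mul (hm1 z) (hm2 z)]
  by_cases h12 : z + t ∉ L.lattice ∧ z - t ∉ L.lattice
  · exact add_nonneg (L.analyticAt_zetaDiff h12.1 h12.2).meromorphicOrderAt_nonneg
      (L.meromorphicOrderAt_weierstrassP_sub_nonneg hz _)
  · have : L.weierstrassP z = L.weierstrassP t := by
      by_cases h1 : z + t ∈ L.lattice
      · have := L.weierstrassP_add_coe (-t) ⟨_, h1⟩
        simpa using this
      · have h2 : z - t ∈ L.lattice := by tauto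
        have := L.weierstrassP_add_coe t ⟨_, h2⟩
        simpa using this
    exact le_trans (by norm_cast) (add_le_add (L.neg_one_le_meromorphicOrderAt_zetaDiff t z)
      (L.one_le_meromorphicOrderAt_weierstrassP_sub hz this))

lemma tendsto_sub_mul_zetaDiff {t : ℂ} (ht : 2 * t ∉ L.lattice) :
    Tendsto (fun z => (z - t) * L.zetaDiff t z) (𝓝[≠] t) (𝓝 (-1)) := by
  have e1 : Tendsto (fun z => (z - t) * L.weierstrassZeta (z - t)) (𝓝[≠] t) (𝓝 1) := by
    have h3 : Tendsto (fun x => x - t) (𝓝[≠] t) (𝓝[≠] 0) :=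
      tendsto_nhdsWithin_of_tendsto_nhds_of_eventually_within _
        (by simpa using ((continuous_sub_right t).tendsto t |>.mono_left nhdsWithin_le_nhds))
        (by filter_upwards [self_mem_nhdsWithin] with x hx using by simpa [sub_eq_zero] using hx)
    simpa [Function.comp_def] using
      (L.tendsto_sub_mul_weierstrassZeta (zero_mem L.lattice)).comp h3
  have e2 : ContinuousAt (fun z => (z - t) * (L.weierstrassZeta (z + t) -
      2 * L.weierstrassZeta t)) t := by
    refine ContinuousAt.mul (by fun_prop) (ContinuousAt.sub ?_ continuousAt_const)
    exact ContinuousAt.comp (f := fun z => z + t) (x := t)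
      (L.analyticAt_weierstrassZeta (by rwa [← two_mul])).continuousAt (by fun_prop)
  have e2' := e2.tendsto.mono_left (nhdsWithin_le_nhds (s := {t}ᶜ))
  have := e2'.sub e1
  simp only [sub_self, zero_mul, zero_sub] at this
  refine this.congr fun z => ?_
  rw [zetaDiff]; ring

/-- An addition formula for the zeta function, cleared of denominators:
`(ζ(z + t) - ζ(z - t) - 2 ζ(t)) (℘(z) - ℘(t)) = -℘'(t)`. The left-hand side is elliptic without
poles; its constant value is found at the simple pole `z = t` of the first factor. -/
theorem zetaDiff_mul {t z : ℂ} (ht : 2 * t ∉ L.lattice) (hz : z ∉ L.lattice)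
    (h1 : z + t ∉ L.lattice) (h2 : z - t ∉ L.lattice) :
    L.zetaDiff t z * (L.weierstrassP z - L.weierstrassP t) = -L.derivWeierstrassP t := by
  have ht' : t ∉ L.lattice := fun h => ht (by rw [two_mul]; exact add_mem h h)
  obtain ⟨c, hc⟩ := L.exists_tendsto_zetaDiff_mul ht'
  have hval : c = -L.derivWeierstrassP t := by
    refine tendsto_nhds_unique (hc t) ?_
    have hA := L.tendsto_sub_mul_zetaDiff ht
    have hB : Tendsto (fun z => (z - t)⁻¹ * (L.weierstrassP z - L.weierstrassP t)) (𝓝[≠] t)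
        (𝓝 (L.derivWeierstrassP t)) := by
      have := (hasDerivAt_iff_tendsto_slope.mp (L.hasDerivAt_weierstrassP ht'))
      simpa [slope_fun_def] using this
    have := hA.mul hB
    rw [neg_one_mul] at this
    refine this.congr' ?_
    filter_upwards [self_mem_nhdsWithin] with z hz
    have : z - t ≠ 0 := sub_ne_zero.mpr hz
    field_simp
  rw [← hval]
  have hcont : ContinuousAt
      (fun z => L.zetaDiff t z * (L.weierstrassP z - L.weierstrassP t)) z :=
    ((L.analyticAt_zetaDiff h1 h2).mul
      ((L.analyticOnNhd_weierstrassP z hz).sub analyticAt_const)).continuousAt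
  exact tendsto_nhds_unique (hcont.tendsto.mono_left nhdsWithin_le_nhds) (hc z)

/-- If `℘'(t) = 0`, the addition formula would force `ζ(z + t) - ζ(z - t)` to be constant,
although it has a pole at `z = t`. -/
theorem derivWeierstrassP_ne_zero {t : ℂ} (ht : 2 * t ∉ L.lattice) :
    L.derivWeierstrassP t ≠ 0 := by
  intro h0
  have ht' : t ∉ L.lattice := fun h => ht (by rw [two_mul]; exact add_mem h h)
  have hA := L.tendsto_sub_mul_zetaDiff ht
  have hP : ∀ᶠ z in 𝓝[≠] t, L.weierstrassP z - L.weierstrassP t = 0 := by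
    filter_upwards [hA.eventually_ne (by norm_num : (-1 : ℂ) ≠ 0),
      L.eventually_notMem_lattice t, L.eventually_add_notMem_lattice t t,
      L.eventually_add_notMem_lattice t (-t)] with z h hz h1 h2
    rw [← sub_eq_add_neg] at h2
    have := L.zetaDiff_mul ht hz h1 h2
    rw [h0, neg_zero] at this
    exact (mul_eq_zero.mp this).resolve_left (right_ne_zero_of_mul h)
  have hord : meromorphicOrderAt (fun z => L.weierstrassP z - L.weierstrassP t) 0 ≠ ⊤ := by
    have e : (fun z => L.weierstrassP z - L.weierstrassP t) =
        L.weierstrassP + fun _ => -L.weierstrassP t := by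
      funext z; simp [sub_eq_add_neg]
    rw [e, meromorphicOrderAt_add_eq_left_of_lt (MeromorphicAt.const _ _)]
    · rw [L.order_weierstrassP 0 (zero_mem _)]; exact fun h => by cases h
    · rw [L.order_weierstrassP 0 (zero_mem _)]
      exact lt_of_lt_of_le (by decide) (analyticAt_const (x := (0 : ℂ))).meromorphicOrderAt_nonneg
  have hm : MeromorphicOn (fun z => L.weierstrassP z - L.weierstrassP t) Set.univ :=
    fun z _ => L.meromorphic_weierstrassP_sub _ z
  exact hm.meromorphicOrderAt_ne_top_of_isPreconnected isPreconnected_univ (Set.mem_univ 0)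
    (Set.mem_univ t) hord (meromorphicOrderAt_eq_top_iff.mpr hP)

/-- Away from the two-torsion, `℘` takes the value `℘(t)` only at `±t`. -/
theorem weierstrassP_ne {t z : ℂ} (ht : 2 * t ∉ L.lattice) (hz : z ∉ L.lattice)
    (h1 : z + t ∉ L.lattice) (h2 : z - t ∉ L.lattice) :
    L.weierstrassP z - L.weierstrassP t ≠ 0 := by
  intro h
  have := L.zetaDiff_mul ht hz h1 h2
  rw [h, mul_zero] at this
  exact L.derivWeierstrassP_ne_zero ht (neg_eq_zero.mp this.symm)

end PeriodPair

/-! ### The continuation of the Kronecker–Eisenstein series -/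

namespace EisensteinTwists

open Filter Topology

lemma norm_omega : ‖ω‖ = 1 := by
  have h : ω ^ 3 = 1 := by linear_combination (ω - 1) * omega_sq
  have : ‖ω‖ ^ 3 = 1 := by rw [← norm_pow, h, norm_one]
  exact (pow_eq_one_iff_of_nonneg (norm_nonneg _) (by norm_num)).mp this

lemma conj_omega : conj ω = ω ^ 2 := by
  have h3 : ω ^ 3 = 1 := by linear_combination (ω - 1) * omega_sq
  have h1 : conj ω * ω = 1 := by
    rw [← Complex.normSq_eq_conj_mul_self, Complex.normSq_eq_norm_sq, norm_omega]; simp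
  have h0 : ω ≠ 0 := by intro h; simp [h] at h1
  refine mul_right_cancel₀ h0 ?_
  rw [h1]; linear_combination -h3

/-- The expansion `(1 + ε̄) |1 + ε|^{-2s} = 1 + (1 - s) ε̄ - s ε + O(|ε|²)`, uniformly for bounded
`s`. -/
lemma norm_binomial_remainder_le {M : ℝ} (s ε : ℂ) (hs : ‖s‖ ≤ M) (hε : ‖ε‖ ≤ 1 / 2) :
    ‖(1 + conj ε) * Complex.exp (-s * (2 * Real.log ‖1 + ε‖ : ℝ)) - 1 - (1 - s) * conj ε + s * ε‖
      ≤ (5 * M + 27 / 2 * M ^ 2 * Real.exp (3 / 2 * M)) * ‖ε‖ ^ 2 := by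
  have hM : 0 ≤ M := (norm_nonneg _).trans hs
  set lam := Complex.log (1 + ε) with hlam
  set ℓ : ℂ := ((2 * Real.log ‖1 + ε‖ : ℝ) : ℂ) with hℓ
  have hℓlam : ℓ = lam + conj lam := by
    rw [Complex.add_conj, hlam, Complex.log_re, hℓ]
  have h1 : ‖lam - ε‖ ≤ ‖ε‖ ^ 2 := by
    refine (Complex.norm_log_one_add_sub_self_le (by linarith)).trans ?_
    have : (1 - ‖ε‖)⁻¹ ≤ 2 := by
      rw [inv_le_comm₀ (by linarith) (by norm_num)]; linarith
    nlinarith [sq_nonneg ‖ε‖]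
  have h2 : ‖ℓ - (ε + conj ε)‖ ≤ 2 * ‖ε‖ ^ 2 := by
    have : ℓ - (ε + conj ε) = (lam - ε) + conj (lam - ε) := by
      rw [hℓlam, map_sub]; ring
    rw [this]
    refine (norm_add_le _ _).trans ?_
    rw [RCLike.norm_conj]; linarith
  have h3 : ‖ℓ‖ ≤ 3 * ‖ε‖ := by
    have : ℓ = (ℓ - (ε + conj ε)) + (ε + conj ε) := by ring
    rw [this]
    refine (norm_add_le _ _).trans ?_
    have := norm_add_le ε (conj ε)
    rw [RCLike.norm_conj] at this
    nlinarith [norm_nonneg ε]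
  have hsl : ‖-s * ℓ‖ ≤ M * (3 * ‖ε‖) := by
    rw [norm_mul, norm_neg]; gcongr
  set E := Complex.exp (-s * ℓ) - 1 - (-s * ℓ) with hE
  have h4 : ‖E‖ ≤ 9 * M ^ 2 * Real.exp (3 / 2 * M) * ‖ε‖ ^ 2 := by
    have := Complex.norm_exp_sub_sum_le_norm_mul_exp (-s * ℓ) 2
    simp only [Finset.sum_range_succ, Finset.range_zero, Finset.sum_empty, pow_zero,
      Nat.factorial, pow_one, zero_add, Nat.cast_one, div_one, mul_one] at this
    rw [← sub_sub] at this
    refine this.trans ?_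
    calc ‖-s * ℓ‖ ^ 2 * Real.exp ‖-s * ℓ‖ ≤ (M * (3 * ‖ε‖)) ^ 2 * Real.exp (3 / 2 * M) := by
          gcongr
          refine hsl.trans ?_
          nlinarith
      _ = _ := by ring
  have key : (1 + conj ε) * Complex.exp (-s * ℓ) - 1 - (1 - s) * conj ε + s * ε =
      -s * (ℓ - (ε + conj ε)) + (-s * ℓ) * conj ε + (1 + conj ε) * E := by
    rw [hE]; ring
  rw [key]
  have h5 : ‖(1 : ℂ) + conj ε‖ ≤ 3 / 2 := by
    refine (norm_add_le _ _).trans ?_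
    rw [RCLike.norm_conj, norm_one]; linarith
  calc _ ≤ ‖-s * (ℓ - (ε + conj ε))‖ + ‖(-s * ℓ) * conj ε‖ + ‖(1 + conj ε) * E‖ :=
        norm_add₃_le
    _ ≤ M * (2 * ‖ε‖ ^ 2) + M * (3 * ‖ε‖) * ‖ε‖ +
        3 / 2 * (9 * M ^ 2 * Real.exp (3 / 2 * M) * ‖ε‖ ^ 2) := by
        gcongr
        · rw [norm_mul, norm_neg]; gcongr
        · rw [norm_mul, RCLike.norm_conj]; gcongr
        · rw [norm_mul]; gcongr
    _ = _ := by ring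

/-- The summand of the Kronecker–Eisenstein series without the part of its expansion in `z / w`
that does not converge absolutely at `s = 1`. For `w = 0` the subtracted part is zero, since it is a
quotient by `0 ^ (2 * s) = 0`. -/
noncomputable def kroneckerTerm (z s w : ℂ) : ℂ :=
  conj (z + w) / ((‖z + w‖ : ℝ) : ℂ) ^ (2 * s) -
    (conj w + (1 - s) * conj z - s * z * conj w / w) / ((‖w‖ : ℝ) : ℂ) ^ (2 * s)

lemma norm_kroneckerTerm_le {M σ : ℝ} {z s w : ℂ} (hs : ‖s‖ ≤ M) (hσ : σ ≤ s.re)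
    (hw : 2 * ‖z‖ ≤ ‖w‖) (hw1 : 1 ≤ ‖w‖) :
    ‖kroneckerTerm z s w‖ ≤
      (5 * M + 27 / 2 * M ^ 2 * Real.exp (3 / 2 * M)) * ‖z‖ ^ 2 * ‖w‖ ^ (-1 - 2 * σ) := by
  have hw0 : 0 < ‖w‖ := by linarith
  have hwne : w ≠ 0 := norm_pos_iff.mp hw0
  have hcw : conj w ≠ 0 := by simpa using hwne
  set ε := z / w with hε
  have hεn : ‖ε‖ ≤ 1 / 2 := by
    rw [hε, norm_div, div_le_iff₀ hw0]; linarith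
  have hz : z = w * ε := by rw [hε]; field_simp
  have h1ε : 0 < ‖1 + ε‖ := by
    rw [norm_pos_iff]; intro h
    have : ε = -1 := by linear_combination h
    rw [this] at hεn; norm_num at hεn
  have hnorm : ‖z + w‖ = ‖w‖ * ‖1 + ε‖ := by rw [← norm_mul, hz]; congr 1; ring
  have hpow : (((‖z + w‖ : ℝ) : ℂ) ^ (2 * s))⁻¹ = (((‖w‖ : ℝ) : ℂ) ^ (2 * s))⁻¹ *
      Complex.exp (-s * (2 * Real.log ‖1 + ε‖ : ℝ)) := by
    rw [hnorm, Complex.ofReal_mul, Complex.mul_cpow_ofReal_nonneg hw0.le h1ε.le, mul_inv]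
    congr 1
    rw [Complex.cpow_def_of_ne_zero (by exact_mod_cast h1ε.ne'), ← Complex.exp_neg,
      Complex.ofReal_mul, Complex.ofReal_log h1ε.le]
    congr 1; push_cast; ring
  have key : kroneckerTerm z s w = conj w * (((‖w‖ : ℝ) : ℂ) ^ (2 * s))⁻¹ *
      ((1 + conj ε) * Complex.exp (-s * (2 * Real.log ‖1 + ε‖ : ℝ)) - 1 - (1 - s) * conj ε
        + s * ε) := by
    rw [kroneckerTerm, div_eq_mul_inv, hpow, div_eq_mul_inv, hz]
    simp only [map_add, map_mul]
    field_simp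
    ring
  rw [key, norm_mul, norm_mul, RCLike.norm_conj, norm_inv,
    Complex.norm_cpow_eq_rpow_re_of_pos hw0]
  have hre : (2 * s).re = 2 * s.re := by simp
  have hεz : ‖ε‖ ^ 2 = ‖z‖ ^ 2 * (‖w‖ ^ 2)⁻¹ := by rw [hε, norm_div, div_pow]; rfl
  have hb := norm_binomial_remainder_le s ε hs hεn
  have hM : 0 ≤ M := (norm_nonneg _).trans hs
  rw [hre]
  calc _ ≤ ‖w‖ * (‖w‖ ^ (2 * s.re))⁻¹ *
        ((5 * M + 27 / 2 * M ^ 2 * Real.exp (3 / 2 * M)) * ‖ε‖ ^ 2) := by gcongr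
    _ = (5 * M + 27 / 2 * M ^ 2 * Real.exp (3 / 2 * M)) * ‖z‖ ^ 2 * ‖w‖ ^ (-1 - 2 * s.re) := by
        rw [hεz, show (-1 - 2 * s.re : ℝ) = 1 + (-(2 * s.re) + (-2 : ℝ)) by ring,
          Real.rpow_add hw0, Real.rpow_add hw0, Real.rpow_neg hw0.le, Real.rpow_one,
          Real.rpow_neg hw0.le, Real.rpow_two]
        ring
    _ ≤ _ := by
        gcongr

variable (L : PeriodPair)

/-- The sum of the regularized summands; it converges for `Re s > 1 / 2`. -/
noncomputable def kroneckerRegular (z s : ℂ) : ℂ := ∑' w : L.lattice, kroneckerTerm z s w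

lemma eventually_cofinite_le_norm (R : ℝ) : ∀ᶠ w : L.lattice in cofinite, R ≤ ‖(w : ℂ)‖ := by
  refine (isCompact_iff_finite.mp (isCompact_closedBall (0 : L.lattice) R)).subset ?_
  intro w hw
  simp only [Set.mem_compl_iff, Set.mem_ofPred_eq, not_le] at hw
  simpa using hw.le

lemma summableLocallyUniformlyOn_kroneckerTerm (z : ℂ) :
    SummableLocallyUniformlyOn (fun (w : L.lattice) s => kroneckerTerm z s w)
      {s : ℂ | 1 / 2 < s.re} := by
  have hopen : IsOpen {s : ℂ | 1 / 2 < s.re} := isOpen_lt continuous_const Complex.continuous_re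
  refine SummableLocallyUniformlyOn.of_locally_bounded_eventually hopen fun K hK hKc => ?_
  obtain ⟨M, hM⟩ := hKc.isBounded.exists_norm_le
  obtain ⟨σ, hσ, hσK⟩ : ∃ σ : ℝ, 1 / 2 < σ ∧ ∀ s ∈ K, σ ≤ s.re := by
    rcases K.eq_empty_or_nonempty with rfl | hne
    · exact ⟨1, by norm_num, by simp⟩
    · obtain ⟨s, hs, hmin⟩ := hKc.exists_isMinOn hne Complex.continuous_re.continuousOn
      exact ⟨s.re, hK hs, fun t ht => hmin ht⟩
  refine ⟨fun w => (5 * M + 27 / 2 * M ^ 2 * Real.exp (3 / 2 * M)) * ‖z‖ ^ 2 *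
    ‖w‖ ^ (-1 - 2 * σ), (ZLattice.summable_norm_rpow _ _ (by simp; linarith)).mul_left _, ?_⟩
  filter_upwards [eventually_cofinite_le_norm L (max 1 (2 * ‖z‖))] with w hw s hs
  exact norm_kroneckerTerm_le (hM s hs) (hσK s hs) ((le_max_right _ _).trans hw)
    ((le_max_left _ _).trans hw)

lemma differentiableOn_kroneckerRegular {z : ℂ} (hz : z ∉ L.lattice) :
    DifferentiableOn ℂ (kroneckerRegular L z) {s : ℂ | 1 / 2 < s.re} := by
  have hopen : IsOpen {s : ℂ | 1 / 2 < s.re} := isOpen_lt continuous_const Complex.continuous_re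
  refine (summableLocallyUniformlyOn_kroneckerTerm L z).differentiableOn hopen fun w s hs => ?_
  have hs0 : 2 * s ≠ 0 := by
    intro h
    have h' : s = 0 := by simpa using h
    rw [Set.mem_ofPred_eq, h'] at hs; norm_num at hs
  have hzw : ((‖z + (w : ℂ)‖ : ℝ) : ℂ) ≠ 0 := by
    simp only [ne_eq, Complex.ofReal_eq_zero, norm_eq_zero]
    intro h
    exact hz (by rw [eq_neg_of_add_eq_zero_left h]; exact neg_mem w.2)
  unfold kroneckerTerm
  refine DifferentiableAt.sub ?_ ?_
  · refine DifferentiableAt.div (by fun_prop) ?_ (by simp [Complex.cpow_eq_zero_iff, hzw])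
    exact DifferentiableAt.const_cpow (by fun_prop) (Or.inl hzw)
  · by_cases hw : (w : ℂ) = 0
    · have : (fun s : ℂ => (conj (w : ℂ) + (1 - s) * conj z - s * z * conj (w : ℂ) / w) /
          ((‖(w : ℂ)‖ : ℝ) : ℂ) ^ (2 * s)) =ᶠ[𝓝 s] fun _ => 0 := by
        filter_upwards [hopen.mem_nhds hs] with t ht
        have : t ≠ 0 := by rintro rfl; simp at ht; norm_num at ht
        simp [hw, this]
      exact this.differentiableAt_iff.mpr (differentiableAt_const _)
    · have hw' : ((‖(w : ℂ)‖ : ℝ) : ℂ) ≠ 0 := by simpa using hw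
      refine DifferentiableAt.div (by fun_prop) ?_ (by simp [Complex.cpow_eq_zero_iff, hw'])
      exact DifferentiableAt.const_cpow (by fun_prop) (Or.inl hw')

/-- At `s = 1` the regularized series is the Weierstrass zeta function. -/
lemma kroneckerRegular_one (z : ℂ) : kroneckerRegular L z 1 = L.weierstrassZeta z := by
  rw [kroneckerRegular, PeriodPair.weierstrassZeta, ← (Equiv.neg L.lattice).tsum_eq]
  have hinv : ∀ u : ℂ, conj u / ((‖u‖ : ℝ) : ℂ) ^ (2 : ℂ) = 1 / u := by
    intro u
    by_cases hu : u = 0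
    · simp [hu]
    have h2 : ((‖u‖ : ℝ) : ℂ) ^ (2 : ℂ) = u * conj u := by
      rw [Complex.mul_conj, Complex.normSq_eq_norm_sq]
      norm_cast
    have : conj u ≠ 0 := by simpa using hu
    rw [h2]; field_simp
  refine tsum_congr fun w => ?_
  have e : ((Equiv.neg L.lattice w : L.lattice) : ℂ) = -(w : ℂ) := by simp
  rw [kroneckerTerm, e, mul_one, hinv, sub_self, zero_mul, add_zero, one_mul]
  by_cases hw : (w : ℂ) = 0
  · simp [hw]
  · have : (conj (-(w : ℂ)) - z * conj (-(w : ℂ)) / -(w : ℂ)) / ((‖-(w : ℂ)‖ : ℝ) : ℂ) ^ (2 : ℂ) =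
        (1 - z / (-(w : ℂ))) * (1 / -(w : ℂ)) := by
      rw [← hinv]; ring
    rw [this, ← sub_eq_add_neg]
    field_simp
    ring

/-- Multiplication by `ω`, as a permutation of a lattice that is stable under it. -/
noncomputable def omegaEquiv {Λ : Submodule ℤ ℂ} (h : ∀ w ∈ Λ, ω * w ∈ Λ) : Λ ≃ Λ where
  toFun w := ⟨ω * w, h _ w.2⟩
  invFun w := ⟨ω * (ω * w), h _ (h _ w.2)⟩
  left_inv w := by
    ext
    show ω * (ω * (ω * (w : ℂ))) = w
    linear_combination (ω - 1) * w * omega_sq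
  right_inv w := by
    ext
    show ω * (ω * (ω * (w : ℂ))) = w
    linear_combination (ω - 1) * w * omega_sq

@[simp] lemma omegaEquiv_coe {Λ : Submodule ℤ ℂ} (h : ∀ w ∈ Λ, ω * w ∈ Λ) (w : Λ) :
    (omegaEquiv h w : ℂ) = ω * w := rfl

lemma summable_div_norm_cpow {f : ℂ → ℂ} {C k : ℝ} {s : ℂ} (hf : ∀ w, ‖f w‖ ≤ C * ‖w‖ ^ k)
    (hs : k + 2 < 2 * s.re) (hk : 0 ≤ k) :
    Summable fun w : L.lattice => f w / ((‖(w : ℂ)‖ : ℝ) : ℂ) ^ (2 * s) := by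
  refine .of_norm_bounded (g := fun w : L.lattice => C * ‖w‖ ^ (k - 2 * s.re))
    ((ZLattice.summable_norm_rpow _ _ (by simp; linarith)).mul_left _) fun w => ?_
  have hre : (2 * s).re = 2 * s.re := by simp
  rw [norm_div, Complex.norm_cpow_eq_rpow_re_of_nonneg (norm_nonneg _) (by rw [hre]; linarith), hre]
  by_cases hw : (w : ℂ) = 0
  · have h1 : ‖(w : L.lattice)‖ = 0 := by simpa using hw
    rw [h1, Real.zero_rpow (by linarith), hw, norm_zero, Real.zero_rpow (by linarith)]
    simp
  · have hw0 : 0 < ‖(w : ℂ)‖ := norm_pos_iff.mpr hw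
    rw [show ‖w‖ = ‖(w : ℂ)‖ from rfl, Real.rpow_sub hw0, ← mul_div_assoc]
    gcongr
    exact hf _

/-- For `Re s > 3 / 2` the Kronecker–Eisenstein series differs from the regularized one by
`(1 - s) z̄` times the Epstein zeta function: the other two subtracted sums vanish, one because
its terms are odd and one because the lattice is stable under `ω`. -/
lemma kroneckerSeries_eq (hω : ∀ w ∈ L.lattice, ω * w ∈ L.lattice) {z s : ℂ} (hz : z ∉ L.lattice)
    (hs : 3 / 2 < s.re) :
    kroneckerSeries L.lattice z s = kroneckerRegular L z s +
      (1 - s) * conj z * ∑' w : L.lattice, 1 / ((‖(w : ℂ)‖ : ℝ) : ℂ) ^ (2 * s) := by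
  set N : L.lattice → ℂ := fun w => ((‖(w : ℂ)‖ : ℝ) : ℂ) ^ (2 * s) with hN
  have hs1 : Summable fun w : L.lattice => conj (w : ℂ) / N w :=
    summable_div_norm_cpow L (f := fun w => conj w) (C := 1) (k := 1) (by simp)
      (by linarith) (by norm_num)
  have hs2 : Summable fun w : L.lattice => 1 / N w :=
    summable_div_norm_cpow L (f := fun _ => 1) (C := 1) (k := 0) (by simp)
      (by linarith) (by norm_num)
  have hs3 : Summable fun w : L.lattice => conj (w : ℂ) / w / N w := by
    refine summable_div_norm_cpow L (f := fun w => conj w / w) (C := 1) (k := 0) (fun w => ?_)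
      (by linarith) (by norm_num)
    rw [norm_div, RCLike.norm_conj, Real.rpow_zero, mul_one]
    exact div_self_le_one _
  have ht1 : ∑' w : L.lattice, conj (w : ℂ) / N w = 0 := by
    have h := (Equiv.neg L.lattice).tsum_eq fun w : L.lattice => conj (w : ℂ) / N w
    have h' : ∀ w : L.lattice, conj ((Equiv.neg L.lattice w : L.lattice) : ℂ) /
        N (Equiv.neg L.lattice w) = -(conj (w : ℂ) / N w) := by
      intro w; simp [hN, neg_div]
    simp only [h', tsum_neg] at h
    exact CharZero.eq_neg_self_iff.mp h.symm
  have ht3 : ∑' w : L.lattice, conj (w : ℂ) / w / N w = 0 := by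
    have h := (omegaEquiv hω).tsum_eq fun w : L.lattice => conj (w : ℂ) / w / N w
    have hω0 : ω ≠ 0 := by intro h; have := norm_omega; simp [h] at this
    have h' : ∀ w : L.lattice, conj (omegaEquiv hω w : ℂ) / (omegaEquiv hω w : ℂ) /
        N (omegaEquiv hω w) = ω * (conj (w : ℂ) / w / N w) := by
      intro w
      simp only [hN, omegaEquiv_coe, map_mul, conj_omega, norm_mul, norm_omega, one_mul]
      rw [mul_div_mul_comm, mul_div_assoc]
      congr 1
      field_simp
    simp only [h', tsum_mul_left] at h
    have h1 : (ω - 1) * ∑' w : L.lattice, conj (w : ℂ) / w / N w = 0 := by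
      rw [sub_mul, h]; ring
    refine (mul_eq_zero.mp h1).resolve_left fun h2 => ?_
    have h3 := omega_sq
    rw [sub_eq_zero.mp h2] at h3; norm_num at h3
  have hsum : Summable fun w : L.lattice => kroneckerTerm z s w :=
    (summableLocallyUniformlyOn_kroneckerTerm L z).summable (by
      show 1 / 2 < s.re; linarith)
  have hdec : ∀ w : L.lattice,
      (open Classical in if z + w = 0 then 0 else
        conj (z + (w : ℂ)) / ((‖z + (w : ℂ)‖ : ℝ) : ℂ) ^ (2 * s)) =
      kroneckerTerm z s w + (conj (w : ℂ) / N w + (1 - s) * conj z * (1 / N w) -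
        s * z * (conj (w : ℂ) / w / N w)) := by
    intro w
    have : z + w ≠ 0 := fun h => hz (by
      rw [eq_neg_of_add_eq_zero_left h]; exact neg_mem w.2)
    rw [if_neg this, kroneckerTerm]
    ring
  rw [kroneckerSeries, tsum_congr hdec, Summable.tsum_add hsum
    ((hs1.add (hs2.mul_left _)).sub (hs3.mul_left _)),
    Summable.tsum_sub (hs1.add (hs2.mul_left _)) (hs3.mul_left _),
    Summable.tsum_add hs1 (hs2.mul_left _), tsum_mul_left, tsum_mul_left, ht1, ht3,
    kroneckerRegular]
  ring

lemma kroneckerSeries_add (z : ℂ) {w : ℂ} (hw : w ∈ L.lattice) :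
    kroneckerSeries L.lattice (z + w) = kroneckerSeries L.lattice z := by
  funext s
  unfold kroneckerSeries
  rw [← (Equiv.addLeft (⟨w, hw⟩ : L.lattice)).tsum_eq (fun v : L.lattice =>
    open Classical in if z + v = 0 then 0 else
      conj (z + (v : ℂ)) / ((‖z + (v : ℂ)‖ : ℝ) : ℂ) ^ (2 * s))]
  refine tsum_congr fun v => ?_
  simp [add_assoc]

lemma IsContinuationValue.unique {Λ : Submodule ℤ ℂ} {z s v₁ v₂ : ℂ}
    (h₁ : IsContinuationValue Λ z s v₁) (h₂ : IsContinuationValue Λ z s v₂) : v₁ = v₂ := by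
  obtain ⟨σ₁, F₁, hs₁, hd₁, he₁, rfl⟩ := h₁
  obtain ⟨σ₂, F₂, hs₂, hd₂, he₂, rfl⟩ := h₂
  set σ := max σ₁ σ₂
  have hopen : IsOpen {t : ℂ | σ < t.re} := isOpen_lt continuous_const Complex.continuous_re
  have hconn : IsPreconnected {t : ℂ | σ < t.re} := (convex_halfSpace_re_gt σ).isPreconnected
  have h1 : AnalyticOnNhd ℂ F₁ {t : ℂ | σ < t.re} :=
    (hd₁.mono fun t (ht : σ < t.re) => (le_max_left _ _).trans_lt ht).analyticOnNhd hopen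
  have h2 : AnalyticOnNhd ℂ F₂ {t : ℂ | σ < t.re} :=
    (hd₂.mono fun t (ht : σ < t.re) => (le_max_right _ _).trans_lt ht).analyticOnNhd hopen
  set t₀ : ℂ := ((max σ (3 / 2) + 1 : ℝ) : ℂ)
  have ht₀ : max σ (3 / 2) < t₀.re := by simp [t₀]
  have hev : F₁ =ᶠ[𝓝 t₀] F₂ := by
    have : {t : ℂ | max σ (3 / 2) < t.re} ∈ 𝓝 t₀ :=
      (isOpen_lt continuous_const Complex.continuous_re).mem_nhds ht₀
    filter_upwards [this] with t ht
    have ht' : max σ (3 / 2) < t.re := ht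
    rw [max_lt_iff, max_lt_iff] at ht'
    rw [he₁ t ht'.1.1 ht'.2, he₂ t ht'.1.2 ht'.2]
  exact h1.eqOn_of_preconnected_of_eventuallyEq h2 hconn
    (show σ < t₀.re from (le_max_left _ _).trans_lt ht₀) hev
    (show σ < s.re from max_lt hs₁ hs₂)

lemma E₁star_eq_of_isContinuationValue {Λ : Submodule ℤ ℂ} {z v : ℂ}
    (h : IsContinuationValue Λ z 1 v) : E₁star z Λ = v := by
  have hex : ∃ v : ℂ, IsContinuationValue Λ z 1 v := ⟨v, h⟩
  rw [E₁star, H₁, dif_pos hex]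
  exact hex.choose_spec.unique h

/-- The constant `κ` with `ℰ₁*(z) = ζ(z) - κ z̄`: the quasi-periods of `ζ` are the multiples
`κ w̄` of the conjugate periods. -/
noncomputable def kroneckerSlope : ℂ :=
  (L.weierstrassZeta (L.ω₁ / 2 + L.ω₁) - L.weierstrassZeta (L.ω₁ / 2)) / conj L.ω₁

/-- The Epstein zeta function, which the regularization leaves behind, is itself a difference of
regularized series, because the Kronecker–Eisenstein series is periodic in `z`. This continues it
past `s = 1`. -/
theorem isContinuationValue_one (hω : ∀ w ∈ L.lattice, ω * w ∈ L.lattice) {z : ℂ}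
    (hz : z ∉ L.lattice) :
    IsContinuationValue L.lattice z 1 (L.weierstrassZeta z - kroneckerSlope L * conj z) := by
  have ha : L.ω₁ / 2 ∉ L.lattice := L.ω₁_div_two_notMem_lattice
  have hb : L.ω₁ / 2 + L.ω₁ ∉ L.lattice := fun h => ha (by
    simpa using sub_mem h L.ω₁_mem_lattice)
  have h0 : conj L.ω₁ ≠ 0 := by
    rw [map_ne_zero]; intro h; exact ha (by rw [h]; simp)
  refine ⟨1 / 2, fun s => kroneckerRegular L z s - (kroneckerRegular L (L.ω₁ / 2 + L.ω₁) s -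
    kroneckerRegular L (L.ω₁ / 2) s) / conj L.ω₁ * conj z, by norm_num, ?_, ?_, ?_⟩
  · exact (differentiableOn_kroneckerRegular L hz).sub
      ((((differentiableOn_kroneckerRegular L hb).sub
        (differentiableOn_kroneckerRegular L ha)).div_const _).mul_const _)
  · intro t _ ht
    have e1 := kroneckerSeries_eq L hω hz ht
    have e2 := kroneckerSeries_eq L hω ha ht
    have e3 := kroneckerSeries_eq L hω hb ht
    rw [kroneckerSeries_add L _ L.ω₁_mem_lattice, e2, map_add] at e3
    have h : (kroneckerRegular L (L.ω₁ / 2 + L.ω₁) t - kroneckerRegular L (L.ω₁ / 2) t) /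
        conj L.ω₁ = -((1 - t) * ∑' w : L.lattice, 1 / ((‖(w : ℂ)‖ : ℝ) : ℂ) ^ (2 * t)) := by
      rw [div_eq_iff h0]
      linear_combination -e3
    dsimp only
    rw [e1, h]
    ring
  · simp only [kroneckerRegular_one, kroneckerSlope]

theorem E₁star_eq (hω : ∀ w ∈ L.lattice, ω * w ∈ L.lattice) {z : ℂ} (hz : z ∉ L.lattice) :
    E₁star z L.lattice = L.weierstrassZeta z - kroneckerSlope L * conj z :=
  E₁star_eq_of_isContinuationValue (isContinuationValue_one L hω hz)

lemma E₁star_add (z : ℂ) {w : ℂ} (hw : w ∈ L.lattice) :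
    E₁star (z + w) L.lattice = E₁star z L.lattice := by
  have h : IsContinuationValue L.lattice (z + w) 1 = IsContinuationValue L.lattice z 1 := by
    funext v
    simp only [IsContinuationValue, kroneckerSeries_add L z hw]
  simp only [E₁star, H₁]
  rw [h]

lemma E₁star_neg (hω : ∀ w ∈ L.lattice, ω * w ∈ L.lattice) {z : ℂ} (hz : z ∉ L.lattice) :
    E₁star (-z) L.lattice = -E₁star z L.lattice := by
  have hz' : -z ∉ L.lattice := fun h => hz (by simpa using neg_mem h)
  rw [E₁star_eq L hω hz, E₁star_eq L hω hz', L.weierstrassZeta_neg, map_neg]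
  ring

lemma omega_mul_mem_iff (hω : ∀ w ∈ L.lattice, ω * w ∈ L.lattice) {z : ℂ} :
    ω * z ∈ L.lattice ↔ z ∈ L.lattice := by
  refine ⟨fun h => ?_, hω z⟩
  have := hω _ (hω _ h)
  have e : ω * (ω * (ω * z)) = z := by linear_combination (ω - 1) * z * omega_sq
  rwa [e] at this

lemma weierstrassZeta_omega_mul (hω : ∀ w ∈ L.lattice, ω * w ∈ L.lattice) (z : ℂ) :
    L.weierstrassZeta (ω * z) = ω ^ 2 * L.weierstrassZeta z := by
  rw [PeriodPair.weierstrassZeta, ← (omegaEquiv hω).tsum_eq, PeriodPair.weierstrassZeta,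
    ← tsum_mul_left]
  refine tsum_congr fun w => ?_
  have h0 : ω ≠ 0 := by intro h; have := norm_omega; simp [h] at this
  have h3 : ω ^ 3 = 1 := by linear_combination (ω - 1) * omega_sq
  have hinv : ω⁻¹ = ω ^ 2 := by field_simp; exact h3.symm
  rw [omegaEquiv_coe, ← mul_sub, mul_pow]
  have hinv2 : (ω ^ 2)⁻¹ = ω := by rw [← hinv, inv_inv]
  simp only [div_eq_mul_inv, mul_inv, hinv, hinv2]
  ring

lemma weierstrassP_omega_mul (hω : ∀ w ∈ L.lattice, ω * w ∈ L.lattice) (z : ℂ) :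
    L.weierstrassP (ω * z) = ω * L.weierstrassP z := by
  rw [PeriodPair.weierstrassP, ← (omegaEquiv hω).tsum_eq, PeriodPair.weierstrassP,
    ← tsum_mul_left]
  refine tsum_congr fun w => ?_
  have h0 : ω ≠ 0 := by intro h; have := norm_omega; simp [h] at this
  have h3 : ω ^ 3 = 1 := by linear_combination (ω - 1) * omega_sq
  have hinv : ω⁻¹ = ω ^ 2 := by field_simp; exact h3.symm
  rw [omegaEquiv_coe, ← mul_sub, mul_pow, mul_pow]
  simp only [one_div, mul_inv, ← inv_pow, hinv]
  ring_nf
  rw [show ω ^ 4 = ω ^ 3 * ω by ring, h3]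
  ring

lemma E₁star_omega_mul (hω : ∀ w ∈ L.lattice, ω * w ∈ L.lattice) {z : ℂ} (hz : z ∉ L.lattice) :
    E₁star (ω * z) L.lattice = ω ^ 2 * E₁star z L.lattice := by
  rw [E₁star_eq L hω hz, E₁star_eq L hω ((omega_mul_mem_iff L hω).not.mpr hz),
    weierstrassZeta_omega_mul L hω, map_mul, conj_omega]
  ring

/-- The addition formula for `ℰ₁*`. -/
theorem E₁star_add_sub_E₁star_sub (hω : ∀ w ∈ L.lattice, ω * w ∈ L.lattice) {t z : ℂ}
    (ht : 2 * t ∉ L.lattice) (hz : z ∉ L.lattice) (h1 : z + t ∉ L.lattice)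
    (h2 : z - t ∉ L.lattice) :
    E₁star (z + t) L.lattice - E₁star (z - t) L.lattice = 2 * E₁star t L.lattice -
      L.derivWeierstrassP t / (L.weierstrassP z - L.weierstrassP t) := by
  have ht' : t ∉ L.lattice := fun h => ht (by rw [two_mul]; exact add_mem h h)
  have hne := L.weierstrassP_ne ht hz h1 h2
  have h := L.zetaDiff_mul ht hz h1 h2
  rw [E₁star_eq L hω ht', E₁star_eq L hω h1, E₁star_eq L hω h2]
  have h' : L.zetaDiff t z =
      -(L.derivWeierstrassP t / (L.weierstrassP z - L.weierstrassP t)) := by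
    rw [← neg_div, eq_div_iff hne, h]
  rw [PeriodPair.zetaDiff] at h'
  simp only [map_add, map_sub]
  linear_combination h'

end EisensteinTwists

/-! ### A lattice is determined by its invariants -/

namespace PeriodPair

open Filter Topology

variable (L : PeriodPair)

lemma weierstrassP_eq_except (z : ℂ) :
    L.weierstrassP z = L.weierstrassPExcept 0 z + 1 / z ^ 2 := by
  have := L.weierstrassPExcept_def 0 z
  simp only [ZeroMemClass.coe_zero, sub_zero] at this
  rw [this]; simp

lemma derivWeierstrassP_eq_except (z : ℂ) :
    L.derivWeierstrassP z = L.derivWeierstrassPExcept 0 z - 2 / z ^ 3 := by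
  have := L.derivWeierstrassPExcept_def 0 z
  simp only [ZeroMemClass.coe_zero, sub_zero] at this
  rw [this]; ring

lemma hasDerivAt_weierstrassPExcept_zero :
    ∀ᶠ z in 𝓝 (0 : ℂ), HasDerivAt (L.weierstrassPExcept 0) (L.derivWeierstrassPExcept 0 z) z := by
  filter_upwards [L.compl_lattice_sdiff_singleton_mem_nhds 0] with z hz
  rw [← L.eqOn_deriv_weierstrassPExcept_derivWeierstrassPExcept 0 hz]
  exact (L.analyticOnNhd_weierstrassPExcept 0 z hz).differentiableAt.hasDerivAt

/-- If `℘₁ - ℘₂ = zⁿ g` with `n ≥ 1` and `g(0) ≠ 0`, then comparing the leading coefficients in the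
difference of the two differential equations gives `-4 n g(0) = 12 g(0)`. -/
lemma weierstrassPExcept_eventuallyEq_of_g₂_of_g₃ {L L' : PeriodPair} (h₂ : L.g₂ = L'.g₂)
    (h₃ : L.g₃ = L'.g₃) : L.weierstrassPExcept 0 =ᶠ[𝓝 0] L'.weierstrassPExcept 0 := by
  have ha := L.analyticAt_weierstrassPExcept 0
  have ha' := L'.analyticAt_weierstrassPExcept 0
  have hu : AnalyticAt ℂ (fun z => L.weierstrassPExcept 0 z - L'.weierstrassPExcept 0 z) 0 :=
    ha.sub ha'
  suffices h : ∀ᶠ z in 𝓝 (0 : ℂ), L.weierstrassPExcept 0 z - L'.weierstrassPExcept 0 z = 0 by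
    filter_upwards [h] with z hz using sub_eq_zero.mp hz
  by_contra hne
  obtain ⟨n, g, hg, hg0, hgu⟩ := hu.exists_eventuallyEq_pow_smul_nonzero_iff.mpr hne
  simp only [sub_zero, smul_eq_mul] at hgu
  have hn : n ≠ 0 := by
    rintro rfl
    have := hgu.self_of_nhds
    simp at this
    exact hg0 this.symm
  have hd := L.analyticAt_derivWeierstrassPExcept 0
  have hd' := L'.analyticAt_derivWeierstrassPExcept 0
  have hderiv : ∀ᶠ z in 𝓝 (0 : ℂ),
      L.derivWeierstrassPExcept 0 z - L'.derivWeierstrassPExcept 0 z =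
        n * z ^ (n - 1) * g z + z ^ n * deriv g z := by
    filter_upwards [L.hasDerivAt_weierstrassPExcept_zero, L'.hasDerivAt_weierstrassPExcept_zero,
      hgu.eventually_nhds, hg.eventually_analyticAt] with z h1 h2 h3 h4
    have e1 := (h1.sub h2).congr_of_eventuallyEq (f₁ := fun z => z ^ n * g z) (by
      filter_upwards [h3] with x hx using hx.symm)
    exact e1.unique ((hasDerivAt_pow n z).mul h4.differentiableAt.hasDerivAt)
  have hev : ∀ᶠ z in 𝓝[≠] (0 : ℂ),
      (n * g z + z * deriv g z) * (z ^ 3 * (L.derivWeierstrassPExcept 0 z +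
        L'.derivWeierstrassPExcept 0 z) - 4) =
      g z * (4 * ((z ^ 2 * L.weierstrassPExcept 0 z + 1) ^ 2 +
        (z ^ 2 * L.weierstrassPExcept 0 z + 1) * (z ^ 2 * L'.weierstrassPExcept 0 z + 1) +
        (z ^ 2 * L'.weierstrassPExcept 0 z + 1) ^ 2) - L.g₂ * z ^ 4) := by
    filter_upwards [self_mem_nhdsWithin, hderiv.filter_mono nhdsWithin_le_nhds,
      hgu.filter_mono nhdsWithin_le_nhds, L.eventually_notMem_lattice 0,
      L'.eventually_notMem_lattice 0] with z hz h1 h3 hL hL'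
    have hz0 : z ≠ 0 := hz
    have o1 := L.derivWeierstrassP_sq z hL
    have o2 := L'.derivWeierstrassP_sq z hL'
    rw [← h₂, ← h₃] at o2
    rw [derivWeierstrassP_eq_except, weierstrassP_eq_except] at o1 o2
    set e := L.weierstrassPExcept 0 z
    set e' := L'.weierstrassPExcept 0 z
    set d := L.derivWeierstrassPExcept 0 z
    set d' := L'.derivWeierstrassPExcept 0 z
    have hn1 : z * z ^ (n - 1) = z ^ n := by
      rw [← pow_succ', Nat.sub_add_cancel (Nat.one_le_iff_ne_zero.mpr hn)]
    have h5 : z * (d - d') = z ^ n * (n * g z + z * deriv g z) := by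
      rw [h1, ← hn1]; ring
    -- the difference of the two differential equations, with denominators cleared
    have h6 : (d - d') * (d + d' - 4 / z ^ 3) = (e - e') * (4 * ((e + 1 / z ^ 2) ^ 2 +
        (e + 1 / z ^ 2) * (e' + 1 / z ^ 2) + (e' + 1 / z ^ 2) ^ 2) - L.g₂) := by
      linear_combination o1 - o2
    have h7 : z * (d - d') * (z ^ 3 * (d + d') - 4) = (e - e') * (4 * ((z ^ 2 * e + 1) ^ 2 +
        (z ^ 2 * e + 1) * (z ^ 2 * e' + 1) + (z ^ 2 * e' + 1) ^ 2) - L.g₂ * z ^ 4) := by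
      have e1 : z * (d - d') * (z ^ 3 * (d + d') - 4) =
          z ^ 4 * ((d - d') * (d + d' - 4 / z ^ 3)) := by field_simp
      rw [e1, h6]
      field_simp
    rw [h5, h3] at h7
    refine mul_left_cancel₀ (pow_ne_zero n hz0) ?_
    linear_combination h7
  have hlim := tendsto_nhds_unique_of_eventuallyEq
    (ContinuousAt.tendsto (x := (0 : ℂ)) (f := fun z => (n * g z + z * deriv g z) *
      (z ^ 3 * (L.derivWeierstrassPExcept 0 z + L'.derivWeierstrassPExcept 0 z) - 4)) (by
        have := hg.deriv.continuousAt
        have := hg.continuousAt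
        have := hd.continuousAt
        have := hd'.continuousAt
        fun_prop) |>.mono_left (nhdsWithin_le_nhds (s := {0}ᶜ)))
    (ContinuousAt.tendsto (x := (0 : ℂ)) (f := fun z => g z *
      (4 * ((z ^ 2 * L.weierstrassPExcept 0 z + 1) ^ 2 +
        (z ^ 2 * L.weierstrassPExcept 0 z + 1) * (z ^ 2 * L'.weierstrassPExcept 0 z + 1) +
        (z ^ 2 * L'.weierstrassPExcept 0 z + 1) ^ 2) - L.g₂ * z ^ 4)) (by
        have := hg.continuousAt
        have := ha.continuousAt
        have := ha'.continuousAt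
        fun_prop) |>.mono_left (nhdsWithin_le_nhds (s := {0}ᶜ))) hev
  have h8 : ((n : ℂ) + 3) * g 0 = 0 := by
    simp only [zero_mul, add_zero, ne_eq, OfNat.ofNat_ne_zero, not_false_eq_true, zero_pow,
      zero_sub, zero_add, mul_zero, sub_zero] at hlim
    linear_combination (-1 / 4 : ℂ) * hlim
  rcases mul_eq_zero.mp h8 with h | h
  · have : ((n + 3 : ℕ) : ℂ) = 0 := by push_cast; exact h
    exact absurd (Nat.cast_eq_zero.mp this) (by omega)
  · exact hg0 h

lemma lattice_le_of_g₂_of_g₃ {L L' : PeriodPair} (h₂ : L.g₂ = L'.g₂) (h₃ : L.g₃ = L'.g₃) :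
    L.lattice ≤ L'.lattice := by
  intro l hl
  have h0 : ∀ᶠ z in 𝓝[≠] (0 : ℂ), (L.weierstrassP - L'.weierstrassP) z = 0 := by
    filter_upwards [(weierstrassPExcept_eventuallyEq_of_g₂_of_g₃ h₂ h₃).filter_mono
      nhdsWithin_le_nhds] with z hz
    simp [weierstrassP_eq_except, hz]
  have hm : MeromorphicOn (L.weierstrassP - L'.weierstrassP) Set.univ := fun z _ =>
    (L.meromorphic_weierstrassP z).sub (L'.meromorphic_weierstrassP z)
  have htop : meromorphicOrderAt (L.weierstrassP - L'.weierstrassP) l = ⊤ := by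
    by_contra h
    exact hm.meromorphicOrderAt_ne_top_of_isPreconnected isPreconnected_univ (Set.mem_univ l)
      (Set.mem_univ 0) h (meromorphicOrderAt_eq_top_iff.mpr h0)
  have heq : L.weierstrassP =ᶠ[𝓝[≠] l] L'.weierstrassP := by
    filter_upwards [meromorphicOrderAt_eq_top_iff.mp htop] with z hz
    exact sub_eq_zero.mp hz
  by_contra hl'
  have h1 := (L'.analyticOnNhd_weierstrassP l hl').meromorphicOrderAt_nonneg
  rw [← meromorphicOrderAt_congr heq, L.order_weierstrassP l hl] at h1
  exact absurd h1 (by decide)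

/-- A lattice is determined by its invariants `g₂` and `g₃`. -/
theorem lattice_eq_of_g₂_of_g₃ {L L' : PeriodPair} (h₂ : L.g₂ = L'.g₂) (h₃ : L.g₃ = L'.g₃) :
    L.lattice = L'.lattice :=
  le_antisymm (lattice_le_of_g₂_of_g₃ h₂ h₃) (lattice_le_of_g₂_of_g₃ h₂.symm h₃.symm)

/-- The image of a pair of periods under an `ℝ`-linear automorphism of `ℂ`. -/
noncomputable def map (φ : ℂ ≃ₗ[ℝ] ℂ) : PeriodPair where
  ω₁ := φ L.ω₁
  ω₂ := φ L.ω₂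
  indep := by
    have := L.indep.map' φ.toLinearMap φ.ker
    have e : ![φ L.ω₁, φ L.ω₂] = φ ∘ ![L.ω₁, L.ω₂] := by
      ext i; fin_cases i <;> rfl
    rw [e]
    exact this

lemma apply_mem_map_lattice (φ : ℂ ≃ₗ[ℝ] ℂ) {w : ℂ} :
    φ w ∈ (L.map φ).lattice ↔ w ∈ L.lattice := by
  simp only [mem_lattice, map]
  refine exists_congr fun m => exists_congr fun n => ?_
  rw [← φ.injective.eq_iff (a := m * L.ω₁ + n * L.ω₂)]
  have : φ (m * L.ω₁ + n * L.ω₂) = m * φ L.ω₁ + n * φ L.ω₂ := by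
    rw [map_add, ← zsmul_eq_mul, ← zsmul_eq_mul, map_zsmul, map_zsmul, zsmul_eq_mul, zsmul_eq_mul]
  rw [this]

/-- The bijection between a lattice and its image. -/
noncomputable def latticeEquivMap (φ : ℂ ≃ₗ[ℝ] ℂ) : L.lattice ≃ (L.map φ).lattice where
  toFun w := ⟨φ w, (L.apply_mem_map_lattice φ).mpr w.2⟩
  invFun w := ⟨φ.symm w, by rw [← L.apply_mem_map_lattice φ]; simp⟩
  left_inv w := by simp
  right_inv w := by simp

lemma G_map (φ : ℂ ≃ₗ[ℝ] ℂ) (n : ℕ) : (L.map φ).G n = ∑' l : L.lattice, (φ l ^ n)⁻¹ := by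
  rw [G, ← (L.latticeEquivMap φ).tsum_eq]
  rfl

end PeriodPair

namespace EisensteinTwists

open Filter Topology

variable {L : PeriodPair}

lemma omega_ne_zero : ω ≠ 0 := by intro h; have := norm_omega; simp [h] at this

lemma omega_pow_three : ω ^ 3 = 1 := by linear_combination (ω - 1) * omega_sq

lemma omega_ne_one : ω ≠ 1 := by
  intro h; have := omega_sq; rw [h] at this; norm_num at this

/-- If `g₂ = 0`, the lattice is stable under `ω`. -/
theorem omega_mul_mem_of_g₂_eq_zero (hg₂ : L.g₂ = 0) : ∀ w ∈ L.lattice, ω * w ∈ L.lattice := by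
  intro w hw
  set φ : ℂ ≃ₗ[ℝ] ℂ := (LinearEquiv.smulOfNeZero ℂ ℂ ω omega_ne_zero).restrictScalars ℝ with hφ
  have happ : ∀ x, φ x = ω * x := fun x => rfl
  have h4 : (L.map φ).G 4 = ω⁻¹ * L.G 4 := by
    rw [PeriodPair.G_map, PeriodPair.G, ← tsum_mul_left]
    refine tsum_congr fun l => ?_
    rw [happ, mul_pow, mul_inv, show ω ^ 4 = ω by linear_combination ω * omega_pow_three]
  have h6 : (L.map φ).G 6 = L.G 6 := by
    rw [PeriodPair.G_map, PeriodPair.G]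
    refine tsum_congr fun l => ?_
    rw [happ, mul_pow, mul_inv, show ω ^ 6 = 1 by
      linear_combination (ω ^ 3 + 1) * omega_pow_three]
    simp
  have hG : L.G 4 = 0 := by simpa [PeriodPair.g₂] using hg₂
  have := PeriodPair.lattice_eq_of_g₂_of_g₃ (L := L.map φ) (L' := L)
    (by rw [PeriodPair.g₂, PeriodPair.g₂, h4, hG, mul_zero]) (by rw [PeriodPair.g₃, h6]; rfl)
  rw [← this, ← happ]
  exact (L.apply_mem_map_lattice φ).mpr hw

/-- A lattice with real invariants is stable under complex conjugation. -/
theorem conj_mem_of_g₂_of_g₃ (hg₂ : conj L.g₂ = L.g₂) (hg₃ : conj L.g₃ = L.g₃) :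
    ∀ w ∈ L.lattice, conj w ∈ L.lattice := by
  intro w hw
  set φ : ℂ ≃ₗ[ℝ] ℂ := Complex.conjAe.toLinearEquiv with hφ
  have happ : ∀ x, φ x = conj x := fun x => rfl
  have h : ∀ n, (L.map φ).G n = conj (L.G n) := by
    intro n
    rw [PeriodPair.G_map, PeriodPair.G, Complex.conj_tsum]
    refine tsum_congr fun l => ?_
    rw [happ, map_inv₀, map_pow]
  have := PeriodPair.lattice_eq_of_g₂_of_g₃ (L := L.map φ) (L' := L)
    (by rw [← hg₂, PeriodPair.g₂, PeriodPair.g₂, h, map_mul, map_ofNat])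
    (by rw [← hg₃, PeriodPair.g₃, PeriodPair.g₃, h, map_mul, map_ofNat])
  rw [← this, ← happ]
  exact (L.apply_mem_map_lattice φ).mpr hw

/-- Complex conjugation, as a permutation of a lattice that is stable under it. -/
noncomputable def conjEquiv {Λ : Submodule ℤ ℂ} (h : ∀ w ∈ Λ, conj w ∈ Λ) : Λ ≃ Λ where
  toFun w := ⟨conj (w : ℂ), h _ w.2⟩
  invFun w := ⟨conj (w : ℂ), h _ w.2⟩
  left_inv w := by simp
  right_inv w := by simp

lemma weierstrassP_conj (h : ∀ w ∈ L.lattice, conj w ∈ L.lattice) (z : ℂ) :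
    L.weierstrassP (conj z) = conj (L.weierstrassP z) := by
  rw [PeriodPair.weierstrassP, PeriodPair.weierstrassP, Complex.conj_tsum,
    ← (conjEquiv h).tsum_eq]
  refine tsum_congr fun l => ?_
  simp [conjEquiv]

lemma derivWeierstrassP_conj (h : ∀ w ∈ L.lattice, conj w ∈ L.lattice) (z : ℂ) :
    L.derivWeierstrassP (conj z) = conj (L.derivWeierstrassP z) := by
  rw [PeriodPair.derivWeierstrassP, PeriodPair.derivWeierstrassP, map_neg, Complex.conj_tsum,
    ← (conjEquiv h).tsum_eq]
  congr 1
  refine tsum_congr fun l => ?_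
  simp [conjEquiv, map_ofNat]

lemma derivWeierstrassP_omega_mul (hω : ∀ w ∈ L.lattice, ω * w ∈ L.lattice) (z : ℂ) :
    L.derivWeierstrassP (ω * z) = L.derivWeierstrassP z := by
  rw [PeriodPair.derivWeierstrassP, ← (omegaEquiv hω).tsum_eq, PeriodPair.derivWeierstrassP]
  congr 1
  refine tsum_congr fun w => ?_
  rw [omegaEquiv_coe, ← mul_sub, mul_pow, omega_pow_three, one_mul]

/-- The derivative of the addition formula for the zeta function. -/
theorem weierstrassP_sub_sub_weierstrassP_add {t z : ℂ} (ht : 2 * t ∉ L.lattice)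
    (hz : z ∉ L.lattice) (h1 : z + t ∉ L.lattice) (h2 : z - t ∉ L.lattice) :
    L.weierstrassP (z - t) - L.weierstrassP (z + t) =
      L.derivWeierstrassP z * L.derivWeierstrassP t /
        (L.weierstrassP z - L.weierstrassP t) ^ 2 := by
  have hne := L.weierstrassP_ne ht hz h1 h2
  have hd := L.hasDerivAt_zetaDiff h1 h2
  have hopen : ∀ᶠ x in 𝓝 z, x ∉ L.lattice ∧ x + t ∉ L.lattice ∧ x - t ∉ L.lattice := by
    have c1 : ContinuousAt (fun x : ℂ => x + t) z := by fun_prop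
    have c2 : ContinuousAt (fun x : ℂ => x - t) z := by fun_prop
    filter_upwards [L.lattice_compl_mem_nhds hz, c1.eventually (L.lattice_compl_mem_nhds h1),
      c2.eventually (L.lattice_compl_mem_nhds h2)] with x a b c using ⟨a, b, c⟩
  have hev : L.zetaDiff t =ᶠ[𝓝 z]
      fun x => -L.derivWeierstrassP t / (L.weierstrassP x - L.weierstrassP t) := by
    filter_upwards [hopen] with x hx
    rw [eq_div_iff (L.weierstrassP_ne ht hx.1 hx.2.1 hx.2.2)]
    exact L.zetaDiff_mul ht hx.1 hx.2.1 hx.2.2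
  have hd' := (hasDerivAt_const z (-L.derivWeierstrassP t)).fun_div
    ((L.hasDerivAt_weierstrassP hz).sub_const (L.weierstrassP t)) hne
  have := (hd.congr_of_eventuallyEq hev.symm).unique hd'
  rw [neg_add_eq_sub] at this
  rw [this]
  ring

end EisensteinTwists

/-! ### The three-torsion point `Ω / 3` -/

namespace EisensteinTwists

open Filter Topology

variable {L : PeriodPair}

lemma derivWeierstrassP_ofReal_im (h : ∀ w ∈ L.lattice, conj w ∈ L.lattice) (r : ℝ) :
    (L.derivWeierstrassP r).im = 0 := by
  have := derivWeierstrassP_conj h (r : ℂ)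
  rw [Complex.conj_ofReal] at this
  exact Complex.conj_eq_iff_im.mp this.symm

lemma weierstrassP_ofReal_im (h : ∀ w ∈ L.lattice, conj w ∈ L.lattice) (r : ℝ) :
    (L.weierstrassP r).im = 0 := by
  have := weierstrassP_conj h (r : ℂ)
  rw [Complex.conj_ofReal] at this
  exact Complex.conj_eq_iff_im.mp this.symm

lemma tendsto_pow_mul_derivWeierstrassP :
    Tendsto (fun z => z ^ 3 * L.derivWeierstrassP z) (𝓝[≠] 0) (𝓝 (-2)) := by
  have hc : ContinuousAt (fun z => z ^ 3 * L.derivWeierstrassPExcept 0 z - 2) 0 := by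
    have := (L.analyticAt_derivWeierstrassPExcept 0).continuousAt
    fun_prop
  have := hc.tendsto.mono_left (nhdsWithin_le_nhds (s := {0}ᶜ))
  simp only [ne_eq, OfNat.ofNat_ne_zero, not_false_eq_true, zero_pow, zero_mul, zero_sub] at this
  refine this.congr' ?_
  filter_upwards [self_mem_nhdsWithin] with z hz
  have hz0 : z ≠ 0 := hz
  rw [L.derivWeierstrassP_eq_except]
  field_simp

/-- `℘'` is negative on the first half of the least positive real period: it has no zero there, and
it tends to `-∞` at the origin. -/
lemma derivWeierstrassP_re_neg (hconj : ∀ w ∈ L.lattice, conj w ∈ L.lattice) {Ω : ℝ}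
    (hΩ : IsLeast {x : ℝ | 0 < x ∧ (x : ℂ) ∈ L.lattice} Ω) {r : ℝ} (hr : 0 < r)
    (hrΩ : 2 * r < Ω) : (L.derivWeierstrassP r).re < 0 := by
  have hnot : ∀ x : ℝ, 0 < x → x < Ω → (x : ℂ) ∉ L.lattice := fun x h0 h1 h =>
    absurd (hΩ.2 ⟨h0, h⟩) (not_le.mpr h1)
  by_contra hneg
  rw [not_lt] at hneg
  -- a point close to the origin at which `℘'` is negative
  obtain ⟨x, hx0, hxr, hx⟩ : ∃ x : ℝ, 0 < x ∧ x < r ∧ (L.derivWeierstrassP x).re < 0 := by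
    have h1 : Tendsto (fun x : ℝ => (x : ℂ)) (𝓝[>] 0) (𝓝[≠] 0) := by
      refine tendsto_nhdsWithin_of_tendsto_nhds_of_eventually_within _ ?_ ?_
      · exact (Complex.continuous_ofReal.tendsto' 0 0 (by simp)).mono_left nhdsWithin_le_nhds
      · filter_upwards [self_mem_nhdsWithin] with x hx
        simpa using (ne_of_gt hx : x ≠ 0)
    have h2 := (tendsto_pow_mul_derivWeierstrassP (L := L)).comp h1
    have h3 := (Complex.continuous_re.tendsto (-2 : ℂ)).comp h2
    have h4 : ∀ᶠ x : ℝ in 𝓝[>] 0, ((x : ℂ) ^ 3 * L.derivWeierstrassP x).re < 0 :=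
      h3.eventually_lt_const (by norm_num)
    obtain ⟨x, hx, hx0, hxr⟩ := (h4.and (Ioo_mem_nhdsGT hr)).exists
    refine ⟨x, hx0, hxr, ?_⟩
    rw [← Complex.ofReal_pow, Complex.re_ofReal_mul] at hx
    have : 0 < x ^ 3 := by positivity
    by_contra hge
    exact absurd hx (not_lt.mpr (mul_nonneg this.le (not_lt.mp hge)))
  have hcont : ContinuousOn (fun x : ℝ => (L.derivWeierstrassP x).re) (Set.Icc x r) := by
    intro y hy
    refine ContinuousAt.continuousWithinAt ?_
    have hy' : (y : ℂ) ∉ L.lattice := hnot y (hx0.trans_le hy.1) (by linarith [hy.2])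
    exact Complex.continuous_re.continuousAt.comp (ContinuousAt.comp (x := y)
      (g := L.derivWeierstrassP) (L.analyticOnNhd_derivWeierstrassP y hy').continuousAt
      Complex.continuous_ofReal.continuousAt)
  obtain ⟨y, hy, hy0⟩ := intermediate_value_Icc hxr.le hcont ⟨hx.le, hneg⟩
  have h2y : 2 * (y : ℂ) ∉ L.lattice := by
    have := hnot (2 * y) (by linarith [hy.1]) (by linarith [hy.2])
    push_cast at this; exact this
  exact L.derivWeierstrassP_ne_zero h2y
    (Complex.ext hy0 (derivWeierstrassP_ofReal_im hconj y))

lemma omega_sub_one_mul_notMem (hω : ∀ w ∈ L.lattice, ω * w ∈ L.lattice) {t : ℂ}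
    (h : L.weierstrassP t ≠ 0) : (ω - 1) * t ∉ L.lattice := by
  intro hmem
  have h1 := L.weierstrassP_add_coe t ⟨_, hmem⟩
  simp only at h1
  rw [show t + (ω - 1) * t = ω * t by ring, weierstrassP_omega_mul L hω] at h1
  have h2 : (ω - 1) * L.weierstrassP t = 0 := by linear_combination h1
  rcases mul_eq_zero.mp h2 with h3 | h3
  · exact omega_ne_one (sub_eq_zero.mp h3)
  · exact h h3

section Torsion

variable (hω : ∀ w ∈ L.lattice, ω * w ∈ L.lattice)

lemma three_torsion_notMem {t : ℂ} (ht : t ∉ L.lattice) (h3 : 3 * t ∈ L.lattice) :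
    2 * t ∉ L.lattice := fun h => ht (by
  have := sub_mem h3 h
  rwa [show 3 * t - 2 * t = t by ring] at this)

include hω in
/-- `(1 - ω) t` is fixed by `ω` up to periods, so that `℘` vanishes there. -/
lemma weierstrassP_omega_sub_one_mul {t : ℂ} (h3 : 3 * t ∈ L.lattice) :
    L.weierstrassP ((ω - 1) * t) = 0 := by
  have hmem : ω * ((ω - 1) * t) - (ω - 1) * t ∈ L.lattice := by
    have : ω * ((ω - 1) * t) - (ω - 1) * t = -(ω * (3 * t)) := by
      linear_combination t * omega_sq
    rw [this]; exact neg_mem (hω _ h3)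
  have h1 := L.weierstrassP_add_coe ((ω - 1) * t) ⟨_, hmem⟩
  simp only at h1
  rw [add_sub_cancel, weierstrassP_omega_mul L hω] at h1
  have h2 : (ω - 1) * L.weierstrassP ((ω - 1) * t) = 0 := by linear_combination h1
  exact (mul_eq_zero.mp h2).resolve_left fun h => omega_ne_one (sub_eq_zero.mp h)

include hω in
/-- A three-torsion point with `℘(t) ≠ 0` satisfies `℘'(t)² = 3 ℘(t)³`, by the addition formula at
`z = ω t`: there `z + t = -ω² t`, and `℘(z - t) = 0`. -/
lemma derivWeierstrassP_sq_of_three_torsion {t : ℂ} (ht : t ∉ L.lattice)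
    (h3 : 3 * t ∈ L.lattice) (h0 : L.weierstrassP t ≠ 0) :
    L.derivWeierstrassP t ^ 2 = 3 * L.weierstrassP t ^ 3 := by
  have h2 : 2 * t ∉ L.lattice := three_torsion_notMem ht h3
  have hωt : ω * t ∉ L.lattice := (omega_mul_mem_iff L hω).not.mpr ht
  have hadd : ω * t + t = -(ω * (ω * t)) := by linear_combination t * omega_sq
  have h1 : ω * t + t ∉ L.lattice := by
    rw [hadd, neg_mem_iff]; exact (omega_mul_mem_iff L hω).not.mpr hωt
  have hsub : ω * t - t = (ω - 1) * t := by ring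
  have h2' : ω * t - t ∉ L.lattice := by rw [hsub]; exact omega_sub_one_mul_notMem hω h0
  have key := weierstrassP_sub_sub_weierstrassP_add h2 hωt h1 h2'
  rw [hsub, weierstrassP_omega_sub_one_mul hω h3, hadd, L.weierstrassP_neg,
    weierstrassP_omega_mul L hω, weierstrassP_omega_mul L hω, derivWeierstrassP_omega_mul hω] at key
  have hne : ω * L.weierstrassP t - L.weierstrassP t ≠ 0 := by
    rw [← sub_one_mul]; exact mul_ne_zero (sub_ne_zero.mpr omega_ne_one) h0
  rw [eq_div_iff (pow_ne_zero 2 hne)] at key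
  set x := L.weierstrassP t
  set y := L.derivWeierstrassP t
  have hs : (ω - 1) ^ 2 = -3 * ω := by linear_combination omega_sq
  have : (ω * x - x) ^ 2 = -3 * ω * x ^ 2 := by rw [← sub_one_mul, mul_pow, hs]
  rw [this] at key
  linear_combination -key + 3 * x ^ 3 * omega_pow_three

include hω in
/-- The value of `ℰ₁*` at a three-torsion point, from the addition formula at `z = ω t`. -/
lemma three_mul_E₁star_of_three_torsion {t : ℂ} (ht : t ∉ L.lattice) (h3 : 3 * t ∈ L.lattice)
    (h0 : L.weierstrassP t ≠ 0) :
    3 * L.weierstrassP t * E₁star t L.lattice = -L.derivWeierstrassP t := by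
  have h2 : 2 * t ∉ L.lattice := three_torsion_notMem ht h3
  have hωt : ω * t ∉ L.lattice := (omega_mul_mem_iff L hω).not.mpr ht
  have hωωt : ω * (ω * t) ∉ L.lattice := (omega_mul_mem_iff L hω).not.mpr hωt
  have hadd : ω * t + t = -(ω * (ω * t)) := by linear_combination t * omega_sq
  have h1 : ω * t + t ∉ L.lattice := by rwa [hadd, neg_mem_iff]
  have hsub : ω * t - t = (ω - 1) * t := by ring
  have h2' : (ω - 1) * t ∉ L.lattice := omega_sub_one_mul_notMem hω h0
  have key := E₁star_add_sub_E₁star_sub L hω h2 hωt h1 (by rwa [hsub])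
  have hρ : E₁star ((ω - 1) * t) L.lattice = 0 := by
    have hmem : -(ω * (3 * t)) ∈ L.lattice := neg_mem (hω _ h3)
    have e1 := E₁star_omega_mul L hω h2'
    rw [show ω * ((ω - 1) * t) = (ω - 1) * t + -(ω * (3 * t)) by
      linear_combination t * omega_sq, E₁star_add L _ hmem] at e1
    have e2 : (ω ^ 2 - 1) * E₁star ((ω - 1) * t) L.lattice = 0 := by linear_combination -e1
    refine (mul_eq_zero.mp e2).resolve_left fun h => omega_ne_one ?_
    linear_combination omega_pow_three - ω * h
  rw [hsub, hρ, hadd, E₁star_neg L hω hωωt, E₁star_omega_mul L hω hωt, E₁star_omega_mul L hω ht,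
    weierstrassP_omega_mul L hω, ← sub_one_mul] at key
  set x := L.weierstrassP t
  set y := L.derivWeierstrassP t
  set e := E₁star t L.lattice
  have hne : (ω - 1) * x ≠ 0 := mul_ne_zero (sub_ne_zero.mpr omega_ne_one) h0
  have h5 : y / ((ω - 1) * x) = (2 + ω) * e := by
    linear_combination key + ω * e * omega_pow_three
  rw [div_eq_iff hne] at h5
  linear_combination h5 + x * e * omega_sq

end Torsion

section Special

variable (hg₂ : L.g₂ = 0) (hg₃ : L.g₃ = 27) {Ω : ℝ}
  (hΩ : IsLeast {x : ℝ | 0 < x ∧ (x : ℂ) ∈ L.lattice} |Ω|)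

include hΩ

lemma period_ne_zero : Ω ≠ 0 := abs_pos.mp hΩ.1.1

lemma period_mem : (Ω : ℂ) ∈ L.lattice := by
  have h := hΩ.1.2
  rcases abs_choice Ω with e | e
  · rwa [e] at h
  · rw [e] at h; simpa using h

lemma period_div_three_notMem : (Ω : ℂ) / 3 ∉ L.lattice := by
  intro h
  have h0 := hΩ.1.1
  have h' : ((|Ω| / 3 : ℝ) : ℂ) ∈ L.lattice := by
    rcases abs_choice Ω with e | e
    · rw [e]; push_cast; exact h
    · rw [e]; push_cast; rw [neg_div]; exact neg_mem h
  have := hΩ.2 ⟨by positivity, h'⟩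
  linarith

include hg₂ hg₃

/-- The differential equation and `℘'² = 3 ℘³` leave `℘³ = 27` and `℘' = ±9`; the values are real,
and `℘'` is negative. -/
lemma weierstrassP_and_derivWeierstrassP_abs_div_three :
    L.weierstrassP ((|Ω| / 3 : ℝ) : ℂ) = 3 ∧ L.derivWeierstrassP ((|Ω| / 3 : ℝ) : ℂ) = -9 := by
  have hω := omega_mul_mem_of_g₂_eq_zero hg₂
  have hconj : ∀ w ∈ L.lattice, conj w ∈ L.lattice :=
    conj_mem_of_g₂_of_g₃ (by rw [hg₂, map_zero]) (by rw [hg₃, map_ofNat])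
  have h0 := hΩ.1.1
  set t : ℂ := ((|Ω| / 3 : ℝ) : ℂ) with ht_def
  have ht : t ∉ L.lattice := fun h => by
    have := hΩ.2 ⟨by positivity, h⟩
    linarith
  have h3 : 3 * t ∈ L.lattice := by
    have : 3 * t = (|Ω| : ℝ) := by rw [ht_def]; push_cast; ring
    rw [this]; exact hΩ.1.2
  have hneg : (L.derivWeierstrassP t).re < 0 :=
    derivWeierstrassP_re_neg hconj hΩ (by positivity) (by linarith)
  have hx := weierstrassP_ofReal_im hconj (|Ω| / 3)
  have hy := derivWeierstrassP_ofReal_im hconj (|Ω| / 3)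
  rw [← ht_def] at hx hy
  have hode := L.derivWeierstrassP_sq t ht
  rw [hg₂, hg₃] at hode
  obtain ⟨x, hxe⟩ : ∃ x : ℝ, L.weierstrassP t = x := ⟨_, (Complex.ext rfl (by simp [hx]))⟩
  obtain ⟨y, hye⟩ : ∃ y : ℝ, L.derivWeierstrassP t = y := ⟨_, (Complex.ext rfl (by simp [hy]))⟩
  rw [hye, Complex.ofReal_re] at hneg
  have hode' : y ^ 2 = 4 * x ^ 3 - 27 := by
    rw [hxe, hye] at hode
    have : ((y ^ 2 : ℝ) : ℂ) = ((4 * x ^ 3 - 27 : ℝ) : ℂ) := by push_cast; rw [hode]; ring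
    exact_mod_cast this
  have hx0 : L.weierstrassP t ≠ 0 := by
    rw [hxe]; norm_cast; rintro rfl
    nlinarith [sq_nonneg y]
  have htor := derivWeierstrassP_sq_of_three_torsion hω ht h3 hx0
  have htor' : y ^ 2 = 3 * x ^ 3 := by
    rw [hxe, hye] at htor; exact_mod_cast htor
  have hx27 : x ^ 3 = 3 ^ 3 := by linarith
  have hx3 : x = 3 := by
    have : (x - 3) * (x ^ 2 + 3 * x + 9) = 0 := by linarith
    rcases mul_eq_zero.mp this with h | h
    · linarith
    · nlinarith [sq_nonneg (x + 3 / 2)]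
  have hy9 : y = -9 := by
    have : (y - 9) * (y + 9) = 0 := by rw [hx3] at htor'; linarith
    rcases mul_eq_zero.mp this with h | h <;> linarith
  rw [hxe, hye, hx3, hy9]
  constructor <;> norm_num

lemma weierstrassP_div_three : L.weierstrassP ((Ω : ℂ) / 3) = 3 := by
  have h := (weierstrassP_and_derivWeierstrassP_abs_div_three hg₂ hg₃ hΩ).1
  rcases abs_choice Ω with e | e
  · rw [e] at h; push_cast at h; exact h
  · rw [e] at h; push_cast at h
    rwa [neg_div, L.weierstrassP_neg] at h

lemma derivWeierstrassP_div_three :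
    L.derivWeierstrassP ((Ω : ℂ) / 3) = -9 * (Real.sign Ω : ℂ) := by
  have h := (weierstrassP_and_derivWeierstrassP_abs_div_three hg₂ hg₃ hΩ).2
  rcases lt_or_gt_of_ne (period_ne_zero hΩ) with e | e
  · rw [abs_of_neg e] at h; push_cast at h
    rw [neg_div, L.derivWeierstrassP_neg] at h
    rw [Real.sign_of_neg e]; push_cast; linear_combination -h
  · rw [abs_of_pos e] at h; push_cast at h
    rw [Real.sign_of_pos e]; push_cast; linear_combination h

lemma E₁star_div_three : E₁star ((Ω : ℂ) / 3) L.lattice = (Real.sign Ω : ℂ) := by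
  have h := three_mul_E₁star_of_three_torsion (omega_mul_mem_of_g₂_eq_zero hg₂)
    (period_div_three_notMem hΩ) (by rw [mul_div_cancel₀ _ (by norm_num)]; exact period_mem hΩ)
    (by rw [weierstrassP_div_three hg₂ hg₃ hΩ]; norm_num)
  rw [weierstrassP_div_three hg₂ hg₃ hΩ, derivWeierstrassP_div_three hg₂ hg₃ hΩ] at h
  linear_combination (1 / 9 : ℂ) * h

/-- The sum of the values of `ℰ₁*` at `z + Ω / 3` and `-z + Ω / 3`. -/
theorem E₁star_add_div_three_add_E₁star_neg_add_div_three {z : ℂ} (hz : z ∉ L.lattice)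
    (h1 : z + (Ω : ℂ) / 3 ∉ L.lattice) (h2 : z - (Ω : ℂ) / 3 ∉ L.lattice) :
    E₁star (z + (Ω : ℂ) / 3) L.lattice + E₁star (-z + (Ω : ℂ) / 3) L.lattice =
      -(Real.sign Ω : ℂ) * (9 / (3 - L.weierstrassP z) - 2) := by
  have hω := omega_mul_mem_of_g₂_eq_zero hg₂
  have ht := period_div_three_notMem hΩ
  have h3 : 3 * ((Ω : ℂ) / 3) ∈ L.lattice := by
    rw [mul_div_cancel₀ _ (by norm_num)]; exact period_mem hΩ
  have key := E₁star_add_sub_E₁star_sub L hω (three_torsion_notMem ht h3) hz h1 h2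
  rw [weierstrassP_div_three hg₂ hg₃ hΩ, derivWeierstrassP_div_three hg₂ hg₃ hΩ,
    E₁star_div_three hg₂ hg₃ hΩ] at key
  rw [show -z + (Ω : ℂ) / 3 = -(z - (Ω : ℂ) / 3) by ring, E₁star_neg L hω h2, ← sub_eq_add_neg, key,
    ← neg_sub (L.weierstrassP z) 3, div_neg]
  ring

end Special

end EisensteinTwists

/-! ### The ring `ℤ[ω]` -/

namespace EisensteinTwists

lemma isPrimitiveRoot_omega : IsPrimitiveRoot ω 3 := by
  refine IsPrimitiveRoot.mk_of_lt ω (by norm_num) omega_pow_three fun l hl hl3 h => ?_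
  interval_cases l
  · exact omega_ne_one (by simpa using h)
  · exact omega_ne_one (by linear_combination omega_pow_three - ω * h)

instance : IsCyclotomicExtension {3} ℚ K := by
  change IsCyclotomicExtension {3} ℚ (IntermediateField.adjoin ℚ {ω}).toSubalgebra
  rw [IntermediateField.adjoin_simple_toSubalgebra_of_isAlgebraic isIntegral_omega.isAlgebraic]
  exact isPrimitiveRoot_omega.adjoin_isCyclotomicExtension ℚ

instance : IsPrincipalIdealRing (𝓞 K) := IsCyclotomicExtension.Rat.three_pid K

lemma isPrimitiveRoot_omegaK :
    IsPrimitiveRoot (⟨ω, IntermediateField.mem_adjoin_simple_self ℚ ω⟩ : K) 3 :=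
  IsPrimitiveRoot.of_map_of_injective (f := algebraMap K ℂ)
    (show IsPrimitiveRoot ω 3 from isPrimitiveRoot_omega) (algebraMap K ℂ).injective

/-- The embedding of the ring of integers of `K` into `ℂ`. -/
noncomputable def emb : 𝓞 K →+* ℂ := (algebraMap K ℂ).comp (algebraMap (𝓞 K) K)

lemma emb_injective : Function.Injective emb :=
  (algebraMap K ℂ).injective.comp (FaithfulSMul.algebraMap_injective (𝓞 K) K)

@[simp] lemma emb_omegaO : emb ωO = ω := rfl

lemma emb_apply (x : 𝓞 K) : emb x = ((x : K) : ℂ) := rfl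

lemma emb_ne_zero {x : 𝓞 K} (hx : x ≠ 0) : emb x ≠ 0 := by
  rwa [Ne, map_eq_zero_iff _ emb_injective]

lemma omegaO_sq : ωO ^ 2 + ωO + 1 = 0 :=
  emb_injective (by simpa using omega_sq)

lemma omegaO_pow_three : ωO ^ 3 = 1 := by linear_combination (ωO - 1) * omegaO_sq

lemma isUnit_omegaO : IsUnit ωO := IsUnit.of_pow_eq_one omegaO_pow_three (by norm_num)

lemma toInteger_eq_omegaO : isPrimitiveRoot_omegaK.toInteger = ωO := rfl

lemma exists_eq_add_mul_omegaO (x : 𝓞 K) : ∃ a b : ℤ, x = a + b * ωO := by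
  have hx : x ∈ Algebra.adjoin ℤ {ωO} := by
    have := isPrimitiveRoot_omegaK.integralPowerBasis.adjoin_gen_eq_top
    rw [isPrimitiveRoot_omegaK.integralPowerBasis_gen, toInteger_eq_omegaO] at this
    rw [this]; trivial
  induction hx using Algebra.adjoin_induction with
  | mem x hx => exact ⟨0, 1, by rw [Set.mem_singleton_iff.mp hx]; simp⟩
  | algebraMap r => exact ⟨r, 0, by simp⟩
  | add x y _ _ hx hy =>
    obtain ⟨a, b, rfl⟩ := hx
    obtain ⟨c, d, rfl⟩ := hy
    exact ⟨a + c, b + d, by push_cast; ring⟩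
  | mul x y _ _ hx hy =>
    obtain ⟨a, b, rfl⟩ := hx
    obtain ⟨c, d, rfl⟩ := hy
    exact ⟨a * c - b * d, a * d + b * c - b * d, by
      push_cast; linear_combination (b * d : 𝓞 K) * omegaO_sq⟩

lemma omega_im : ω.im = Real.sqrt 3 / 2 := by
  simp [ω]

lemma add_mul_omegaO_eq_zero {a b : ℤ} (h : (a : 𝓞 K) + b * ωO = 0) : a = 0 ∧ b = 0 := by
  have h1 : (a : ℂ) + b * ω = 0 := by simpa using congrArg emb h
  have h2 := congrArg Complex.im h1
  simp only [Complex.add_im, Complex.intCast_im, Complex.mul_im, Complex.intCast_re, omega_im,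
    zero_mul, add_zero, zero_add, Complex.zero_im] at h2
  have h3 : (b : ℝ) = 0 := by
    rcases mul_eq_zero.mp h2 with h | h
    · exact h
    · have : Real.sqrt 3 > 0 := by positivity
      linarith
  have hb : b = 0 := by exact_mod_cast h3
  subst hb
  refine ⟨?_, rfl⟩
  simpa using h1

/-- The coordinates with respect to the `ℤ`-basis `1, ω` of `ℤ[ω]`. -/
noncomputable def omegaBasis : Module.Basis (Fin 2) ℤ (𝓞 K) :=
  Module.Basis.ofEquivFun (LinearEquiv.ofBijective
    ({ toFun := fun v => (v 0 : 𝓞 K) + v 1 * ωO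
       map_add' := fun v w => by simp only [Pi.add_apply]; push_cast; ring
       map_smul' := fun r v => by
        simp only [Pi.smul_apply, smul_eq_mul, zsmul_eq_mul, eq_intCast]
        push_cast; ring } : (Fin 2 → ℤ) →ₗ[ℤ] 𝓞 K)
    ⟨(injective_iff_map_eq_zero _).mpr fun v hv => by
        obtain ⟨h0, h1⟩ := add_mul_omegaO_eq_zero hv
        ext i; fin_cases i <;> assumption,
      fun x => by
        obtain ⟨a, b, rfl⟩ := exists_eq_add_mul_omegaO x
        exact ⟨![a, b], rfl⟩⟩).symm

lemma omegaBasis_repr (a b : ℤ) :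
    ⇑(omegaBasis.repr ((a : 𝓞 K) + b * ωO)) = ![a, b] := by
  have h : (a : 𝓞 K) + b * ωO = omegaBasis.equivFun.symm ![a, b] := by
    rw [omegaBasis, Module.Basis.equivFun_ofEquivFun]; rfl
  rw [h, ← omegaBasis.equivFun_apply, LinearEquiv.apply_symm_apply]

lemma norm_add_mul_omegaO (a b : ℤ) :
    Algebra.norm ℤ ((a : 𝓞 K) + b * ωO) = a ^ 2 - a * b + b ^ 2 := by
  have hb0 : omegaBasis 0 = 1 := by
    rw [omegaBasis, Module.Basis.coe_ofEquivFun]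
    change (((Pi.single 0 1 : Fin 2 → ℤ) 0 : ℤ) : 𝓞 K) +
      ((Pi.single 0 1 : Fin 2 → ℤ) 1 : ℤ) * ωO = 1
    simp
  have hb1 : omegaBasis 1 = ωO := by
    rw [omegaBasis, Module.Basis.coe_ofEquivFun]
    change (((Pi.single 1 1 : Fin 2 → ℤ) 0 : ℤ) : 𝓞 K) +
      ((Pi.single 1 1 : Fin 2 → ℤ) 1 : ℤ) * ωO = ωO
    simp
  have e0 : ((a : 𝓞 K) + b * ωO) * 1 = (a : 𝓞 K) + b * ωO := mul_one _
  have e1 : ((a : 𝓞 K) + b * ωO) * ωO = ((-b : ℤ) : 𝓞 K) + (a - b : ℤ) * ωO := by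
    push_cast; linear_combination (b : 𝓞 K) * omegaO_sq
  rw [Algebra.norm_eq_matrix_det omegaBasis, Matrix.det_fin_two]
  simp only [Algebra.leftMulMatrix_eq_repr_mul, hb0, hb1, e0, e1, omegaBasis_repr]
  simp
  ring

lemma card_quotient_span (a b : ℤ) :
    Nat.card (𝓞 K ⧸ Ideal.span {(a : 𝓞 K) + b * ωO}) = (a ^ 2 - a * b + b ^ 2).natAbs := by
  rw [← norm_add_mul_omegaO, ← Ideal.absNorm_span_singleton]
  rfl

lemma finite_quotient {I : Ideal (𝓞 K)} (hI : I ≠ ⊥) : Finite (𝓞 K ⧸ I) :=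
  Ideal.finiteQuotientOfFreeOfNeBot I hI

/-- Among the associates of an element prime to `√-3` there is one that is `1` modulo `3`. -/
lemma exists_isUnit_mul_sub_one {x : 𝓞 K} (hx : ¬ (1 - ωO) ∣ x) :
    ∃ u : 𝓞 K, IsUnit u ∧ 3 ∣ u * x - 1 := by
  obtain ⟨a, b, rfl⟩ := exists_eq_add_mul_omegaO x
  have hab : ¬ (3 : ℤ) ∣ a + b := by
    rintro ⟨k, hk⟩
    refine hx ⟨k * (1 - ωO ^ 2) - b, ?_⟩
    have : (a : 𝓞 K) = 3 * k - b := by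
      have := congrArg (Int.cast : ℤ → 𝓞 K) hk
      push_cast at this
      linear_combination this
    rw [this]
    linear_combination (k : 𝓞 K) * omegaO_sq - k * omegaO_pow_three
  have hu := isUnit_omegaO
  -- the residues of `a` and `b` modulo `3` leave six cases, one for each unit
  have key : ∀ (u : 𝓞 K) (r s : ℤ), IsUnit u →
      u * ((a : 𝓞 K) + b * ωO) = (1 + 3 * r : ℤ) + (3 * s : ℤ) * ωO →
      ∃ u : 𝓞 K, IsUnit u ∧ 3 ∣ u * ((a : 𝓞 K) + b * ωO) - 1 := by
    intro u r s hu h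
    exact ⟨u, hu, r + s * ωO, by rw [h]; push_cast; ring⟩
  have ha : a = 3 * (a / 3) + a % 3 := (Int.mul_ediv_add_emod a 3).symm
  have hb : b = 3 * (b / 3) + b % 3 := (Int.mul_ediv_add_emod b 3).symm
  generalize a / 3 = m at ha
  generalize b / 3 = n at hb
  have h1 : a % 3 = 0 ∨ a % 3 = 1 ∨ a % 3 = 2 := by omega
  have h2 : b % 3 = 0 ∨ b % 3 = 1 ∨ b % 3 = 2 := by omega
  rcases h1 with h1 | h1 | h1 <;> rcases h2 with h2 | h2 | h2 <;> rw [h1] at ha <;> rw [h2] at hb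
  · omega
  · refine key (ωO ^ 2) (n - m) (-m) (hu.pow 2) ?_
    rw [ha, hb]; push_cast
    linear_combination (3 * m : 𝓞 K) * omegaO_sq + (3 * n + 1 : 𝓞 K) * omegaO_pow_three
  · refine key (-ωO ^ 2) (m - n - 1) m (hu.pow 2).neg ?_
    rw [ha, hb]; push_cast
    linear_combination (-3 * m : 𝓞 K) * omegaO_sq - (3 * n + 2 : 𝓞 K) * omegaO_pow_three
  · refine key 1 m n isUnit_one ?_
    rw [ha, hb]; push_cast; ring
  · refine key (-ωO) n (n - m) hu.neg ?_
    rw [ha, hb]; push_cast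
    linear_combination (-3 * n - 1 : 𝓞 K) * omegaO_sq
  · omega
  · refine key (-1) (-m - 1) (-n) isUnit_one.neg ?_
    rw [ha, hb]; push_cast; ring
  · omega
  · refine key ωO (-n - 1) (m - n) hu ?_
    rw [ha, hb]; push_cast
    linear_combination (3 * n + 2 : 𝓞 K) * omegaO_sq

lemma isUnit_cases {u : 𝓞 K} (hu : IsUnit u) :
    ∃ k : ℕ, u = ωO ^ k ∨ u = -ωO ^ k := by
  obtain ⟨u, rfl⟩ := hu
  have := IsCyclotomicExtension.Rat.Three.Units.mem isPrimitiveRoot_omegaK u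
  simp only [List.mem_cons, List.not_mem_nil, or_false] at this
  rcases this with rfl | rfl | rfl | rfl | rfl | rfl
  · exact ⟨0, Or.inl (by simp)⟩
  · exact ⟨0, Or.inr (by simp)⟩
  · exact ⟨1, Or.inl (by simp [toInteger_eq_omegaO])⟩
  · exact ⟨1, Or.inr (by simp [toInteger_eq_omegaO])⟩
  · exact ⟨2, Or.inl (by simp [toInteger_eq_omegaO])⟩
  · exact ⟨2, Or.inr (by simp [toInteger_eq_omegaO])⟩

/-- A unit that is `±1` modulo `3` is `±1`. -/
lemma eq_one_or_neg_one_of_three_dvd {u : 𝓞 K} (hu : IsUnit u) {n : ℤ} (h : (3 : 𝓞 K) ∣ u - n) :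
    u = 1 ∨ u = -1 := by
  obtain ⟨u, rfl⟩ := hu
  have := IsCyclotomicExtension.Rat.Three.eq_one_or_neg_one_of_unit_of_congruent
    isPrimitiveRoot_omegaK u ⟨n, ?_⟩
  · rcases this with rfl | rfl <;> simp
  · refine Dvd.dvd.trans ⟨-ωO ^ 2, ?_⟩ h
    change (3 : 𝓞 K) = (ωO - 1) ^ 2 * -ωO ^ 2
    linear_combination (ωO ^ 2 - 3 * ωO + 3) * omegaO_sq

end EisensteinTwists

/-! ### Power residue characters and Frobenius elements -/

namespace EisensteinTwists

section PowerChar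

variable {m : ℕ} {ζ : 𝓞 K} {𝔮 : Ideal (𝓞 K)}

open Classical in
/-- The power residue character modulo a prime ideal `𝔮`, with values in `𝓞 K`: the `m`-th root of
unity congruent to `a ^ ((N𝔮 - 1) / m)` modulo `𝔮`, if there is one, and `0` otherwise. -/
noncomputable def powerChar (m : ℕ) (𝔮 : Ideal (𝓞 K)) (a : 𝓞 K) : 𝓞 K :=
  if h : ∃ z : 𝓞 K, z ^ m = 1 ∧ a ^ ((Nat.card (𝓞 K ⧸ 𝔮) - 1) / m) - z ∈ 𝔮 then h.choose else 0

/-- A primitive root of unity of prime order stays primitive modulo a prime not above that order. -/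
lemma isPrimitiveRoot_mk (hm : m.Prime) (hζ : IsPrimitiveRoot ζ m) (h𝔮 : 𝔮.IsPrime)
    (h0 : 𝔮 ≠ ⊥) (hm𝔮 : (m : 𝓞 K) ∉ 𝔮) : IsPrimitiveRoot (Ideal.Quotient.mk 𝔮 ζ) m := by
  have : NeZero m := ⟨hm.ne_zero⟩
  have := finite_quotient h0
  refine hζ.idealQuotient_mk (fun h => h𝔮.ne_top (Ideal.absNorm_eq_one_iff.mp h)) ?_
  refine ((Nat.Prime.coprime_iff_not_dvd hm).mpr fun hd => ?_).symm
  have : Fact m.Prime := ⟨hm⟩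
  obtain ⟨x, hx⟩ := exists_prime_addOrderOf_dvd_card' (G := 𝓞 K ⧸ 𝔮) m hd
  have h1 : (m : 𝓞 K ⧸ 𝔮) * x = 0 := by
    rw [← nsmul_eq_mul, ← hx]; exact addOrderOf_nsmul_eq_zero x
  rcases mul_eq_zero.mp h1 with h1 | h1
  · exact hm𝔮 (Ideal.Quotient.eq_zero_iff_mem.mp (by simpa using h1))
  · rw [h1, addOrderOf_zero] at hx
    exact hm.one_lt.ne hx

lemma dvd_card_sub_one (hm : m.Prime) (hζ : IsPrimitiveRoot ζ m) (h𝔮 : 𝔮.IsPrime)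
    (h0 : 𝔮 ≠ ⊥) (hm𝔮 : (m : 𝓞 K) ∉ 𝔮) : m ∣ Nat.card (𝓞 K ⧸ 𝔮) - 1 := by
  have := finite_quotient h0
  have := Fintype.ofFinite (𝓞 K ⧸ 𝔮)
  have h := isPrimitiveRoot_mk hm hζ h𝔮 h0 hm𝔮
  have hmax := h𝔮.isMaximal h0
  let := Ideal.Quotient.field 𝔮
  rw [Nat.card_eq_fintype_card]
  exact h.dvd_of_pow_eq_one _ (FiniteField.pow_card_sub_one_eq_one _ (h.ne_zero hm.ne_zero))

lemma eq_of_pow_eq_one_of_sub_mem (hm : m.Prime) (hζ : IsPrimitiveRoot ζ m) (h𝔮 : 𝔮.IsPrime)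
    (h0 : 𝔮 ≠ ⊥) (hm𝔮 : (m : 𝓞 K) ∉ 𝔮) {z w : 𝓞 K} (hz : z ^ m = 1) (hw : w ^ m = 1)
    (hzw : z - w ∈ 𝔮) : z = w := by
  have : NeZero m := ⟨hm.ne_zero⟩
  obtain ⟨i, hi, rfl⟩ := hζ.eq_pow_of_pow_eq_one hz
  obtain ⟨j, hj, rfl⟩ := hζ.eq_pow_of_pow_eq_one hw
  have h := Ideal.Quotient.eq.mpr hzw
  rw [map_pow, map_pow] at h
  rw [(isPrimitiveRoot_mk hm hζ h𝔮 h0 hm𝔮).pow_inj hi hj h]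

lemma powerChar_eq (hm : m.Prime) (hζ : IsPrimitiveRoot ζ m) (h𝔮 : 𝔮.IsPrime)
    (h0 : 𝔮 ≠ ⊥) (hm𝔮 : (m : 𝓞 K) ∉ 𝔮) {a z : 𝓞 K} (hz : z ^ m = 1)
    (h : a ^ ((Nat.card (𝓞 K ⧸ 𝔮) - 1) / m) - z ∈ 𝔮) : powerChar m 𝔮 a = z := by
  have hex : ∃ z : 𝓞 K, z ^ m = 1 ∧ a ^ ((Nat.card (𝓞 K ⧸ 𝔮) - 1) / m) - z ∈ 𝔮 := ⟨z, hz, h⟩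
  rw [powerChar, dif_pos hex]
  refine eq_of_pow_eq_one_of_sub_mem hm hζ h𝔮 h0 hm𝔮 hex.choose_spec.1 hz ?_
  have := 𝔮.sub_mem h hex.choose_spec.2
  rwa [sub_sub_sub_cancel_left] at this

lemma powerChar_spec (hm : m.Prime) (hζ : IsPrimitiveRoot ζ m) (h𝔮 : 𝔮.IsPrime)
    (h0 : 𝔮 ≠ ⊥) (hm𝔮 : (m : 𝓞 K) ∉ 𝔮) {a : 𝓞 K} (ha : a ∉ 𝔮) :
    powerChar m 𝔮 a ^ m = 1 ∧ a ^ ((Nat.card (𝓞 K ⧸ 𝔮) - 1) / m) - powerChar m 𝔮 a ∈ 𝔮 := by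
  have hex : ∃ z : 𝓞 K, z ^ m = 1 ∧ a ^ ((Nat.card (𝓞 K ⧸ 𝔮) - 1) / m) - z ∈ 𝔮 := by
    have := finite_quotient h0
    have := Fintype.ofFinite (𝓞 K ⧸ 𝔮)
    have hmax := h𝔮.isMaximal h0
    let := Ideal.Quotient.field 𝔮
    have : NeZero m := ⟨hm.ne_zero⟩
    have h1 : (Ideal.Quotient.mk 𝔮 a ^ ((Nat.card (𝓞 K ⧸ 𝔮) - 1) / m)) ^ m = 1 := by
      rw [← pow_mul, Nat.div_mul_cancel (dvd_card_sub_one hm hζ h𝔮 h0 hm𝔮),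
        Nat.card_eq_fintype_card]
      exact FiniteField.pow_card_sub_one_eq_one _ (by
        rwa [Ne, Ideal.Quotient.eq_zero_iff_mem])
    obtain ⟨i, -, hi⟩ := (isPrimitiveRoot_mk hm hζ h𝔮 h0 hm𝔮).eq_pow_of_pow_eq_one h1
    refine ⟨ζ ^ i, by rw [← pow_mul, mul_comm, pow_mul, hζ.pow_eq_one, one_pow], ?_⟩
    rw [← Ideal.Quotient.eq, map_pow, map_pow, hi]
  rw [powerChar, dif_pos hex]
  exact hex.choose_spec

lemma powerChar_mul (hm : m.Prime) (hζ : IsPrimitiveRoot ζ m) (h𝔮 : 𝔮.IsPrime)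
    (h0 : 𝔮 ≠ ⊥) (hm𝔮 : (m : 𝓞 K) ∉ 𝔮) {a b : 𝓞 K} (ha : a ∉ 𝔮) (hb : b ∉ 𝔮) :
    powerChar m 𝔮 (a * b) = powerChar m 𝔮 a * powerChar m 𝔮 b := by
  obtain ⟨h1, h2⟩ := powerChar_spec hm hζ h𝔮 h0 hm𝔮 ha
  obtain ⟨h3, h4⟩ := powerChar_spec hm hζ h𝔮 h0 hm𝔮 hb
  refine powerChar_eq hm hζ h𝔮 h0 hm𝔮 (by rw [mul_pow, h1, h3, one_mul]) ?_
  rw [← Ideal.Quotient.eq] at h2 h4 ⊢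
  rw [mul_pow, map_mul, map_mul, h2, h4]

lemma powerChar_congr (hm : m.Prime) (hζ : IsPrimitiveRoot ζ m) (h𝔮 : 𝔮.IsPrime)
    (h0 : 𝔮 ≠ ⊥) (hm𝔮 : (m : 𝓞 K) ∉ 𝔮) {a b : 𝓞 K} (ha : a ∉ 𝔮) (hab : a - b ∈ 𝔮) :
    powerChar m 𝔮 a = powerChar m 𝔮 b := by
  obtain ⟨h1, h2⟩ := powerChar_spec hm hζ h𝔮 h0 hm𝔮 ha
  refine (powerChar_eq hm hζ h𝔮 h0 hm𝔮 h1 ?_).symm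
  rw [← Ideal.Quotient.eq] at h2 hab ⊢
  rw [← h2, map_pow, map_pow, hab]

/-- `m`-th powers have trivial power residue character. -/
lemma powerChar_pow (hm : m.Prime) (hζ : IsPrimitiveRoot ζ m) (h𝔮 : 𝔮.IsPrime)
    (h0 : 𝔮 ≠ ⊥) (hm𝔮 : (m : 𝓞 K) ∉ 𝔮) {a : 𝓞 K} (ha : a ∉ 𝔮) :
    powerChar m 𝔮 (a ^ m) = 1 := by
  refine powerChar_eq hm hζ h𝔮 h0 hm𝔮 (one_pow _) ?_
  have := finite_quotient h0
  have := Fintype.ofFinite (𝓞 K ⧸ 𝔮)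
  have hmax := h𝔮.isMaximal h0
  let := Ideal.Quotient.field 𝔮
  rw [← Ideal.Quotient.eq, ← pow_mul, Nat.mul_div_cancel' (dvd_card_sub_one hm hζ h𝔮 h0 hm𝔮),
    Nat.card_eq_fintype_card, map_pow, map_one]
  exact FiniteField.pow_card_sub_one_eq_one _ (by rwa [Ne, Ideal.Quotient.eq_zero_iff_mem])

end PowerChar

section Kummer

variable {m : ℕ} {a : 𝓞 K}

lemma isSplittingField_kummer (hm : m ≠ 0) (a : 𝓞 K) :
    (Polynomial.X ^ m - Polynomial.C (a : K)).IsSplittingField K (kummer m a) := by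
  have h : {z : ℂ | z ^ m = ((a : K) : ℂ)} =
      (Polynomial.X ^ m - Polynomial.C (a : K)).rootSet ℂ := by
    ext z
    rw [Polynomial.mem_rootSet_of_ne (Polynomial.X_pow_sub_C_ne_zero (Nat.pos_of_ne_zero hm) _)]
    simp [sub_eq_zero]
  unfold kummer
  rw [h]
  exact IntermediateField.adjoin_rootSet_isSplittingField (IsAlgClosed.splits _)

lemma finiteDimensional_kummer (hm : m ≠ 0) (a : 𝓞 K) : FiniteDimensional K (kummer m a) :=
  have := isSplittingField_kummer hm a
  Polynomial.IsSplittingField.finiteDimensional _ (Polynomial.X ^ m - Polynomial.C (a : K))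

lemma numberField_kummer (hm : m ≠ 0) (a : 𝓞 K) : NumberField (kummer m a) :=
  have := finiteDimensional_kummer hm a
  NumberField.of_module_finite K _

lemma isGalois_kummer (hm : m ≠ 0) (a : 𝓞 K) : IsGalois K (kummer m a) := by
  have := isSplittingField_kummer hm a
  have : Normal K (kummer m a) :=
    Normal.of_isSplittingField (Polynomial.X ^ m - Polynomial.C (a : K))
  exact ⟨⟩

/-- Frobenius elements exist at every nonzero prime. -/
lemma exists_isFrobenius (hm : m ≠ 0) (a : 𝓞 K) {𝔮 : Ideal (𝓞 K)} (h𝔮 : 𝔮.IsPrime)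
    (h0 : 𝔮 ≠ ⊥) : ∃ φ : kummer m a ≃ₐ[K] kummer m a, IsFrobenius 𝔮 φ := by
  have := finiteDimensional_kummer hm a
  have := numberField_kummer hm a
  have := isGalois_kummer hm a
  obtain ⟨Q, -, hQ, hQ𝔮⟩ := Ideal.exists_ideal_over_prime_of_isIntegral
    (S := 𝓞 (kummer m a)) 𝔮 ⊥ (by
      rw [← RingHom.ker_eq_comap_bot, (RingHom.injective_iff_ker_eq_bot _).mp
        (FaithfulSMul.algebraMap_injective (𝓞 K) (𝓞 (kummer m a)))]
      exact bot_le)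
  have hlies : Q.LiesOver 𝔮 := ⟨hQ𝔮.symm⟩
  have hQ0 : Q ≠ ⊥ := by
    rintro rfl
    apply h0
    rw [← hQ𝔮, ← RingHom.ker_eq_comap_bot]
    exact (RingHom.injective_iff_ker_eq_bot _).mp
      (FaithfulSMul.algebraMap_injective (𝓞 K) (𝓞 (kummer m a)))
  have : Finite (𝓞 (kummer m a) ⧸ Q) := Ideal.finiteQuotientOfFreeOfNeBot Q hQ0
  obtain ⟨φ, hφ⟩ := IsArithFrobAt.exists_of_isInvariant (𝓞 K) (kummer m a ≃ₐ[K] kummer m a) Q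
  refine ⟨φ, Q, hQ, hlies, fun x => ?_⟩
  have := hφ x
  rwa [← hlies.over] at this

/-- A root of `X ^ m - a` in the Kummer extension. -/
lemma exists_pow_eq (hm : m ≠ 0) (a : 𝓞 K) :
    ∃ α : kummer m a, α ^ m = algebraMap K (kummer m a) a := by
  obtain ⟨z, hz⟩ := IsAlgClosed.exists_pow_nat_eq ((a : K) : ℂ) (Nat.pos_of_ne_zero hm)
  exact ⟨⟨z, IntermediateField.subset_adjoin _ _ hz⟩, Subtype.ext hz⟩

lemma exists_integer_pow_eq (hm : m ≠ 0) {α : kummer m a}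
    (hα : α ^ m = algebraMap K (kummer m a) a) :
    ∃ β : 𝓞 (kummer m a), (β : kummer m a) = α ∧ β ^ m = algebraMap (𝓞 K) _ a := by
  have hint : IsIntegral ℤ α := by
    refine IsIntegral.of_pow (Nat.pos_of_ne_zero hm) ?_
    rw [hα]
    exact (NumberField.RingOfIntegers.isIntegral_coe a).map
      (Algebra.ofId K (kummer m a) |>.restrictScalars ℤ)
  exact ⟨⟨α, hint⟩, rfl, NumberField.RingOfIntegers.ext hα⟩

/-- A Frobenius element at a prime `𝔮` not above `m a` acts on the `m`-th roots of `a` through the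
power residue character. -/
lemma IsFrobenius.apply_eq (hm : m.Prime) {ζ : 𝓞 K} (hζ : IsPrimitiveRoot ζ m)
    {𝔮 : Ideal (𝓞 K)} (h𝔮 : 𝔮.IsPrime) (h0 : 𝔮 ≠ ⊥) (hm𝔮 : (m : 𝓞 K) ∉ 𝔮) (ha : a ∉ 𝔮)
    {φ : kummer m a ≃ₐ[K] kummer m a} (hφ : IsFrobenius 𝔮 φ) {α : kummer m a}
    (hα : α ^ m = algebraMap K (kummer m a) a) :
    φ α = algebraMap K (kummer m a) (powerChar m 𝔮 a) * α := by
  have : NeZero m := ⟨hm.ne_zero⟩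
  obtain ⟨Q, hQ, hlies, hF⟩ := hφ
  obtain ⟨hz1, hz2⟩ := powerChar_spec hm hζ h𝔮 h0 hm𝔮 ha
  set z := powerChar m 𝔮 a
  have ha0 : a ≠ 0 := fun h => ha (h ▸ 𝔮.zero_mem)
  have hα0 : α ≠ 0 := by
    rintro rfl
    rw [zero_pow hm.ne_zero, eq_comm, map_eq_zero] at hα
    exact ha0 (NumberField.RingOfIntegers.coe_eq_zero_iff.mp hα)
  have hmap (x : 𝓞 K) : algebraMap (𝓞 K) (𝓞 (kummer m a)) x ∈ Q ↔ x ∈ 𝔮 := by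
    rw [hlies.over]; rfl
  -- `φ α / α` is an `m`-th root of unity
  have hζ' : IsPrimitiveRoot (algebraMap K (kummer m a) ζ) m :=
    (hζ.map_of_injective (f := algebraMap (𝓞 K) K)
      (FaithfulSMul.algebraMap_injective (𝓞 K) K)).map_of_injective (algebraMap K _).injective
  have hr : (φ α / α) ^ m = 1 := by
    rw [div_pow, ← map_pow, hα, AlgEquiv.commutes, ← hα, div_self (pow_ne_zero _ hα0)]
  obtain ⟨i, -, hi⟩ := hζ'.eq_pow_of_pow_eq_one hr
  have hφα : φ α = algebraMap K (kummer m a) ((ζ ^ i : 𝓞 K) : K) * α := by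
    rw [eq_div_iff hα0] at hi
    rw [← hi]; simp
  obtain ⟨β, hβ, hβm⟩ := exists_integer_pow_eq hm.ne_zero hα
  have hφβ : φ • β = algebraMap (𝓞 K) (𝓞 (kummer m a)) (ζ ^ i) * β := by
    apply NumberField.RingOfIntegers.ext
    change φ (β : kummer m a) = algebraMap K (kummer m a) ((ζ ^ i : 𝓞 K) : K) * (β : kummer m a)
    rw [hβ, hφα]
  have hcard : Nat.card (𝓞 K ⧸ 𝔮) = m * ((Nat.card (𝓞 K ⧸ 𝔮) - 1) / m) + 1 := by
    rw [Nat.mul_div_cancel' (dvd_card_sub_one hm hζ h𝔮 h0 hm𝔮)]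
    have := finite_quotient h0
    have : 0 < Nat.card (𝓞 K ⧸ 𝔮) := Nat.card_pos
    omega
  have h1 := hF β
  rw [hφβ, hcard, pow_succ, pow_mul, hβm, ← map_pow, ← sub_mul, ← map_sub] at h1
  have hβQ : β ∉ Q := fun h => by
    have := Q.pow_mem_of_mem h m hm.pos
    rw [hβm, hmap] at this
    exact ha this
  have h2 := (hmap _).mp ((hQ.mem_or_mem h1).resolve_right hβQ)
  have h3 : ζ ^ i = z := by
    refine eq_of_pow_eq_one_of_sub_mem hm hζ h𝔮 h0 hm𝔮
      (by rw [← pow_mul, mul_comm, pow_mul, hζ.pow_eq_one, one_pow]) hz1 ?_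
    have := 𝔮.add_mem h2 hz2
    rwa [sub_add_sub_cancel] at this
  rw [hφα, h3]

/-- If all Frobenius elements at `𝔮` multiply the `m`-th roots of `a` by `z`, then `z` is the value
of the power residue symbol. -/
lemma residueSymbolAt_eq (hm : m ≠ 0) (ha : a ≠ 0) {𝔮 : Ideal (𝓞 K)} (h𝔮 : 𝔮.IsPrime)
    (h0 : 𝔮 ≠ ⊥) {z : 𝓞 K}
    (h : ∀ φ : kummer m a ≃ₐ[K] kummer m a, IsFrobenius 𝔮 φ → ∀ α : kummer m a,
      α ^ m = algebraMap K (kummer m a) a → φ α = algebraMap K (kummer m a) z * α) :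
    residueSymbolAt m a 𝔮 = emb z := by
  have hex : ∃ ζ : ℂ, IsResidueSymbolAt m a 𝔮 ζ := by
    obtain ⟨φ, hφ⟩ := exists_isFrobenius hm a h𝔮 h0
    refine ⟨emb z, φ, hφ, fun α hα => ?_⟩
    rw [h φ hφ α (Subtype.ext hα)]
    rfl
  rw [residueSymbolAt, dif_pos hex]
  obtain ⟨φ, hφ, hφα⟩ := hex.choose_spec
  obtain ⟨α, hα⟩ := exists_pow_eq hm a
  have h1 := hφα α (congrArg Subtype.val hα)
  rw [h φ hφ α hα] at h1
  have hα0 : (α : ℂ) ≠ 0 := by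
    intro h'
    have h2 : (α : ℂ) ^ m = emb a := congrArg Subtype.val hα
    rw [h', zero_pow hm] at h2
    exact emb_ne_zero ha h2.symm
  exact (mul_right_cancel₀ hα0 h1).symm

/-- The power residue symbol at a prime not above `m a` is the power residue character. -/
lemma residueSymbolAt_eq_powerChar (hm : m.Prime) {ζ : 𝓞 K} (hζ : IsPrimitiveRoot ζ m)
    {𝔮 : Ideal (𝓞 K)} (h𝔮 : 𝔮.IsPrime) (h0 : 𝔮 ≠ ⊥) (hm𝔮 : (m : 𝓞 K) ∉ 𝔮) (ha : a ∉ 𝔮) :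
    residueSymbolAt m a 𝔮 = emb (powerChar m 𝔮 a) :=
  residueSymbolAt_eq hm.ne_zero (by rintro rfl; exact ha 𝔮.zero_mem) h𝔮 h0 fun _ hφ _ hα =>
    hφ.apply_eq hm hζ h𝔮 h0 hm𝔮 ha hα

end Kummer

section Quadratic

/-- The quadratic residue symbol of `1 + 4 μ` at the prime `2`, read off from the action of
Frobenius on the root `(1 + √a) / 2` of `X² - X - μ`. -/
lemma residueSymbolAt_two_span_two {a μ : 𝓞 K} (ha : a = 1 + 4 * μ) (ha0 : a ≠ 0)
    (h2 : (Ideal.span {(2 : 𝓞 K)}).IsPrime) :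
    ((2 : 𝓞 K) ∣ μ + μ ^ 2 → residueSymbolAt 2 a (Ideal.span {2}) = 1) ∧
    (¬ (2 : 𝓞 K) ∣ μ + μ ^ 2 → residueSymbolAt 2 a (Ideal.span {2}) = -1) := by
  have h20 : (Ideal.span {(2 : 𝓞 K)}) ≠ ⊥ := by
    rw [Ne, Ideal.span_singleton_eq_bot]; exact two_ne_zero
  have hcard : Nat.card (𝓞 K ⧸ Ideal.span {(2 : 𝓞 K)}) = 4 := by
    simpa using card_quotient_span 2 0
  have key : ∀ φ : kummer 2 a ≃ₐ[K] kummer 2 a, IsFrobenius (Ideal.span {2}) φ →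
      ∀ α : kummer 2 a, α ^ 2 = algebraMap K (kummer 2 a) a →
      (φ α = α ∧ (2 : 𝓞 K) ∣ μ + μ ^ 2) ∨ (φ α = -α ∧ ¬ (2 : 𝓞 K) ∣ μ + μ ^ 2) := by
    rintro φ ⟨Q, hQ, hlies, hF⟩ α hα
    set μ' : kummer 2 a := algebraMap K (kummer 2 a) μ with hμ'
    have hα' : α ^ 2 = 1 + 4 * μ' := by
      rw [hα, hμ', show (a : K) = 1 + 4 * (μ : K) by
        simpa only [map_add, map_one, map_mul, map_ofNat] using
          congrArg (algebraMap (𝓞 K) K) ha, map_add, map_one, map_mul, map_ofNat]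
    set θ : kummer 2 a := (1 + α) / 2 with hθ
    have hθ2 : θ ^ 2 = θ + μ' := by
      rw [hθ]; linear_combination (1 / 4) * hα'
    have hμint : IsIntegral ℤ μ' :=
      (NumberField.RingOfIntegers.isIntegral_coe μ).map
        (Algebra.ofId K (kummer 2 a) |>.restrictScalars ℤ)
    have hint : IsIntegral ℤ θ := by
      have h1 : IsIntegral ℤ (α : kummer 2 a) := by
        refine IsIntegral.of_pow (n := 2) (by norm_num) ?_
        rw [hα]
        exact (NumberField.RingOfIntegers.isIntegral_coe a).map
          (Algebra.ofId K (kummer 2 a) |>.restrictScalars ℤ)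
      have h3 : IsIntegral (integralClosure ℤ (kummer 2 a)) θ := by
        refine ⟨Polynomial.X ^ 2 - Polynomial.X - Polynomial.C ⟨μ', hμint⟩, ?_, ?_⟩
        · rw [sub_sub]
          apply Polynomial.monic_X_pow_sub
          refine lt_of_le_of_lt ((Polynomial.degree_add_le _ _).trans
            (max_le Polynomial.degree_X_le (Polynomial.degree_C_le.trans zero_le_one))) ?_
          norm_num
        · simp only [Polynomial.eval₂_sub, Polynomial.eval₂_pow, Polynomial.eval₂_X,
            Polynomial.eval₂_C]
          change θ ^ 2 - θ - μ' = 0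
          rw [hθ2]; ring
      exact isIntegral_trans (A := integralClosure ℤ (kummer 2 a)) θ h3
    set Θ : 𝓞 (kummer 2 a) := ⟨θ, hint⟩ with hΘ
    set M : 𝓞 (kummer 2 a) := algebraMap (𝓞 K) _ μ with hM
    have hΘ2 : Θ ^ 2 = Θ + M := NumberField.RingOfIntegers.ext hθ2
    have hmap (x : 𝓞 K) :
        algebraMap (𝓞 K) (𝓞 (kummer 2 a)) x ∈ Q ↔ (2 : 𝓞 K) ∣ x := by
      rw [← Ideal.mem_span_singleton, hlies.over]; rfl
    have h2Q : (2 : 𝓞 (kummer 2 a)) ∈ Q := by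
      have := (hmap 2).mpr dvd_rfl
      rwa [map_ofNat] at this
    have h1 := hF Θ
    rw [hcard] at h1
    have h4 : Θ ^ 4 = Θ + (M + M ^ 2) + 2 * (Θ * M) := by
      linear_combination (Θ ^ 2 + Θ + M + 1) * hΘ2
    rw [h4] at h1
    have hφ2 : (φ α) ^ 2 = α ^ 2 := by
      rw [← map_pow, hα, AlgEquiv.commutes]
    have hφΘ : ((φ • Θ : 𝓞 (kummer 2 a)) : kummer 2 a) = (1 + φ α) / 2 := by
      change φ ((1 + α) / 2) = _
      rw [map_div₀, map_add, map_one, map_ofNat]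
    rcases sq_eq_sq_iff_eq_or_eq_neg.mp hφ2 with h | h
    · refine Or.inl ⟨h, ?_⟩
      have h5 : φ • Θ = Θ := NumberField.RingOfIntegers.ext (by rw [hφΘ, h]; rfl)
      rw [h5] at h1
      have h6 := Q.neg_mem (Q.add_mem h1 (Q.mul_mem_right (Θ * M) h2Q))
      rw [← hmap, map_add, map_pow]
      convert h6 using 1
      ring
    · refine Or.inr ⟨h, fun hd => ?_⟩
      have h5 : φ • Θ = 1 - Θ := NumberField.RingOfIntegers.ext (by
        rw [hφΘ, h]
        change (1 + -α) / 2 = 1 - (1 + α) / 2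
        ring)
      rw [h5] at h1
      rw [← hmap, map_add, map_pow] at hd
      have h6 := Q.add_mem (Q.add_mem h1 (Q.mul_mem_right (Θ * M + Θ) h2Q)) hd
      refine hQ.ne_top ((Ideal.eq_top_iff_one _).mpr ?_)
      convert h6 using 1
      ring
  constructor
  · intro hd
    rw [← map_one emb]
    refine residueSymbolAt_eq two_ne_zero ha0 h2 h20 fun φ hφ α hα => ?_
    rcases key φ hφ α hα with h | h
    · rw [h.1]; simp
    · exact absurd hd h.2
  · intro hd
    rw [← map_one emb, ← map_neg]
    refine residueSymbolAt_eq two_ne_zero ha0 h2 h20 fun φ hφ α hα => ?_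
    rcases key φ hφ α hα with h | h
    · exact absurd h.2 hd
    · rw [h.1]; simp

end Quadratic

section Product

open UniqueFactorizationMonoid

lemma residueSymbol_mul (m : ℕ) (a : 𝓞 K) {I J : Ideal (𝓞 K)} (hI : I ≠ ⊥) (hJ : J ≠ ⊥) :
    residueSymbol m a (I * J) = residueSymbol m a I * residueSymbol m a J := by
  rw [residueSymbol, normalizedFactors_mul hI hJ, Multiset.map_add, Multiset.prod_add]
  rfl

lemma residueSymbol_one (m : ℕ) (a : 𝓞 K) : residueSymbol m a 1 = 1 := by
  rw [residueSymbol, normalizedFactors_one]; simp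

lemma residueSymbol_span_of_prime (m : ℕ) (a : 𝓞 K) {q : 𝓞 K} (hq : Prime q) :
    residueSymbol m a (Ideal.span {q}) = residueSymbolAt m a (Ideal.span {q}) := by
  have : Prime (Ideal.span {q}) := Ideal.prime_of_isPrime
    (by rw [Ne, Ideal.span_singleton_eq_bot]; exact hq.ne_zero)
    ((Ideal.span_singleton_prime hq.ne_zero).mpr hq)
  rw [residueSymbol, normalizedFactors_irreducible this.irreducible, normalize_eq]
  simp

/-- If suitable generators of the prime factors of `β` have residue symbols given by a function `χ`
that is multiplicative on a submonoid `G`, then so has an associate of `β`. -/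
lemma exists_associated_residueSymbol_eq (m : ℕ) (a : 𝓞 K) (G : Submonoid (𝓞 K)) (χ : 𝓞 K → ℂ)
    (h1 : χ 1 = 1) (hmul : ∀ x ∈ G, ∀ y ∈ G, χ (x * y) = χ x * χ y) {β : 𝓞 K} (hβ : β ≠ 0)
    (h : ∀ q, Prime q → q ∣ β →
      ∃ q' ∈ G, Associated q q' ∧ residueSymbolAt m a (Ideal.span {q'}) = χ q') :
    ∃ γ ∈ G, Associated β γ ∧ residueSymbol m a (Ideal.span {β}) = χ γ := by
  induction β using induction_on_prime with
  | h₁ => exact absurd rfl hβ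
  | h₂ x hx =>
    refine ⟨1, G.one_mem, associated_one_iff_isUnit.mpr hx, ?_⟩
    rw [Ideal.span_singleton_eq_top.mpr hx, ← Ideal.one_eq_top, residueSymbol_one, h1]
  | h₃ x q hx hq ih =>
    obtain ⟨γ, hγ, hxγ, e1⟩ := ih hx fun r hr hrx => h r hr (hrx.mul_left q)
    obtain ⟨q', hq', hqq', e2⟩ := h q hq (dvd_mul_right q x)
    refine ⟨q' * γ, G.mul_mem hq' hγ, hqq'.mul_mul hxγ, ?_⟩
    have e3 : Ideal.span {q} = Ideal.span {q'} := Ideal.span_singleton_eq_span_singleton.mpr hqq'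
    rw [← Ideal.span_singleton_mul_span_singleton, residueSymbol_mul, e1,
      residueSymbol_span_of_prime m a hq, e3, e2, hmul _ hq' _ hγ]
    · rw [Ne, Ideal.span_singleton_eq_bot]; exact hq.ne_zero
    · rw [Ne, Ideal.span_singleton_eq_bot]; exact hx

end Product

section Primes

lemma span_ne_bot {x : 𝓞 K} (hx : x ≠ 0) : Ideal.span {x} ≠ ⊥ := by
  rwa [Ne, Ideal.span_singleton_eq_bot]

lemma exists_prime_dvd {q : 𝓞 K} (hq : Prime q) : ∃ l : ℕ, l.Prime ∧ q ∣ (l : 𝓞 K) := by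
  have h0 : Ideal.absNorm (Ideal.span {q}) ≠ 0 := by
    rw [Ne, Ideal.absNorm_eq_zero_iff, Ideal.span_singleton_eq_bot]; exact hq.ne_zero
  have h := Ideal.mem_span_singleton.mp (Ideal.absNorm_mem (Ideal.span {q}))
  rw [← Nat.prod_primeFactorsList h0, Nat.cast_list_prod] at h
  obtain ⟨x, hx, hqx⟩ := (Prime.dvd_prod_iff hq).mp h
  obtain ⟨l, hl, rfl⟩ := List.mem_map.mp hx
  exact ⟨l, Nat.prime_of_mem_primeFactorsList hl, hqx⟩

/-- A prime of `ℤ[ω]` above `l` either has norm `l` or is associated to `l`. -/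
lemma card_quotient_eq_or_associated {q : 𝓞 K} (hq : Prime q) {l : ℕ} (hl : l.Prime)
    (hql : q ∣ (l : 𝓞 K)) :
    Nat.card (𝓞 K ⧸ Ideal.span {q}) = l ∨ Associated q (l : 𝓞 K) := by
  obtain ⟨s, hs⟩ := hql
  have h1 : Nat.card (𝓞 K ⧸ Ideal.span {(l : 𝓞 K)}) = l ^ 2 := by
    have := card_quotient_span l 0
    simp only [Int.cast_natCast, Int.cast_zero, zero_mul, add_zero] at this
    rw [this]
    simp [Int.natAbs_pow]
  have h2 : Nat.card (𝓞 K ⧸ Ideal.span {q}) * Nat.card (𝓞 K ⧸ Ideal.span {s}) = l ^ 2 := by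
    rw [← h1, hs]
    change Ideal.absNorm _ * Ideal.absNorm _ = Ideal.absNorm _
    rw [← map_mul, Ideal.span_singleton_mul_span_singleton]
  obtain ⟨k, hk, hqk⟩ := (Nat.dvd_prime_pow hl).mp (Dvd.intro _ h2)
  interval_cases k
  · have : Ideal.absNorm (Ideal.span {q}) = 1 := hqk.trans (pow_zero l)
    rw [Ideal.absNorm_eq_one_iff, Ideal.span_singleton_eq_top] at this
    exact absurd this hq.not_isUnit
  · exact Or.inl (by simpa using hqk)
  · right
    rw [hqk] at h2
    have h3 : Nat.card (𝓞 K ⧸ Ideal.span {s}) = 1 := by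
      have : 0 < l ^ 2 := pow_pos hl.pos 2
      exact Nat.eq_of_mul_eq_mul_left this (by rw [h2, mul_one])
    have h4 : IsUnit s := by
      rw [← Ideal.span_singleton_eq_top]
      exact Ideal.absNorm_eq_one_iff.mp h3
    rw [hs]
    exact associated_mul_unit_right q s h4

lemma isPrime_span {q : 𝓞 K} (hq : Prime q) : (Ideal.span {q}).IsPrime :=
  (Ideal.span_singleton_prime hq.ne_zero).mpr hq

lemma associated_of_prime_dvd {p q : 𝓞 K} (hp : Prime p) (hq : Prime q) (h : p ∣ q) :
    Associated p q :=
  (hp.dvd_prime_iff_associated hq).mp h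

lemma isPrimitiveRoot_omegaO : IsPrimitiveRoot ωO 3 :=
  isPrimitiveRoot_omegaK.toInteger_isPrimitiveRoot

lemma isPrimitiveRoot_neg_one : IsPrimitiveRoot (-1 : 𝓞 K) 2 :=
  IsPrimitiveRoot.neg_one 0 (by norm_num)

lemma one_sub_omegaO_dvd_three : 1 - ωO ∣ 3 :=
  ⟨1 - ωO ^ 2, by linear_combination (2 - ωO) * omegaO_sq⟩

end Primes

end EisensteinTwists

/-! ### The lattice `ℤ[ω]` and a constant product of `℘`-values -/

namespace EisensteinTwists

open Filter Topology

/-- The pair of periods `1, ω`, whose lattice is `ℤ[ω]`. -/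
noncomputable def hexPair : PeriodPair where
  ω₁ := 1
  ω₂ := ω
  indep := by
    rw [LinearIndependent.pair_iff]
    intro s t h
    have h2 := congrArg Complex.im h
    have h3 := congrArg Complex.re h
    have ht : t = 0 := by simpa [omega_im] using h2
    subst ht
    exact ⟨by simpa using h3, rfl⟩

lemma mem_hexPair_lattice {z : ℂ} : z ∈ hexPair.lattice ↔ ∃ x : 𝓞 K, emb x = z := by
  rw [PeriodPair.mem_lattice]
  constructor
  · rintro ⟨a, b, h⟩
    refine ⟨a + b * ωO, ?_⟩
    rw [map_add, map_mul, map_intCast, map_intCast, emb_omegaO, ← h]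
    simp [hexPair]
  · rintro ⟨x, rfl⟩
    obtain ⟨a, b, rfl⟩ := exists_eq_add_mul_omegaO x
    exact ⟨a, b, by simp [hexPair]⟩

lemma emb_mem (x : 𝓞 K) : emb x ∈ hexPair.lattice := mem_hexPair_lattice.mpr ⟨x, rfl⟩

lemma emb_mul_mem (x : 𝓞 K) {z : ℂ} (hz : z ∈ hexPair.lattice) : emb x * z ∈ hexPair.lattice := by
  obtain ⟨y, rfl⟩ := mem_hexPair_lattice.mp hz
  rw [← map_mul]
  exact emb_mem _

lemma omega_mul_mem_hex : ∀ w ∈ hexPair.lattice, ω * w ∈ hexPair.lattice := fun _ hw =>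
  emb_mul_mem ωO hw

lemma dvd_of_div_three_mem {a b : ℤ} (h : ((a : ℂ) + b * ω) / 3 ∈ hexPair.lattice) :
    3 ∣ a ∧ 3 ∣ b := by
  obtain ⟨x, hx⟩ := mem_hexPair_lattice.mp h
  obtain ⟨c, d, rfl⟩ := exists_eq_add_mul_omegaO x
  have h1 : ((a - 3 * c : ℤ) : 𝓞 K) + (b - 3 * d : ℤ) * ωO = 0 := by
    apply emb_injective
    simp only [map_add, map_mul, map_intCast, emb_omegaO, map_zero] at hx ⊢
    push_cast
    linear_combination -3 * hx
  obtain ⟨h2, h3⟩ := add_mul_omegaO_eq_zero h1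
  exact ⟨⟨c, by linarith⟩, ⟨d, by linarith⟩⟩

/-- A zero of `℘` for the lattice `ℤ[ω]`. -/
noncomputable def rho : ℂ := (ω - 1) / 3

lemma rho_eq : rho = (((-1 : ℤ) : ℂ) + (1 : ℤ) * ω) / 3 := by rw [rho]; push_cast; ring

lemma three_mul_rho_mem : 3 * rho ∈ hexPair.lattice :=
  mem_hexPair_lattice.mpr ⟨ωO - 1, by simp [rho]; ring⟩

lemma rho_notMem : rho ∉ hexPair.lattice := fun h => by
  rw [rho_eq] at h
  exact absurd (dvd_of_div_three_mem h).2 (by norm_num)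

lemma two_mul_rho_notMem : 2 * rho ∉ hexPair.lattice := fun h =>
  rho_notMem (by
    have := sub_mem three_mul_rho_mem h
    rwa [show 3 * rho - 2 * rho = rho by ring] at this)

lemma weierstrassP_rho : hexPair.weierstrassP rho = 0 := by
  have := weierstrassP_omega_sub_one_mul omega_mul_mem_hex (t := 1 / 3)
    (by simpa using emb_mem 1)
  rwa [show (ω - 1) * (1 / 3) = rho by rw [rho]; ring] at this

lemma weierstrassP_congr {L : PeriodPair} {z w : ℂ} (h : z - w ∈ L.lattice) :
    L.weierstrassP z = L.weierstrassP w := by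
  have := L.weierstrassP_add_coe w ⟨_, h⟩
  simpa using this

lemma weierstrassP_eq_zero_of {z : ℂ}
    (h : z - rho ∈ hexPair.lattice ∨ z + rho ∈ hexPair.lattice) :
    hexPair.weierstrassP z = 0 := by
  rcases h with h | h
  · rw [weierstrassP_congr h, weierstrassP_rho]
  · rw [weierstrassP_congr (w := -rho) (by simpa using h), PeriodPair.weierstrassP_neg,
      weierstrassP_rho]

lemma weierstrassP_hex_ne_zero {z : ℂ} (h0 : z ∉ hexPair.lattice) (h1 : z - rho ∉ hexPair.lattice)
    (h2 : z + rho ∉ hexPair.lattice) : hexPair.weierstrassP z ≠ 0 := by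
  have := hexPair.weierstrassP_ne two_mul_rho_notMem h0 h2 h1
  rwa [weierstrassP_rho, sub_zero] at this

lemma meromorphicOrderAt_hex_nonneg {z : ℂ} (hz : z ∉ hexPair.lattice) :
    0 ≤ meromorphicOrderAt hexPair.weierstrassP z :=
  (hexPair.analyticOnNhd_weierstrassP z hz).meromorphicOrderAt_nonneg

lemma meromorphicOrderAt_hex_of_zero {z : ℂ}
    (h : z - rho ∈ hexPair.lattice ∨ z + rho ∈ hexPair.lattice) :
    meromorphicOrderAt hexPair.weierstrassP z = (1 : ℤ) := by
  have hz2 : 2 * z ∉ hexPair.lattice := fun hz => by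
    rcases h with h | h
    · apply two_mul_rho_notMem
      have := sub_mem hz (add_mem h h)
      rwa [show 2 * z - (z - rho + (z - rho)) = 2 * rho by ring] at this
    · apply two_mul_rho_notMem
      have := sub_mem (add_mem h h) hz
      rwa [show z + rho + (z + rho) - 2 * z = 2 * rho by ring] at this
  have hz : z ∉ hexPair.lattice := fun hz => hz2 (by rw [two_mul]; exact add_mem hz hz)
  have ha := hexPair.analyticOnNhd_weierstrassP z hz
  have h0 := weierstrassP_eq_zero_of h
  have hd : deriv hexPair.weierstrassP z ≠ 0 := by
    rw [PeriodPair.deriv_weierstrassP]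
    exact hexPair.derivWeierstrassP_ne_zero hz2
  have h1 := ha.analyticOrderAt_sub_eq_one_of_deriv_ne_zero hd
  simp only [h0, sub_zero] at h1
  rw [ha.meromorphicOrderAt_eq, h1]
  rfl

lemma meromorphicOrderAt_hex_eq_zero {z : ℂ} (h0 : z ∉ hexPair.lattice)
    (h1 : z - rho ∉ hexPair.lattice) (h2 : z + rho ∉ hexPair.lattice) :
    meromorphicOrderAt hexPair.weierstrassP z = 0 := by
  have ha := hexPair.analyticOnNhd_weierstrassP z h0
  rw [ha.meromorphicOrderAt_eq, ha.analyticOrderAt_eq_zero.mpr (weierstrassP_hex_ne_zero h0 h1 h2)]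
  rfl

/-- `℘(z) ℘(z + ρ) ℘(z - ρ)` is constant: its zeros and poles cancel. -/
lemma exists_weierstrassP_mul_eq : ∃ κ : ℂ, ∀ z, z ∉ hexPair.lattice → z - rho ∉ hexPair.lattice →
    z + rho ∉ hexPair.lattice →
    hexPair.weierstrassP z * hexPair.weierstrassP (z + rho) * hexPair.weierstrassP (z - rho) =
      κ := by
  set f : ℂ → ℂ := fun z =>
    hexPair.weierstrassP z * hexPair.weierstrassP (z + rho) * hexPair.weierstrassP (z + -rho)
    with hf
  have hm0 := hexPair.meromorphic_weierstrassP
  have hm1 := PeriodPair.meromorphic_comp_add hm0 rho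
  have hm2 := PeriodPair.meromorphic_comp_add hm0 (-rho)
  have hm : Meromorphic f := fun z => ((hm0 z).mul (hm1 z)).mul (hm2 z)
  have hord : ∀ z, meromorphicOrderAt f z = meromorphicOrderAt hexPair.weierstrassP z +
      meromorphicOrderAt hexPair.weierstrassP (z + rho) +
      meromorphicOrderAt hexPair.weierstrassP (z + -rho) := fun z => by
    have e := meromorphicOrderAt_mul ((hm0 z).mul (hm1 z)) (hm2 z)
    rw [meromorphicOrderAt_mul (hm0 z) (hm1 z)] at e
    refine e.trans (congrArg₂ _ (congrArg₂ _ rfl ?_) ?_)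
    · exact meromorphicOrderAt_comp_add_const_eq_meromorphicOrderAt (f := hexPair.weierstrassP)
    · exact meromorphicOrderAt_comp_add_const_eq_meromorphicOrderAt (f := hexPair.weierstrassP)
  have h3 := three_mul_rho_mem
  obtain ⟨κ, hκ⟩ := hexPair.exists_forall_eq_of_meromorphicOrderAt_nonneg hm (fun z w hw => by
      refine Eventually.of_forall fun x => ?_
      simp only [hf]
      rw [weierstrassP_congr (z := x + w) (w := x) (by simpa using hw),
        weierstrassP_congr (z := x + w + rho) (w := x + rho) (by convert hw using 1; ring),
        weierstrassP_congr (z := x + w + -rho) (w := x + -rho) (by convert hw using 1; ring)])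
    (fun z => by
      rw [hord]
      by_cases h0 : z ∈ hexPair.lattice
      · rw [hexPair.order_weierstrassP z h0,
          meromorphicOrderAt_hex_of_zero (z := z + rho) (Or.inl (by simpa using h0)),
          meromorphicOrderAt_hex_of_zero (z := z + -rho) (Or.inr (by simpa using h0))]
        exact le_rfl
      by_cases h1 : z - rho ∈ hexPair.lattice
      · rw [hexPair.order_weierstrassP (z + -rho) h1,
          meromorphicOrderAt_hex_of_zero (z := z) (Or.inl h1),
          meromorphicOrderAt_hex_of_zero (z := z + rho) (Or.inr (by
            convert add_mem h1 h3 using 1; ring))]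
        exact le_rfl
      by_cases h2 : z + rho ∈ hexPair.lattice
      · rw [hexPair.order_weierstrassP (z + rho) h2,
          meromorphicOrderAt_hex_of_zero (z := z) (Or.inr h2),
          meromorphicOrderAt_hex_of_zero (z := z + -rho) (Or.inl (by
            convert sub_mem h2 h3 using 1; ring))]
        exact le_rfl
      exact add_nonneg (add_nonneg (meromorphicOrderAt_hex_nonneg h0)
        (meromorphicOrderAt_hex_nonneg h2)) (meromorphicOrderAt_hex_nonneg h1))
  refine ⟨κ, fun z h0 h1 h2 => tendsto_nhds_unique ?_ (hκ z)⟩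
  have hc : ContinuousAt f z := by
    have c0 := (hexPair.analyticOnNhd_weierstrassP z h0).continuousAt
    have c1 := (hexPair.analyticOnNhd_weierstrassP (z + rho) h2).continuousAt
    have c2 := (hexPair.analyticOnNhd_weierstrassP (z + -rho) h1).continuousAt
    refine (c0.mul ?_).mul ?_
    · exact ContinuousAt.comp (f := fun z => z + rho) c1 (by fun_prop)
    · exact ContinuousAt.comp (f := fun z => z + -rho) c2 (by fun_prop)
  have := hc.tendsto.mono_left (nhdsWithin_le_nhds (s := {z}ᶜ))
  simpa only [hf, ← sub_eq_add_neg] using this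

/-- The product `℘(z + w) ℘(z + ω w) ℘(z + ω² w)`. -/
noncomputable def tripleP (z w : ℂ) : ℂ :=
  hexPair.weierstrassP (z + w) * hexPair.weierstrassP (z + ω * w) *
    hexPair.weierstrassP (z + ω ^ 2 * w)

/-- The symmetry behind cubic reciprocity: the factors `ω` in `℘(ω z) = ω ℘(z)` cancel. -/
lemma tripleP_comm (z w : ℂ) : tripleP z w = tripleP w z := by
  have h (x : ℂ) := weierstrassP_omega_mul hexPair omega_mul_mem_hex x
  have e1 : z + ω * w = ω * (w + ω ^ 2 * z) := by
    linear_combination -z * omega_pow_three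
  have e2 : z + ω ^ 2 * w = ω * (ω * (w + ω * z)) := by
    linear_combination -z * omega_pow_three
  rw [tripleP, tripleP, e1, e2, h, h, h, add_comm z w]
  linear_combination (hexPair.weierstrassP (w + z) * hexPair.weierstrassP (w + ω ^ 2 * z) *
    hexPair.weierstrassP (w + ω * z)) * omega_pow_three

lemma third_notMem : (1 / 3 : ℂ) ∉ hexPair.lattice := fun h => by
  rw [show (1 / 3 : ℂ) = (((1 : ℤ) : ℂ) + (0 : ℤ) * ω) / 3 by push_cast; ring] at h
  exact absurd (dvd_of_div_three_mem h).1 (by norm_num)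

lemma third_sub_rho_notMem : (1 / 3 : ℂ) - rho ∉ hexPair.lattice := fun h => by
  rw [show (1 / 3 : ℂ) - rho = (((2 : ℤ) : ℂ) + (-1 : ℤ) * ω) / 3 by
    rw [rho]; push_cast; ring] at h
  exact absurd (dvd_of_div_three_mem h).1 (by norm_num)

lemma third_add_rho_notMem : (1 / 3 : ℂ) + rho ∉ hexPair.lattice := fun h => by
  rw [show (1 / 3 : ℂ) + rho = (((0 : ℤ) : ℂ) + (1 : ℤ) * ω) / 3 by
    rw [rho]; push_cast; ring] at h
  exact absurd (dvd_of_div_three_mem h).2 (by norm_num)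

/-- `tripleP z (1 / 3)` does not depend on `z`. -/
lemma exists_tripleP_third : ∃ κ : ℂ, κ ≠ 0 ∧ ∀ z, z + 1 / 3 ∉ hexPair.lattice →
    z + 1 / 3 - rho ∉ hexPair.lattice → z + 1 / 3 + rho ∉ hexPair.lattice →
    tripleP z (1 / 3) = κ := by
  obtain ⟨κ, hκ⟩ := exists_weierstrassP_mul_eq
  refine ⟨κ, ?_, fun z h0 h1 h2 => ?_⟩
  · have h3 := three_mul_rho_mem
    rw [← hκ _ third_notMem third_sub_rho_notMem third_add_rho_notMem]
    refine mul_ne_zero (mul_ne_zero ?_ ?_) ?_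
    · exact weierstrassP_hex_ne_zero third_notMem third_sub_rho_notMem third_add_rho_notMem
    · refine weierstrassP_hex_ne_zero third_add_rho_notMem (by simpa using third_notMem)
        fun h => third_sub_rho_notMem ?_
      convert sub_mem h h3 using 1; ring
    · refine weierstrassP_hex_ne_zero third_sub_rho_notMem
        (fun h => third_add_rho_notMem ?_) (by simpa using third_notMem)
      convert add_mem h h3 using 1; ring
  · rw [← hκ _ h0 h1 h2, tripleP]
    have e1 : z + ω * (1 / 3) = z + 1 / 3 + rho := by rw [rho]; ring
    have e2 : hexPair.weierstrassP (z + ω ^ 2 * (1 / 3)) =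
        hexPair.weierstrassP (z + 1 / 3 - rho) := by
      apply weierstrassP_congr
      have : z + ω ^ 2 * (1 / 3) - (z + 1 / 3 - rho) = emb (-1) := by
        rw [rho, map_neg, map_one]; linear_combination (1 / 3 : ℂ) * omega_sq
      rw [this]
      exact emb_mem _
    rw [e1, e2]

end EisensteinTwists

/-! ### Gauss's lemma for a subgroup of order three -/

namespace EisensteinTwists

open Filter Topology

section Group

open Subgroup

variable {G : Type*} [CommGroup G] {ζ : G}

lemma card_quotient_zpowers (hζ : orderOf ζ = 3) :
    Nat.card (G ⧸ zpowers ζ) = Nat.card G / 3 := by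
  rw [card_eq_card_quotient_mul_card_subgroup (zpowers ζ), Nat.card_zpowers, hζ]
  omega

variable [Fintype G]

lemma exists_eq_pow_mul_out (hζ : orderOf ζ = 3) (u : G) :
    ∃ k : Fin 3, u = ζ ^ (k : ℕ) * (u : G ⧸ zpowers ζ).out := by
  have h : (((u : G ⧸ zpowers ζ).out : G) : G ⧸ zpowers ζ) = u := Quotient.out_eq _
  have h1 : (u : G ⧸ zpowers ζ).out⁻¹ * u ∈ zpowers ζ := QuotientGroup.eq.mp h
  classical
  rw [mem_zpowers_iff_mem_range_orderOf, hζ] at h1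
  obtain ⟨k, hk, hku⟩ := Finset.mem_image.mp h1
  refine ⟨⟨k, Finset.mem_range.mp hk⟩, ?_⟩
  simp only at hku ⊢
  rw [hku]
  exact (inv_mul_cancel_comm _ _).symm

open Classical in
lemma prod_eq_prod_quotient {M : Type*} [CommMonoid M] (hζ : orderOf ζ = 3) (f : G → M) :
    ∏ u, f u = ∏ q : G ⧸ zpowers ζ, f q.out * f (ζ * q.out) * f (ζ ^ 2 * q.out) := by
  have hbij : Function.Bijective fun p : (G ⧸ zpowers ζ) × Fin 3 => ζ ^ (p.2 : ℕ) * p.1.out := by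
    constructor
    · rintro ⟨q, i⟩ ⟨r, j⟩ h
      simp only at h
      have hq : q = r := by
        have h1 := congrArg (QuotientGroup.mk : G → G ⧸ zpowers ζ) h
        have h2 (i : ℕ) : ((ζ ^ i : G) : G ⧸ zpowers ζ) = 1 :=
          (QuotientGroup.eq_one_iff _).mpr (pow_mem (mem_zpowers ζ) i)
        rw [QuotientGroup.mk_mul, QuotientGroup.mk_mul, h2, h2, one_mul, one_mul] at h1
        simpa using h1
      subst hq
      have h3 := pow_injOn_Iio_orderOf (x := ζ) (by simp [hζ]) (by simp [hζ])
        (mul_right_cancel h)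
      simp only [Prod.mk.injEq, true_and]
      exact Fin.ext h3
    · intro u
      obtain ⟨k, hk⟩ := exists_eq_pow_mul_out hζ u
      exact ⟨(u, k), hk.symm⟩
  rw [← hbij.prod_comp, Fintype.prod_prod_type]
  refine Finset.prod_congr rfl fun q _ => ?_
  rw [Fin.prod_univ_three]
  simp

open Classical in
/-- Gauss's lemma: translating representatives of the cosets of `⟨ζ⟩` by `b` changes the product of
an equivariant function by the root of unity corresponding to `b ^ [G : ⟨ζ⟩]`. -/
lemma exists_pow_eq_and_prod_eq {z : ℂ} (hζ : orderOf ζ = 3) (b : G) {ψ : G → ℂ}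
    (hψ : ∀ u, ψ (ζ * u) = z * ψ u) :
    ∃ k : ℕ, b ^ (Nat.card G / 3) = ζ ^ k ∧
      ∏ q : G ⧸ zpowers ζ, ψ (b * q.out) = z ^ k * ∏ q : G ⧸ zpowers ζ, ψ q.out := by
  have hψ' (k : ℕ) (u : G) : ψ (ζ ^ k * u) = z ^ k * ψ u := by
    induction k with
    | zero => simp
    | succ k ih => rw [pow_succ', mul_assoc, hψ, ih, pow_succ', mul_assoc]
  choose k hk using fun q : G ⧸ zpowers ζ => exists_eq_pow_mul_out hζ (b * q.out)
  have hmk (q : G ⧸ zpowers ζ) : ((b * q.out : G) : G ⧸ zpowers ζ) = (b : G ⧸ zpowers ζ) * q := by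
    rw [QuotientGroup.mk_mul]; simp
  simp only [hmk] at hk
  refine ⟨∑ q, (k q : ℕ), ?_, ?_⟩
  · have h1 : ∏ q : G ⧸ zpowers ζ, (b * q.out) = ζ ^ (∑ q, (k q : ℕ)) *
        ∏ q : G ⧸ zpowers ζ, q.out := by
      rw [Finset.prod_congr rfl fun q _ => hk q, Finset.prod_mul_distrib,
        Finset.prod_pow_eq_pow_sum]
      congr 1
      exact Equiv.prod_comp (Equiv.mulLeft (b : G ⧸ zpowers ζ)) fun q => (q.out : G)
    rw [Finset.prod_mul_distrib, Finset.prod_const, Finset.card_univ,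
      ← Nat.card_eq_fintype_card, card_quotient_zpowers hζ] at h1
    exact mul_right_cancel h1
  · rw [Finset.prod_congr rfl fun q _ => (congrArg ψ (hk q)).trans (hψ' _ _),
      Finset.prod_mul_distrib, Finset.prod_pow_eq_pow_sum]
    congr 1
    exact Equiv.prod_comp (Equiv.mulLeft (b : G ⧸ zpowers ζ)) fun q => ψ q.out

end Group

/-! ### The multiplication formula for `℘` and cubic reciprocity -/

section Multiplication

/-- The representative of a residue class modulo `β`, as a complex number. -/
noncomputable def rep {β : 𝓞 K} (r : 𝓞 K ⧸ Ideal.span {β}) : ℂ := emb (Quotient.out r)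

variable {β : 𝓞 K}

lemma rep_mk_sub (x : 𝓞 K) :
    ∃ y, rep (Ideal.Quotient.mk (Ideal.span {β}) x) = emb x + emb β * emb y := by
  have h : Ideal.Quotient.mk (Ideal.span {β}) (Quotient.out (Ideal.Quotient.mk (Ideal.span {β}) x))
      = Ideal.Quotient.mk (Ideal.span {β}) x := Ideal.Quotient.mk_out _
  rw [Ideal.Quotient.eq, Ideal.mem_span_singleton] at h
  obtain ⟨y, hy⟩ := h
  refine ⟨y, ?_⟩
  rw [rep, ← map_mul, ← hy]
  simp

lemma exists_rep_eq (r : 𝓞 K ⧸ Ideal.span {β}) :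
    ∃ x : 𝓞 K, rep r = emb x ∧ Ideal.Quotient.mk (Ideal.span {β}) x = r :=
  ⟨Quotient.out r, rfl, Ideal.Quotient.mk_out r⟩

/-- Division by `β` detects membership in the ideal `(β)`. -/
lemma emb_div_mem_iff (hβ : β ≠ 0) {x : 𝓞 K} :
    emb x / emb β ∈ hexPair.lattice ↔ x ∈ Ideal.span {β} := by
  rw [mem_hexPair_lattice, Ideal.mem_span_singleton]
  have h0 := emb_ne_zero hβ
  constructor
  · rintro ⟨y, hy⟩
    refine ⟨y, emb_injective ?_⟩
    rw [map_mul, hy, mul_div_cancel₀ _ h0]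
  · rintro ⟨y, rfl⟩
    exact ⟨y, by rw [map_mul, mul_div_cancel_left₀ _ h0]⟩

lemma notMem_of_mul_notMem (hβ : β ≠ 0) {y : ℂ} (hy : y ∉ hexPair.lattice)
    (r : 𝓞 K ⧸ Ideal.span {β}) : (y + rep r) / emb β ∉ hexPair.lattice := fun h => by
  have h0 := emb_ne_zero hβ
  have h1 := sub_mem (emb_mul_mem β h) (emb_mem (Quotient.out r))
  rw [mul_div_cancel₀ _ h0] at h1
  exact hy (by simpa [rep] using h1)

lemma sub_one_mul_rho_mem (hβ3 : 3 ∣ β - 1) : emb β * rho - rho ∈ hexPair.lattice := by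
  obtain ⟨x, hx⟩ := hβ3
  have : emb β - 1 = 3 * emb x := by
    rw [← map_one emb, ← map_sub, hx, map_mul, map_ofNat]
  have e : emb β * rho - rho = emb x * (3 * rho) := by linear_combination rho * this
  rw [e]
  exact emb_mul_mem x three_mul_rho_mem

variable [Fintype (𝓞 K ⧸ Ideal.span {β})]

/-- The product of `℘((y + r) / β)` over the residue classes `r` modulo `β` is a multiple of
`℘(y)`. -/
lemma exists_prod_weierstrassP_eq (hβ : β ≠ 0) (hβ3 : 3 ∣ β - 1) :
    ∃ c : ℂ, ∀ y, y ∉ hexPair.lattice →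
      ∏ r : 𝓞 K ⧸ Ideal.span {β}, hexPair.weierstrassP ((y + rep r) / emb β) =
        c * hexPair.weierstrassP y := by
  classical
  have hb := emb_ne_zero hβ
  set g : (𝓞 K ⧸ Ideal.span {β}) → ℂ → ℂ := fun r y =>
    hexPair.weierstrassP ((y + rep r) / emb β) with hg
  set P : ℂ → ℂ := fun y => ∏ r, g r y with hP
  have hga (r : 𝓞 K ⧸ Ideal.span {β}) (y : ℂ) : AnalyticAt ℂ
      (fun y => (y + rep r) / emb β) y := by fun_prop
  have hgm (r : 𝓞 K ⧸ Ideal.span {β}) : Meromorphic (g r) := fun y =>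
    (hexPair.meromorphic_weierstrassP ((y + rep r) / emb β)).comp_analyticAt
      (g := fun y => (y + rep r) / emb β) (hga r y)
  have hgo (r : 𝓞 K ⧸ Ideal.span {β}) (y : ℂ) : meromorphicOrderAt (g r) y =
      meromorphicOrderAt hexPair.weierstrassP ((y + rep r) / emb β) := by
    refine meromorphicOrderAt_comp_of_deriv_ne_zero (f := hexPair.weierstrassP) (hga r y) ?_
    have : HasDerivAt (fun y => (y + rep r) / emb β) (1 / emb β) y :=
      ((hasDerivAt_id y).add_const _).div_const _
    rw [this.deriv]
    exact one_div_ne_zero hb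
  have hPm : Meromorphic P := fun y => by
    have := MeromorphicAt.prod (s := Finset.univ) (fun r _ => hgm r y)
    rwa [show ∏ r, g r = P by funext y; simp [hP]] at this
  have hPo (y : ℂ) : meromorphicOrderAt P y =
      ∑ r : 𝓞 K ⧸ Ideal.span {β},
        meromorphicOrderAt hexPair.weierstrassP ((y + rep r) / emb β) := by
    rw [hP, meromorphicOrderAt_fun_prod fun r _ => hgm r y]
    exact Finset.sum_congr rfl fun r _ => hgo r y
  have hPper (y w : ℂ) (hw : w ∈ hexPair.lattice) : P (y + w) = P y := by
    obtain ⟨x, rfl⟩ := mem_hexPair_lattice.mp hw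
    refine Fintype.prod_equiv (Equiv.addRight (Ideal.Quotient.mk (Ideal.span {β}) x)) _ _
      fun r => ?_
    obtain ⟨s, hs, rfl⟩ := exists_rep_eq r
    simp only [hg, Equiv.coe_addRight, ← map_add]
    obtain ⟨u, hu⟩ := rep_mk_sub (β := β) (s + x)
    apply weierstrassP_congr
    rw [hu, hs, map_add]
    have : (y + emb x + emb s) / emb β - (y + (emb s + emb x + emb β * emb u)) / emb β =
      emb (-u) := by
      rw [map_neg]; field_simp; ring
    rw [this]
    exact emb_mem _
  have hPnonneg (y : ℂ) (hy : y ∉ hexPair.lattice) (r : 𝓞 K ⧸ Ideal.span {β}) :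
      0 ≤ meromorphicOrderAt hexPair.weierstrassP ((y + rep r) / emb β) :=
    meromorphicOrderAt_hex_nonneg (notMem_of_mul_notMem hβ hy r)
  -- the product vanishes at the zeros of `℘`
  have hzero (y t : ℂ) (ht : t = rho ∨ t = -rho) (hyt : y - t ∈ hexPair.lattice) :
      ((1 : ℤ) : WithTop ℤ) ≤ meromorphicOrderAt P y := by
    have hy : y ∉ hexPair.lattice := fun hy => by
      have h1 := sub_mem hy hyt
      rw [sub_sub_cancel] at h1
      rcases ht with rfl | rfl
      · exact rho_notMem h1
      · exact rho_notMem (by simpa using h1)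
    have hbt : emb β * t - t ∈ hexPair.lattice := by
      rcases ht with rfl | rfl
      · exact sub_one_mul_rho_mem hβ3
      · convert neg_mem (sub_one_mul_rho_mem hβ3) using 1; ring
    obtain ⟨w, hw⟩ := mem_hexPair_lattice.mp (sub_mem hbt hyt)
    obtain ⟨u, hu⟩ := rep_mk_sub (β := β) w
    have e : (y + rep (Ideal.Quotient.mk (Ideal.span {β}) w)) / emb β - t = emb u := by
      rw [hu, hw]; field_simp; ring
    have h1 : meromorphicOrderAt hexPair.weierstrassP
        ((y + rep (Ideal.Quotient.mk (Ideal.span {β}) w)) / emb β) = (1 : ℤ) := by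
      refine meromorphicOrderAt_hex_of_zero ?_
      rcases ht with rfl | rfl
      · exact Or.inl (e ▸ emb_mem u)
      · exact Or.inr (by rw [← sub_neg_eq_add]; exact e ▸ emb_mem u)
    rw [hPo, ← h1]
    exact Finset.single_le_sum
      (f := fun r => meromorphicOrderAt hexPair.weierstrassP ((y + rep r) / emb β))
      (fun r _ => hPnonneg y hy r) (Finset.mem_univ _)
  -- at a lattice point exactly one factor has a pole
  have hpole (y : ℂ) (hy : y ∈ hexPair.lattice) :
      ((-2 : ℤ) : WithTop ℤ) ≤ meromorphicOrderAt P y := by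
    obtain ⟨x, rfl⟩ := mem_hexPair_lattice.mp hy
    rw [hPo, ← Finset.add_sum_erase _ _
      (Finset.mem_univ (Ideal.Quotient.mk (Ideal.span {β}) (-x)))]
    have h1 : emb x / emb β + rep (Ideal.Quotient.mk (Ideal.span {β}) (-x)) / emb β ∈
        hexPair.lattice := by
      obtain ⟨u, hu⟩ := rep_mk_sub (β := β) (-x)
      rw [hu, map_neg, show emb x / emb β + (-emb x + emb β * emb u) / emb β = emb u by
        field_simp; ring]
      exact emb_mem u
    rw [add_div, hexPair.order_weierstrassP _ h1]
    refine le_add_of_nonneg_right (Finset.sum_nonneg fun r hr => ?_)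
    refine meromorphicOrderAt_hex_nonneg fun h => Finset.ne_of_mem_erase hr ?_
    obtain ⟨s, hs, rfl⟩ := exists_rep_eq r
    rw [hs, ← map_add, emb_div_mem_iff hβ] at h
    rw [Ideal.Quotient.eq]
    simpa [add_comm] using h
  have hfm : Meromorphic fun y => P y * (hexPair.weierstrassP y)⁻¹ := fun y =>
    (hPm y).mul (hexPair.meromorphic_weierstrassP y).inv
  have hford (y : ℂ) {n : ℤ} (h1 : meromorphicOrderAt hexPair.weierstrassP y = n)
      (h2 : (n : WithTop ℤ) ≤ meromorphicOrderAt P y) :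
      0 ≤ meromorphicOrderAt (fun y => P y * (hexPair.weierstrassP y)⁻¹) y := by
    have h3 := meromorphicOrderAt_mul (hPm y) (hexPair.meromorphic_weierstrassP y).inv
    rw [meromorphicOrderAt_inv, h1] at h3
    refine le_of_le_of_eq ?_ h3.symm
    refine le_trans ?_ (add_le_add_left h2 _)
    rw [← WithTop.LinearOrderedAddCommGroup.coe_neg, ← WithTop.coe_add, add_neg_cancel]
    exact le_rfl
  obtain ⟨c, hc⟩ := hexPair.exists_forall_eq_of_meromorphicOrderAt_nonneg hfm
    (fun z w hw => Eventually.of_forall fun y => by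
      rw [hPper y w hw, weierstrassP_congr (z := y + w) (w := y) (by simpa using hw)])
    (fun y => by
      by_cases h0 : y ∈ hexPair.lattice
      · exact hford y (hexPair.order_weierstrassP y h0) (hpole y h0)
      by_cases h1 : y - rho ∈ hexPair.lattice
      · exact hford y (meromorphicOrderAt_hex_of_zero (Or.inl h1)) (hzero y _ (Or.inl rfl) h1)
      by_cases h2 : y + rho ∈ hexPair.lattice
      · exact hford y (meromorphicOrderAt_hex_of_zero (Or.inr h2))
          (hzero y _ (Or.inr rfl) (by simpa using h2))
      · refine hford y (n := 0) (meromorphicOrderAt_hex_eq_zero h0 h1 h2) ?_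
        rw [hPo]
        exact Finset.sum_nonneg fun r _ => hPnonneg y h0 r)
  refine ⟨c, fun y hy => ?_⟩
  have hcont : ContinuousAt P y := by
    refine tendsto_finsetProd _ fun r _ => ?_
    have c1 := (hexPair.analyticOnNhd_weierstrassP _ (notMem_of_mul_notMem hβ hy r)).continuousAt
    exact ContinuousAt.comp (f := fun y => (y + rep r) / emb β) c1 (hga r y).continuousAt
  have hcont' := (hexPair.analyticOnNhd_weierstrassP y hy).continuousAt
  have h1 := (hc y).mul (hcont'.tendsto.mono_left (nhdsWithin_le_nhds (s := {y}ᶜ)))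
  refine tendsto_nhds_unique (hcont.tendsto.mono_left (nhdsWithin_le_nhds (s := {y}ᶜ)))
    (h1.congr' ?_)
  have hne : ∀ᶠ x in 𝓝[≠] y, hexPair.weierstrassP x ≠ 0 := by
    filter_upwards [hexPair.eventually_notMem_lattice y,
      hexPair.eventually_add_notMem_lattice y (-rho),
      hexPair.eventually_add_notMem_lattice y rho] with x h0 h1 h2
    exact weierstrassP_hex_ne_zero h0 (by rwa [sub_eq_add_neg]) h2
  filter_upwards [hne] with x hx
  rw [mul_assoc, inv_mul_cancel₀ hx, mul_one]

end Multiplication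

open Classical in
lemma prod_eq_zero_mul_prod_units {F M : Type*} [Field F] [Fintype F] [CommMonoid M] (f : F → M) :
    ∏ r, f r = f 0 * ∏ u : Fˣ, f u := by
  rw [← Finset.mul_prod_erase Finset.univ f (Finset.mem_univ 0)]
  congr 1
  rw [Finset.prod_subtype (p := fun x => x ≠ 0) _ (by simp)]
  exact (Fintype.prod_equiv unitsEquivNeZero _ _ fun u => rfl).symm

section Reciprocity

/-- The image of `ω` in the unit group modulo `β`. -/
noncomputable def omegaUnit (β : 𝓞 K) : (𝓞 K ⧸ Ideal.span {β})ˣ :=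
  Units.map (Ideal.Quotient.mk (Ideal.span {β})).toMonoidHom isUnit_omegaO.unit

lemma omegaUnit_coe (β : 𝓞 K) :
    (omegaUnit β : 𝓞 K ⧸ Ideal.span {β}) = Ideal.Quotient.mk _ ωO := rfl

variable {β : 𝓞 K}

lemma three_notMem_span (hβ : Prime β) (hβ3 : 3 ∣ β - 1) : (3 : 𝓞 K) ∉ Ideal.span {β} := by
  rw [Ideal.mem_span_singleton]
  intro h
  refine hβ.not_isUnit (isUnit_of_dvd_one ?_)
  have := dvd_sub (dvd_refl β) (h.trans hβ3)
  rwa [sub_sub_cancel] at this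

lemma orderOf_omegaUnit (hβ : Prime β) (hβ3 : 3 ∣ β - 1) : orderOf (omegaUnit β) = 3 := by
  have h := isPrimitiveRoot_mk Nat.prime_three isPrimitiveRoot_omegaO (isPrime_span hβ)
    (span_ne_bot hβ.ne_zero) (by exact_mod_cast three_notMem_span hβ hβ3)
  rw [← omegaUnit_coe, IsPrimitiveRoot.coe_units_iff] at h
  exact h.eq_orderOf.symm

/-- `rep (ω u) / β` and `ω rep u / β` differ by a lattice point. -/
lemma rep_omegaUnit_pow_mul (hβ : β ≠ 0) (k : ℕ) (r : 𝓞 K ⧸ Ideal.span {β}) :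
    ∃ y, rep ((omegaUnit β : 𝓞 K ⧸ Ideal.span {β}) ^ k * r) / emb β =
      ω ^ k * (rep r / emb β) + emb y := by
  obtain ⟨x, hx, rfl⟩ := exists_rep_eq r
  rw [omegaUnit_coe, ← map_pow, ← map_mul]
  obtain ⟨y, hy⟩ := rep_mk_sub (β := β) (ωO ^ k * x)
  refine ⟨y, ?_⟩
  have := emb_ne_zero hβ
  rw [hy, hx, map_mul, map_pow, emb_omegaO]
  field_simp

open Classical in
lemma prod_weierstrassP_eq_prod_tripleP [Fintype (𝓞 K ⧸ Ideal.span {β})] (hβ : Prime β)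
    (hβ3 : 3 ∣ β - 1) (y : ℂ) :
    ∏ r : 𝓞 K ⧸ Ideal.span {β}, hexPair.weierstrassP ((y + rep r) / emb β) =
      hexPair.weierstrassP (y / emb β) *
        ∏ q : (𝓞 K ⧸ Ideal.span {β})ˣ ⧸ Subgroup.zpowers (omegaUnit β),
          tripleP (y / emb β) (rep (q.out : 𝓞 K ⧸ Ideal.span {β}) / emb β) := by
  have hmax := (isPrime_span hβ).isMaximal (span_ne_bot hβ.ne_zero)
  let := Ideal.Quotient.field (Ideal.span {β})
  have h1 := prod_eq_zero_mul_prod_units fun r : 𝓞 K ⧸ Ideal.span {β} =>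
    hexPair.weierstrassP ((y + rep r) / emb β)
  have h2 := prod_eq_prod_quotient (orderOf_omegaUnit hβ hβ3)
    fun u : (𝓞 K ⧸ Ideal.span {β})ˣ => hexPair.weierstrassP
      ((y + rep (u : 𝓞 K ⧸ Ideal.span {β})) / emb β)
  rw [h1]
  congr 1
  · apply weierstrassP_congr
    obtain ⟨z, hz⟩ := rep_mk_sub (β := β) 0
    have hb := emb_ne_zero hβ.ne_zero
    rw [map_zero] at hz
    rw [hz, map_zero, show (y + (0 + emb β * emb z)) / emb β - y / emb β = emb z by
      field_simp; ring]
    exact emb_mem z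
  · refine Eq.trans ?_ (h2.trans ?_)
    · exact Finset.prod_congr (by ext; simp) fun _ _ => rfl
    · refine Finset.prod_congr rfl fun q _ => ?_
      rw [tripleP]
      obtain ⟨u, hu⟩ := rep_omegaUnit_pow_mul hβ.ne_zero 1 (q.out : 𝓞 K ⧸ Ideal.span {β})
      obtain ⟨v, hv⟩ := rep_omegaUnit_pow_mul hβ.ne_zero 2 (q.out : 𝓞 K ⧸ Ideal.span {β})
      rw [pow_one, pow_one] at hu
      simp only [add_div, Units.val_mul, Units.val_pow_eq_pow_val, hu, hv]
      congr 1
      · congr 1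
        apply weierstrassP_congr
        convert emb_mem u using 1
        ring
      · apply weierstrassP_congr
        convert emb_mem v using 1
        ring

lemma third_shift_notMem (hβ : β ≠ 0) (hβ3 : 3 ∣ β - 1) {t : ℂ} (ht : (1 / 3 : ℂ) - t ∉
    hexPair.lattice) (ht' : emb β * t - t ∈ hexPair.lattice) (r : 𝓞 K ⧸ Ideal.span {β}) :
    rep r / emb β + 1 / 3 - t ∉ hexPair.lattice := fun h => ht (by
  obtain ⟨x, hx⟩ := hβ3
  have h0 := emb_ne_zero hβ
  have h1 : emb β - 1 = 3 * emb x := by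
    rw [← map_one emb, ← map_sub, hx, map_mul, map_ofNat]
  have h2 := emb_mul_mem β h
  have h3 : (1 / 3 : ℂ) - t = emb β * (rep r / emb β + 1 / 3 - t) + (emb β * t - t)
      - emb (Quotient.out r) - emb x := by
    rw [show emb (Quotient.out r) = rep r from rfl]
    field_simp
    linear_combination -h1
  rw [h3]
  exact sub_mem (sub_mem (add_mem h2 ht') (emb_mem _)) (emb_mem _))

open Classical in
/-- The multiplication formula for `℘`, with a constant that is a power of one number `κ`. -/
lemma exists_multiplication_formula : ∃ κ : ℂ, κ ≠ 0 ∧ ∀ (β : 𝓞 K) [Fintype (𝓞 K ⧸ Ideal.span {β})],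
    Prime β → 3 ∣ β - 1 → ∀ y, y ∉ hexPair.lattice →
      κ ^ (Nat.card (𝓞 K ⧸ Ideal.span {β})ˣ / 3) * hexPair.weierstrassP y =
        hexPair.weierstrassP (y / emb β) *
        ∏ q : (𝓞 K ⧸ Ideal.span {β})ˣ ⧸ Subgroup.zpowers (omegaUnit β),
          tripleP (y / emb β) (rep (q.out : 𝓞 K ⧸ Ideal.span {β}) / emb β) := by
  obtain ⟨κ, hκ0, hκ⟩ := exists_tripleP_third
  refine ⟨κ, hκ0, fun β _ hβ hβ3 y hy => ?_⟩
  obtain ⟨c, hc⟩ := exists_prod_weierstrassP_eq hβ.ne_zero hβ3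
  have h0 := emb_ne_zero hβ.ne_zero
  suffices h : c = κ ^ (Nat.card (𝓞 K ⧸ Ideal.span {β})ˣ / 3) by
    rw [← h, ← hc y hy, prod_weierstrassP_eq_prod_tripleP hβ hβ3]
  obtain ⟨x, hx⟩ := id hβ3
  have h1 : emb β - 1 = 3 * emb x := by
    rw [← map_one emb, ← map_sub, hx, map_mul, map_ofNat]
  -- the formula is evaluated at `β / 3`, which is congruent to `1 / 3`
  have e1 : emb β / 3 - 1 / 3 = emb x := by linear_combination (1 / 3 : ℂ) * h1
  have hy3 : emb β / 3 ∉ hexPair.lattice := fun h => third_notMem (by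
    have := sub_mem h (emb_mem x)
    rwa [← e1, sub_sub_cancel] at this)
  have h2 := hc _ hy3
  have e2 : emb β / 3 / emb β = 1 / 3 := by field_simp
  rw [prod_weierstrassP_eq_prod_tripleP hβ hβ3, e2,
    weierstrassP_congr (z := emb β / 3) (w := 1 / 3) (e1 ▸ emb_mem x), mul_comm c] at h2
  have h3 := mul_left_cancel₀ (weierstrassP_hex_ne_zero third_notMem third_sub_rho_notMem
    third_add_rho_notMem) h2
  rw [← h3, Finset.prod_congr rfl fun q _ => ?_, Finset.prod_const, Finset.card_univ,
    ← Nat.card_eq_fintype_card, card_quotient_zpowers (orderOf_omegaUnit hβ hβ3)]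
  rw [tripleP_comm]
  have hr := sub_one_mul_rho_mem hβ3
  refine hκ _ ?_ ?_ ?_
  · have := third_shift_notMem hβ.ne_zero hβ3 (t := 0) (by simpa using third_notMem) (by simp)
      (q.out : 𝓞 K ⧸ Ideal.span {β})
    simpa using this
  · exact third_shift_notMem hβ.ne_zero hβ3 third_sub_rho_notMem hr _
  · have := third_shift_notMem hβ.ne_zero hβ3 (t := -rho) (by simpa using third_add_rho_notMem)
      (by convert neg_mem hr using 1; ring) (q.out : 𝓞 K ⧸ Ideal.span {β})
    simpa using this

lemma weierstrassP_rep_div_ne_zero (hβ : Prime β) (hβ3 : 3 ∣ β - 1)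
    (u : (𝓞 K ⧸ Ideal.span {β})ˣ) :
    hexPair.weierstrassP (rep (u : 𝓞 K ⧸ Ideal.span {β}) / emb β) ≠ 0 := by
  have hprime := isPrime_span hβ
  obtain ⟨x, hx, hxu⟩ := exists_rep_eq (u : 𝓞 K ⧸ Ideal.span {β})
  have h0 := emb_ne_zero hβ.ne_zero
  have key : ∀ t, t ∉ hexPair.lattice → emb β * t - t ∈ hexPair.lattice →
      rep (u : 𝓞 K ⧸ Ideal.span {β}) / emb β - t ∉ hexPair.lattice := fun t ht ht' h => ht (by
    have h2 := emb_mul_mem β h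
    rw [hx] at h2
    have h3 := sub_mem (sub_mem (emb_mem x) h2) ht'
    convert h3 using 1
    field_simp
    ring)
  have hr := sub_one_mul_rho_mem hβ3
  refine weierstrassP_hex_ne_zero ?_ (key _ rho_notMem hr) ?_
  · rw [hx, emb_div_mem_iff hβ.ne_zero, ← Ideal.Quotient.eq_zero_iff_mem, hxu]
    exact u.ne_zero
  · have := key (-rho) (by simpa using rho_notMem) (by convert neg_mem hr using 1; ring)
    simpa using this

open Classical in
/-- A double product formula for the cubic residue character, symmetric up to the order of the two
primes. -/
lemma exists_pow_mul_powerChar_eq : ∃ κ : ℂ, κ ≠ 0 ∧ ∀ (β l : 𝓞 K)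
    [Fintype (𝓞 K ⧸ Ideal.span {β})] [Fintype (𝓞 K ⧸ Ideal.span {l})],
    Prime β → 3 ∣ β - 1 → Prime l → 3 ∣ l - 1 → ¬ l ∣ β →
      (κ ^ (Nat.card (𝓞 K ⧸ Ideal.span {β})ˣ / 3)) ^ (Nat.card (𝓞 K ⧸ Ideal.span {l})ˣ / 3) *
        emb (powerChar 3 (Ideal.span {l}) β) =
        ∏ s : (𝓞 K ⧸ Ideal.span {l})ˣ ⧸ Subgroup.zpowers (omegaUnit l),
        ∏ q : (𝓞 K ⧸ Ideal.span {β})ˣ ⧸ Subgroup.zpowers (omegaUnit β),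
          tripleP (rep (s.out : 𝓞 K ⧸ Ideal.span {l}) / emb l)
            (rep (q.out : 𝓞 K ⧸ Ideal.span {β}) / emb β) := by
  obtain ⟨κ, hκ0, hκ⟩ := exists_multiplication_formula
  refine ⟨κ, hκ0, fun β l _ _ hβ hβ3 hl hl3 hlβ => ?_⟩
  have hprime := isPrime_span hl
  have hmax := hprime.isMaximal (span_ne_bot hl.ne_zero)
  let := Ideal.Quotient.field (Ideal.span {l})
  have h0 := emb_ne_zero hl.ne_zero
  have hb0 := emb_ne_zero hβ.ne_zero
  set b : (𝓞 K ⧸ Ideal.span {l})ˣ := Units.mk0 (Ideal.Quotient.mk _ β) (by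
    rwa [Ne, Ideal.Quotient.eq_zero_iff_mem, Ideal.mem_span_singleton]) with hb
  have hψ : ∀ u : (𝓞 K ⧸ Ideal.span {l})ˣ,
      hexPair.weierstrassP (rep ((omegaUnit l * u : (𝓞 K ⧸ Ideal.span {l})ˣ) :
        𝓞 K ⧸ Ideal.span {l}) / emb l) =
      ω * hexPair.weierstrassP (rep (u : 𝓞 K ⧸ Ideal.span {l}) / emb l) := fun u => by
    obtain ⟨v, hv⟩ := rep_omegaUnit_pow_mul hl.ne_zero 1 (u : 𝓞 K ⧸ Ideal.span {l})
    rw [pow_one, pow_one] at hv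
    rw [Units.val_mul, hv, ← weierstrassP_omega_mul hexPair omega_mul_mem_hex]
    exact weierstrassP_congr (by simpa using emb_mem v)
  obtain ⟨k, hk1, hk2⟩ := exists_pow_eq_and_prod_eq (orderOf_omegaUnit hl hl3) b
    (ψ := fun u : (𝓞 K ⧸ Ideal.span {l})ˣ =>
      hexPair.weierstrassP (rep (u : 𝓞 K ⧸ Ideal.span {l}) / emb l)) hψ
  have hchar : powerChar 3 (Ideal.span {l}) β = ωO ^ k := by
    refine powerChar_eq Nat.prime_three isPrimitiveRoot_omegaO hprime (span_ne_bot hl.ne_zero)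
      (by exact_mod_cast three_notMem_span hl hl3)
      (by rw [← pow_mul, mul_comm, pow_mul, omegaO_pow_three, one_pow]) ?_
    rw [← Ideal.Quotient.eq, map_pow, map_pow, ← omegaUnit_coe]
    rw [Nat.card_units] at hk1
    have := congrArg Units.val hk1
    rwa [Units.val_pow_eq_pow_val, Units.val_pow_eq_pow_val] at this
  rw [hchar, map_pow, emb_omegaO]
  have hfac (s : (𝓞 K ⧸ Ideal.span {l})ˣ ⧸ Subgroup.zpowers (omegaUnit l)) :
      κ ^ (Nat.card (𝓞 K ⧸ Ideal.span {β})ˣ / 3) *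
        hexPair.weierstrassP (rep ((b * s.out : (𝓞 K ⧸ Ideal.span {l})ˣ) :
          𝓞 K ⧸ Ideal.span {l}) / emb l) =
      hexPair.weierstrassP (rep (s.out : 𝓞 K ⧸ Ideal.span {l}) / emb l) *
        ∏ q : (𝓞 K ⧸ Ideal.span {β})ˣ ⧸ Subgroup.zpowers (omegaUnit β),
          tripleP (rep (s.out : 𝓞 K ⧸ Ideal.span {l}) / emb l)
            (rep (q.out : 𝓞 K ⧸ Ideal.span {β}) / emb β) := by
    obtain ⟨x, hx, hxs⟩ := exists_rep_eq (s.out : 𝓞 K ⧸ Ideal.span {l})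
    obtain ⟨v, hv⟩ := rep_mk_sub (β := l) (β * x)
    have e1 : ((b * s.out : (𝓞 K ⧸ Ideal.span {l})ˣ) : 𝓞 K ⧸ Ideal.span {l}) =
        Ideal.Quotient.mk _ (β * x) := by
      rw [Units.val_mul, map_mul, hxs]; rfl
    have hy : emb β * (emb x / emb l) ∉ hexPair.lattice := fun h => by
      rw [← mul_div_assoc, ← map_mul, emb_div_mem_iff hl.ne_zero,
        ← Ideal.Quotient.eq_zero_iff_mem, ← e1] at h
      exact (b * s.out).ne_zero h
    have h2 := hκ β hβ hβ3 _ hy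
    rw [mul_div_cancel_left₀ _ hb0] at h2
    rw [e1, hx, ← h2, hv]
    congr 1
    apply weierstrassP_congr
    convert emb_mem v using 1
    rw [map_mul]
    field_simp
    ring
  have hprod := Finset.prod_congr (rfl : (Finset.univ : Finset
    ((𝓞 K ⧸ Ideal.span {l})ˣ ⧸ Subgroup.zpowers (omegaUnit l))) = Finset.univ) fun s _ => hfac s
  rw [Finset.prod_mul_distrib, Finset.prod_mul_distrib, Finset.prod_const, Finset.card_univ,
    ← Nat.card_eq_fintype_card, card_quotient_zpowers (orderOf_omegaUnit hl hl3), hk2] at hprod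
  have hne : ∏ s : (𝓞 K ⧸ Ideal.span {l})ˣ ⧸ Subgroup.zpowers (omegaUnit l),
      hexPair.weierstrassP (rep (s.out : 𝓞 K ⧸ Ideal.span {l}) / emb l) ≠ 0 :=
    Finset.prod_ne_zero_iff.mpr fun s _ => weierstrassP_rep_div_ne_zero hl hl3 _
  apply mul_left_cancel₀ hne
  rw [← hprod]
  ring

/-- Cubic reciprocity for primes congruent to `1` modulo `3`. -/
theorem powerChar_three_reciprocity {β l : 𝓞 K} (hβ : Prime β) (hβ3 : 3 ∣ β - 1) (hl : Prime l)
    (hl3 : 3 ∣ l - 1) (hlβ : ¬ Associated l β) :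
    powerChar 3 (Ideal.span {l}) β = powerChar 3 (Ideal.span {β}) l := by
  classical
  have h1 : ¬ l ∣ β := fun h => hlβ (associated_of_prime_dvd hl hβ h)
  have h2 : ¬ β ∣ l := fun h => hlβ (associated_of_prime_dvd hβ hl h).symm
  have := finite_quotient (span_ne_bot hβ.ne_zero)
  have := finite_quotient (span_ne_bot hl.ne_zero)
  have := Fintype.ofFinite (𝓞 K ⧸ Ideal.span {β})
  have := Fintype.ofFinite (𝓞 K ⧸ Ideal.span {l})
  obtain ⟨κ, hκ0, hκ⟩ := exists_pow_mul_powerChar_eq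
  have e1 := hκ β l hβ hβ3 hl hl3 h1
  have e2 := hκ l β hl hl3 hβ hβ3 h2
  rw [Finset.prod_comm] at e1
  simp only [tripleP_comm (_ / emb l)] at e1
  rw [← e2, pow_right_comm] at e1
  exact emb_injective (mul_left_cancel₀ (pow_ne_zero _ (pow_ne_zero _ hκ0)) e1)

end Reciprocity

lemma not_isUnit_one_sub_omegaO : ¬ IsUnit (1 - ωO) := fun h => by
  have h1 := card_quotient_span 1 (-1)
  have e : ((1 : ℤ) : 𝓞 K) + (-1 : ℤ) * ωO = 1 - ωO := by push_cast; ring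
  rw [e, Ideal.span_singleton_eq_top.mpr h] at h1
  have : Nat.card (𝓞 K ⧸ (⊤ : Ideal (𝓞 K))) = 1 := Nat.card_unique
  rw [this] at h1
  norm_num at h1

lemma not_one_sub_omegaO_dvd {β : 𝓞 K} (hβ3 : 3 ∣ β - 1) : ¬ (1 - ωO) ∣ β := fun h => by
  refine not_isUnit_one_sub_omegaO (isUnit_of_dvd_one ?_)
  have := dvd_sub h (one_sub_omegaO_dvd_three.trans hβ3)
  rwa [sub_sub_cancel] at this

/-- The cubic residue symbol of a primary prime `π` at an ideal with a primary generator `β` is the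
cubic residue character of `β` modulo `π`. -/
theorem residueSymbol_three_eq {π β : 𝓞 K} (hπ : Prime π) (hπ3 : 3 ∣ π - 1) (hβ3 : 3 ∣ β - 1)
    (hπβ : ¬ π ∣ β) :
    residueSymbol 3 π (Ideal.span {β}) = emb (powerChar 3 (Ideal.span {π}) β) := by
  have hprime := isPrime_span hπ
  have hbot := span_ne_bot hπ.ne_zero
  have h3π : ((3 : ℕ) : 𝓞 K) ∉ Ideal.span {π} := by exact_mod_cast three_notMem_span hπ hπ3
  have hmem {x : 𝓞 K} : x ∈ Ideal.span {π} ↔ π ∣ x := Ideal.mem_span_singleton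
  have hmul {x y : 𝓞 K} (hx : ¬ π ∣ x) (hy : ¬ π ∣ y) :=
    powerChar_mul Nat.prime_three isPrimitiveRoot_omegaO hprime hbot h3π (hmem.not.mpr hx)
      (hmem.not.mpr hy)
  have hone : ∀ x : 𝓞 K, IsUnit x → powerChar 3 (Ideal.span {π}) (x ^ 3) = 1 := fun x hx =>
    powerChar_pow Nat.prime_three isPrimitiveRoot_omegaO hprime hbot h3π fun h =>
      hπ.not_isUnit (isUnit_of_dvd_unit (hmem.mp h) hx)
  let G : Submonoid (𝓞 K) :=
    { carrier := {x | 3 ∣ x - 1 ∧ ¬ π ∣ x}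
      one_mem' := ⟨by simp, fun h => hπ.not_isUnit (isUnit_of_dvd_one h)⟩
      mul_mem' := fun {x y} hx hy => ⟨by
        rw [show x * y - 1 = (x - 1) * y + (y - 1) by ring]
        exact dvd_add (hx.1.mul_right y) hy.1, fun h => (hπ.dvd_or_dvd h).elim hx.2 hy.2⟩ }
  have hβ0 : β ≠ 0 := by rintro rfl; exact hπβ (dvd_zero π)
  obtain ⟨γ, ⟨hγ3, hγπ⟩, ⟨u, rfl⟩, h⟩ := exists_associated_residueSymbol_eq 3 π G
    (fun x => emb (powerChar 3 (Ideal.span {π}) x))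
    (by have := hone 1 isUnit_one; rw [one_pow] at this; simp [this])
    (fun x hx y hy => by rw [hmul hx.2 hy.2, map_mul]) hβ0 (fun q hq hqβ => by
      have h1 : ¬ (1 - ωO) ∣ q := fun h => not_one_sub_omegaO_dvd hβ3 (h.trans hqβ)
      obtain ⟨u, hu, hu3⟩ := exists_isUnit_mul_sub_one h1
      have hass : Associated q (u * q) := by
        rw [mul_comm]; exact associated_mul_unit_right q u hu
      have hq' : Prime (u * q) := hass.prime hq
      have hπq : ¬ π ∣ u * q := fun h => hπβ ((hass.dvd_iff_dvd_right.mpr h).trans hqβ)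
      have hqπ : ¬ Associated (u * q) π := fun h => hπq h.symm.dvd
      refine ⟨u * q, ⟨hu3, hπq⟩, hass, ?_⟩
      rw [residueSymbolAt_eq_powerChar Nat.prime_three isPrimitiveRoot_omegaO (isPrime_span hq')
        (span_ne_bot hq'.ne_zero) (by exact_mod_cast three_notMem_span hq' hu3)
        (fun h => hqπ (associated_of_prime_dvd hq' hπ (Ideal.mem_span_singleton.mp h))),
        powerChar_three_reciprocity hπ hπ3 hq' hu3 hqπ])
  rw [h]
  have hu : (3 : 𝓞 K) ∣ (u : 𝓞 K) - (1 : ℤ) := by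
    rw [show (u : 𝓞 K) - (1 : ℤ) = (β * u - 1) - u * (β - 1) by push_cast; ring]
    exact dvd_sub hγ3 (hβ3.mul_left _)
  have hu3 : (u : 𝓞 K) = (u : 𝓞 K) ^ 3 := by
    rcases eq_one_or_neg_one_of_three_dvd u.isUnit hu with h | h <;> rw [h] <;> ring
  rw [hmul hπβ fun h => hπ.not_isUnit (isUnit_of_dvd_unit h u.isUnit), hu3, hone _ u.isUnit,
    mul_one]

end EisensteinTwists

/-! ### Quadratic reciprocity over `ℤ` for the forms `a² - ab + b²` -/

namespace EisensteinTwists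

lemma jacobiSym_natAbs_of_one_mod_four {q : ℕ} (hq : q % 4 = 1) (n : ℤ) :
    jacobiSym n q = jacobiSym n.natAbs q := by
  rcases Int.natAbs_eq n with h | h
  · rw [← h]
  · have hodd : Odd q := Nat.odd_iff.mpr (by omega)
    rw [h, jacobiSym.neg _ hodd, ZMod.χ₄_nat_one_mod_four hq, one_mul, Int.natAbs_neg,
      Int.natAbs_natCast]

lemma jacobiSym_eq_of_one_mod_four {q : ℕ} (hq : q % 4 = 1) {n : ℤ} (hn : Odd n) :
    jacobiSym n q = jacobiSym q n.natAbs := by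
  rw [jacobiSym_natAbs_of_one_mod_four hq,
    ← jacobiSym.quadratic_reciprocity_one_mod_four hq (Int.natAbs_odd.mpr hn)]

/-- The sign of `n ≡ 1` modulo `4` compensates the sign in the reciprocity law for `|n|`. -/
lemma jacobiSym_eq_of_int_one_mod_four {q : ℕ} (hq : Odd q) {n : ℤ} (hn : n % 4 = 1) :
    jacobiSym n q = jacobiSym q n.natAbs := by
  have hq2 := Nat.odd_iff.mp hq
  rcases (by omega : q % 4 = 1 ∨ q % 4 = 3) with h | h
  · exact jacobiSym_eq_of_one_mod_four h (Int.odd_iff.mpr (by omega))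
  rcases Int.natAbs_eq n with hn' | hn'
  · rw [← jacobiSym.quadratic_reciprocity_one_mod_four (a := n.natAbs) (by omega) hq, ← hn']
  · rw [← neg_inj, ← jacobiSym.quadratic_reciprocity_three_mod_four (a := n.natAbs) (by omega) h]
    conv_lhs => rw [hn']
    rw [jacobiSym.neg _ hq, ZMod.χ₄_nat_three_mod_four h]
    ring

lemma jacobiSym_eq_one_of_dvd_sub_sq {x y : ℤ} {q : ℕ} (h : (q : ℤ) ∣ y - x ^ 2)
    (hy : jacobiSym y q ≠ 0) : jacobiSym y q = 1 := by
  have e : jacobiSym y q = jacobiSym x q ^ 2 := by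
    rw [← jacobiSym.pow_left]
    exact (jacobiSym.mod_left' (Int.modEq_iff_dvd.mpr h)).symm
  rw [e] at hy ⊢
  rcases jacobiSym.trichotomy x q with h | h | h <;> rw [h] at hy ⊢ <;> simp at hy ⊢

lemma jacobiSym_natAbs_ne_zero {q : ℕ} (hq : q.Prime) {n : ℤ} (hn : ¬ (q : ℤ) ∣ n) :
    jacobiSym q n.natAbs ≠ 0 := by
  apply jacobiSym.ne_zero
  rw [Int.gcd_natCast_natCast]
  exact (Nat.Prime.coprime_iff_not_dvd hq).mpr (Int.natCast_dvd.not.mp hn)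

section Form

variable {p : ℕ} {a b : ℤ}

lemma mod_four_eq_one (hp : (p : ℤ) = a ^ 2 - a * b + b ^ 2) (ha : 4 ∣ a - 1) (hb : 4 ∣ b) :
    p % 4 = 1 := by
  obtain ⟨k, hk⟩ := ha
  obtain ⟨j, rfl⟩ := hb
  obtain rfl : a = 4 * k + 1 := by linarith
  have : (p : ℤ) = 4 * (4 * k ^ 2 + 2 * k - j * (4 * k + 1) + 4 * j ^ 2) + 1 := by rw [hp]; ring
  omega

lemma mod_eight_eq (hp : (p : ℤ) = a ^ 2 - a * b + b ^ 2) (ha : 4 ∣ a - 1) {j : ℤ}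
    (hb : b = 4 * j) : (p : ℤ) % 8 = (1 - 4 * j) % 8 := by
  obtain ⟨k, hk⟩ := ha
  obtain rfl : a = 4 * k + 1 := by linarith
  have : (p : ℤ) = 8 * (2 * k ^ 2 + k - 2 * j * k + 2 * j ^ 2) + (1 - 4 * j) := by
    rw [hp, hb]; ring
  omega

lemma jacobiSym_two_eq_ite (hp : (p : ℤ) = a ^ 2 - a * b + b ^ 2)
    (ha : 4 ∣ a - 1) {j : ℤ} (hb : b = 4 * j) :
    jacobiSym 2 p = if Even j then 1 else -1 := by
  have h4 := mod_four_eq_one hp ha ⟨j, hb⟩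
  have h8 := mod_eight_eq hp ha hb
  rw [jacobiSym.at_two (Nat.odd_iff.mpr (by omega)), ZMod.χ₈_nat_eq_if_mod_eight]
  by_cases hj : Even j
  · obtain ⟨i, rfl⟩ := hj
    rw [if_neg (by omega), if_pos (by omega), if_pos ⟨i, rfl⟩]
  · rw [if_neg hj]
    rw [Int.not_even_iff] at hj
    rw [if_neg (by omega), if_neg (by omega)]

/-- `b` is a square modulo a prime `p = a² - ab + b²` with `a ≡ 1` and `b ≡ 0` modulo `4`. -/
lemma jacobiSym_coeff_eq_one [hpp : Fact p.Prime] (hp : (p : ℤ) = a ^ 2 - a * b + b ^ 2)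
    (ha : 4 ∣ a - 1) (hb : 4 ∣ b) (hpb : ¬ (p : ℤ) ∣ b) : jacobiSym b p = 1 := by
  have h4 := mod_four_eq_one hp ha hb
  have hb0 : b ≠ 0 := by rintro rfl; exact hpb (dvd_zero _)
  obtain ⟨j, hj⟩ := hb
  have hj0 : j ≠ 0 := by rintro rfl; exact hb0 hj
  obtain ⟨e, n, hn, hen⟩ := Nat.exists_eq_two_pow_mul_odd (Int.natAbs_ne_zero.mpr hj0)
  have hbn : b.natAbs = 2 ^ 2 * (2 ^ e * n) := by
    rw [hj, Int.natAbs_mul, hen]; rfl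
  have hnb : ((n : ℕ) : ℤ) ∣ b := by
    rw [Int.natCast_dvd, hbn]; exact Dvd.intro_left _ (by rw [← mul_assoc])
  have hodd : Odd p := Nat.odd_iff.mpr (by omega)
  have h2 : jacobiSym 2 p ^ 2 = 1 := by
    rw [jacobiSym_two_eq_ite hp ha hj]; split_ifs <;> norm_num
  -- the odd part `n` of `b`: modulo `n`, the prime `p` is the square of `a`
  have hnp : jacobiSym n p = 1 := by
    rw [jacobiSym_eq_of_one_mod_four h4 (n := n) (by exact_mod_cast hn), Int.natAbs_natCast]
    refine jacobiSym_eq_one_of_dvd_sub_sq (x := a) ?_ ?_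
    · rw [hp, show a ^ 2 - a * b + b ^ 2 - a ^ 2 = b * (b - a) by ring]
      exact hnb.mul_right _
    · have := jacobiSym_natAbs_ne_zero hpp.out (n := n) fun h => hpb (h.trans hnb)
      rwa [Int.natAbs_natCast] at this
  -- the even part: `p ≡ 1` modulo `8` unless `b / 4` is odd
  have he : jacobiSym 2 p ^ e = 1 := by
    rw [jacobiSym_two_eq_ite hp ha hj]
    split_ifs with hje
    · exact one_pow e
    · have : e = 0 := by
        by_contra he
        apply hje
        rw [← Int.natAbs_even, hen]
        exact (Nat.even_pow.mpr ⟨even_two, he⟩).mul_right n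
      rw [this, pow_zero]
  rw [jacobiSym_natAbs_of_one_mod_four h4, hbn]
  rw [Nat.cast_mul, Nat.cast_mul, Nat.cast_pow, Nat.cast_pow, Nat.cast_ofNat,
    jacobiSym.mul_left, jacobiSym.mul_left, jacobiSym.pow_left, jacobiSym.pow_left, h2, he, hnp]
  norm_num

/-- The reciprocity law between two primes of norm `p` and `l`, expressed through the coordinates
of the two primes: with `m = ad - bc`, both sides are governed by `p l ≡ x²` modulo `m`. -/
theorem jacobiSym_form_reciprocity [hpp : Fact p.Prime] {l : ℕ} [hll : Fact l.Prime] {c d m : ℤ}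
    (hp : (p : ℤ) = a ^ 2 - a * b + b ^ 2) (hl : (l : ℤ) = c ^ 2 - c * d + d ^ 2)
    (ha : 4 ∣ a - 1) (hb : 4 ∣ b) (hd : Odd d) (hl2 : Odd l) (hm : m = a * d - b * c)
    (hpb : ¬ (p : ℤ) ∣ b) (hld : ¬ (l : ℤ) ∣ d) (hpm : ¬ (p : ℤ) ∣ m) (hlm : ¬ (l : ℤ) ∣ m) :
    jacobiSym (m * d) l = jacobiSym (-m * b) p := by
  have h4 := mod_four_eq_one hp ha hb
  have hodd : Odd p := Nat.odd_iff.mpr (by omega)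
  have hmd : (m * d) % 4 = 1 := by
    obtain ⟨k, hk⟩ := ha
    obtain ⟨j, rfl⟩ := hb
    obtain ⟨i, rfl⟩ := hd
    obtain rfl : a = 4 * k + 1 := by linarith
    have : m * (2 * i + 1) = 4 * (k * (2 * i + 1) ^ 2 + i ^ 2 + i - j * c * (2 * i + 1)) + 1 := by
      rw [hm]; ring
    omega
  have hmodd : Odd m := by
    have : Odd (m * d) := Int.odd_iff.mpr (by omega)
    exact (Int.odd_mul.mp this).1
  have hm0 : m.natAbs ≠ 0 := by
    rw [Int.natAbs_ne_zero]; rintro rfl; exact hpm (dvd_zero _)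
  have hd0 : d.natAbs ≠ 0 := by
    rw [Int.natAbs_ne_zero]; rintro rfl; exact hld (dvd_zero _)
  have e1 : jacobiSym l d.natAbs = 1 := by
    refine jacobiSym_eq_one_of_dvd_sub_sq (x := c) ?_ (jacobiSym_natAbs_ne_zero hll.out hld)
    rw [hl, show c ^ 2 - c * d + d ^ 2 - c ^ 2 = d * (d - c) by ring, Int.natAbs_dvd]
    exact dvd_mul_right _ _
  have e2 : jacobiSym l m.natAbs * jacobiSym p m.natAbs = 1 := by
    rw [← jacobiSym.mul_left]
    refine jacobiSym_eq_one_of_dvd_sub_sq (x := a * c + b * d - a * d) ?_ ?_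
    · rw [hl, hp, Int.natAbs_dvd]
      exact ⟨m + (a * c + b * d - a * d), by rw [hm]; ring⟩
    · rw [jacobiSym.mul_left]
      exact mul_ne_zero (jacobiSym_natAbs_ne_zero hll.out hlm)
        (jacobiSym_natAbs_ne_zero hpp.out hpm)
  have e3 : jacobiSym (-m * b) p = jacobiSym p m.natAbs := by
    rw [neg_mul, jacobiSym.neg _ hodd, ZMod.χ₄_nat_one_mod_four h4, one_mul, jacobiSym.mul_left,
      jacobiSym_coeff_eq_one hp ha hb hpb, mul_one, jacobiSym_eq_of_one_mod_four h4 hmodd]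
  rw [e3, jacobiSym_eq_of_int_one_mod_four hl2 hmd, Int.natAbs_mul,
    jacobiSym.mul_right' _ hm0 hd0, e1, mul_one]
  rcases jacobiSym.trichotomy l m.natAbs with h | h | h <;> rw [h] at e2 ⊢ <;> linarith

end Form

end EisensteinTwists

/-! ### The quadratic residue symbol of a special prime -/

namespace EisensteinTwists

section Special

/-- A prime above a special split rational prime `p` has norm `p`. -/
lemma card_quotient_eq_of_isSpecialSplit {p : ℕ} (hp : IsSpecialSplit p) {π : 𝓞 K} (hπ : Prime π)
    (hπp : π ∣ (p : 𝓞 K)) : Nat.card (𝓞 K ⧸ Ideal.span {π}) = p := by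
  obtain ⟨hpp, hsplit⟩ := hp
  have hprime := isPrime_span hπ
  obtain ⟨Q, -, hQ, hQπ⟩ := Ideal.exists_ideal_over_prime_of_isIntegral
    (S := 𝓞 (IntermediateField.adjoin K (torsionX 4))) (Ideal.span {π}) ⊥ (by
      rw [← RingHom.ker_eq_comap_bot, (RingHom.injective_iff_ker_eq_bot _).mp
        (FaithfulSMul.algebraMap_injective (𝓞 K) _)]
      exact bot_le)
  have hlies : Q.LiesOver (Ideal.span {π}) := ⟨hQπ.symm⟩
  have hliesp : (Ideal.span {π}).LiesOver (Ideal.span {(p : ℤ)}) := by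
    have hmax : (Ideal.span {(p : ℤ)}).IsMaximal :=
      PrincipalIdealRing.isMaximal_of_irreducible (Nat.prime_iff_prime_int.mp hpp).irreducible
    refine ⟨hmax.eq_of_le (Ideal.IsPrime.ne_top (hprime.under ℤ)) ?_⟩
    rw [Ideal.span_singleton_le_iff_mem, Ideal.under_def, Ideal.mem_comap,
      Ideal.mem_span_singleton]
    simpa using hπp
  have hQp : Q.LiesOver (Ideal.span {(p : ℤ)}) := Ideal.LiesOver.trans Q (Ideal.span {π}) _
  have h1 := (hsplit Q hQ hQp).2
  have h2 := Ideal.inertiaDeg_below_dvd (R := ℤ) (Ideal.span {π}) Q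
  rw [h1, Nat.dvd_one] at h2
  have h3 := Ideal.absNorm_pow_inertiaDeg (Ideal.span {(p : ℤ)}) (Ideal.span {π})
  rw [h2, pow_one, Ideal.absNorm_span_singleton] at h3
  exact h3.symm.trans (by simp)

end Special

section Legendre

variable {q : 𝓞 K} {l : ℕ}

lemma natCast_mem_span (hcard : Nat.card (𝓞 K ⧸ Ideal.span {q}) = l) :
    (l : 𝓞 K) ∈ Ideal.span {q} := by
  rw [← hcard]
  exact Ideal.absNorm_mem _

lemma intCast_mem_span_iff (hq : Prime q) (hl : l.Prime) (hql : q ∣ (l : 𝓞 K)) {n : ℤ} :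
    (n : 𝓞 K) ∈ Ideal.span {q} ↔ (l : ℤ) ∣ n := by
  have hlm : (l : 𝓞 K) ∈ Ideal.span {q} := Ideal.mem_span_singleton.mpr hql
  constructor
  · intro h
    by_contra hn
    obtain ⟨u, v, huv⟩ := (Nat.prime_iff_prime_int.mp hl).coprime_iff_not_dvd.mpr hn
    refine (isPrime_span hq).ne_top ((Ideal.eq_top_iff_one _).mpr ?_)
    have e : (1 : 𝓞 K) = u * l + v * n := by exact_mod_cast huv.symm
    rw [e]
    exact add_mem (Ideal.mul_mem_left _ _ hlm) (Ideal.mul_mem_left _ _ h)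
  · rintro ⟨k, rfl⟩
    push_cast
    exact Ideal.mul_mem_right _ _ hlm

lemma two_notMem_span (hq : Prime q) (hl : l.Prime) (hql : q ∣ (l : 𝓞 K)) (hl2 : Odd l) :
    ((2 : ℕ) : 𝓞 K) ∉ Ideal.span {q} := by
  have h : ¬ (l : ℤ) ∣ 2 := fun h => by
    have : l ∣ 2 := by exact_mod_cast h
    rw [Nat.dvd_prime Nat.prime_two] at this
    rcases this with rfl | rfl
    · exact Nat.not_prime_one hl
    · exact absurd hl2 (by decide)
  have := (intCast_mem_span_iff hq hl hql).not.mpr h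
  exact_mod_cast this

/-- The power `n ^ ((l - 1) / 2)` of an integer modulo `q ∣ l`. -/
lemma pow_sub_jacobiSym_mem (hl : l.Prime) (hql : q ∣ (l : 𝓞 K)) (hl2 : Odd l) (n : ℤ) :
    (n : 𝓞 K) ^ ((l - 1) / 2) - (jacobiSym n l : ℤ) ∈ Ideal.span {q} := by
  have : Fact l.Prime := ⟨hl⟩
  have h := legendreSym.eq_pow l n
  have e : l / 2 = (l - 1) / 2 := by obtain ⟨k, rfl⟩ := hl2; omega
  rw [e, ← Int.cast_pow, eq_comm, ZMod.intCast_eq_intCast_iff_dvd_sub, dvd_sub_comm,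
    jacobiSym.legendreSym.to_jacobiSym] at h
  obtain ⟨k, hk⟩ := h
  rw [Ideal.mem_span_singleton]
  refine hql.trans ⟨k, ?_⟩
  exact_mod_cast hk

lemma jacobiSym_cast_sq (hl : l.Prime) {n : ℤ} (hn : ¬ (l : ℤ) ∣ n) :
    ((jacobiSym n l : ℤ) : 𝓞 K) ^ 2 = 1 := by
  have h : n.gcd l = 1 := by
    rw [Int.gcd_comm, ← Int.isCoprime_iff_gcd_eq_one]
    exact (Nat.prime_iff_prime_int.mp hl).coprime_iff_not_dvd.mpr hn
  exact_mod_cast jacobiSym.sq_one h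

/-- At a prime of norm `l` the quadratic residue character is the Legendre symbol. -/
lemma powerChar_two_eq_jacobiSym (hq : Prime q) (hl : l.Prime)
    (hcard : Nat.card (𝓞 K ⧸ Ideal.span {q}) = l) (hl2 : Odd l) {x : 𝓞 K} {n : ℤ}
    (hx : x - n ∈ Ideal.span {q}) (hn : ¬ (l : ℤ) ∣ n) :
    powerChar 2 (Ideal.span {q}) x = (jacobiSym n l : ℤ) := by
  have hql : q ∣ (l : 𝓞 K) := Ideal.mem_span_singleton.mp (natCast_mem_span hcard)
  refine powerChar_eq Nat.prime_two isPrimitiveRoot_neg_one (isPrime_span hq)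
    (span_ne_bot hq.ne_zero) (two_notMem_span hq hl hql hl2) (jacobiSym_cast_sq hl hn) ?_
  have h1 := pow_sub_jacobiSym_mem hl hql hl2 n
  rw [hcard]
  rw [← Ideal.Quotient.eq] at h1 hx ⊢
  rw [← h1, map_pow, map_pow, hx]

end Legendre

section Reciprocity

variable {π : 𝓞 K} {p : ℕ} {a b : ℤ}

lemma eq_form_of_card (hp : Nat.card (𝓞 K ⧸ Ideal.span {π}) = p) (hπab : π = a + b * ωO) :
    (p : ℤ) = a ^ 2 - a * b + b ^ 2 := by
  have hpos : 0 ≤ a ^ 2 - a * b + b ^ 2 := by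
    nlinarith [sq_nonneg (a - b), sq_nonneg a, sq_nonneg b]
  rw [← hp, hπab, card_quotient_span, Int.natCast_natAbs, abs_of_nonneg hpos]

/-- Quadratic reciprocity between a special prime and a prime of odd prime norm. -/
lemma powerChar_two_reciprocity_of_card_eq (hπ : Prime π) (hp : p.Prime)
    (hcard : Nat.card (𝓞 K ⧸ Ideal.span {π}) = p) (hπab : π = a + b * ωO) (ha : 4 ∣ a - 1)
    (hb : 4 ∣ b) {q : 𝓞 K} {l : ℕ} (hq : Prime q) (hl : l.Prime)
    (hcardq : Nat.card (𝓞 K ⧸ Ideal.span {q}) = l) (hl2 : Odd l) {c d : ℤ}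
    (hqcd : q = c + d * ωO) (hd : Odd d) (hπq : ¬ Associated π q) :
    powerChar 2 (Ideal.span {q}) π = powerChar 2 (Ideal.span {π}) q := by
  have : Fact p.Prime := ⟨hp⟩
  have : Fact l.Prime := ⟨hl⟩
  have hpab := eq_form_of_card hcard hπab
  have hlcd := eq_form_of_card hcardq hqcd
  have hπp : π ∣ (p : 𝓞 K) := Ideal.mem_span_singleton.mp (natCast_mem_span hcard)
  have hql : q ∣ (l : 𝓞 K) := Ideal.mem_span_singleton.mp (natCast_mem_span hcardq)
  have hp4 := mod_four_eq_one hpab ha hb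
  have hp2 : Odd p := Nat.odd_iff.mpr (by omega)
  -- a prime of prime norm does not divide its second coordinate
  have hcoord (s : ℕ) (x y : ℤ) (hs : s.Prime) (hxy : (s : ℤ) = x ^ 2 - x * y + y ^ 2) :
      ¬ (s : ℤ) ∣ y := by
    intro h
    have h1 : (s : ℤ) ∣ x ^ 2 := by
      have : x ^ 2 = s + y * (x - y) := by rw [hxy]; ring
      rw [this]
      exact dvd_add dvd_rfl (h.mul_right _)
    have h2 := (Nat.prime_iff_prime_int.mp hs).dvd_of_dvd_pow h1
    obtain ⟨u, rfl⟩ := h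
    obtain ⟨v, rfl⟩ := h2
    have h3 : (s : ℤ) * (s * (v ^ 2 - v * u + u ^ 2)) = s * 1 := by
      rw [mul_one]; nth_rewrite 3 [hxy]; ring
    have h4 := mul_left_cancel₀ (by exact_mod_cast hs.ne_zero) h3
    have h5 := Int.isUnit_iff.mp (IsUnit.of_mul_eq_one _ h4)
    have := hs.two_le
    omega
  have hpb := hcoord p a b hp hpab
  have hld := hcoord l c d hl hlcd
  set m := a * d - b * c with hm
  have e1 : d * π - m = b * q := by
    rw [hπab, hqcd, hm]; push_cast; ring
  have hbπ : (b : 𝓞 K) ∉ Ideal.span {π} := (intCast_mem_span_iff hπ hp hπp).not.mpr hpb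
  have hdq : (d : 𝓞 K) ∉ Ideal.span {q} := (intCast_mem_span_iff hq hl hql).not.mpr hld
  have hqπ : q ∉ Ideal.span {π} := fun h =>
    hπq (associated_of_prime_dvd hπ hq (Ideal.mem_span_singleton.mp h))
  have hπq' : π ∉ Ideal.span {q} := fun h =>
    hπq (associated_of_prime_dvd hq hπ (Ideal.mem_span_singleton.mp h)).symm
  have hlm : ¬ (l : ℤ) ∣ m := fun h => by
    have h1 := (intCast_mem_span_iff hq hl hql).mpr h
    have h2 : (d : 𝓞 K) * π ∈ Ideal.span {q} := by
      rw [show (d : 𝓞 K) * π = b * q + m by rw [← e1]; ring]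
      exact add_mem (Ideal.mul_mem_left _ _ (Ideal.mem_span_singleton_self q)) h1
    exact ((isPrime_span hq).mem_or_mem h2).elim hdq hπq'
  have hpm : ¬ (p : ℤ) ∣ m := fun h => by
    have h1 := (intCast_mem_span_iff hπ hp hπp).mpr h
    have h2 : (b : 𝓞 K) * q ∈ Ideal.span {π} := by
      rw [← e1]
      exact sub_mem (Ideal.mul_mem_left _ _ (Ideal.mem_span_singleton_self π)) h1
    exact ((isPrime_span hπ).mem_or_mem h2).elim hbπ hqπ
  -- if `y x ≡ n` with `y`, `n` rational, then the class of `x` is that of `n y` up to squares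
  have key : ∀ (r : 𝓞 K) (s : ℕ) (y : ℤ) (x : 𝓞 K) (n : ℤ), Prime r → s.Prime →
      Nat.card (𝓞 K ⧸ Ideal.span {r}) = s → Odd s → ¬ (s : ℤ) ∣ y → ¬ (s : ℤ) ∣ n →
      x ∉ Ideal.span {r} → y * x - n ∈ Ideal.span {r} →
      powerChar 2 (Ideal.span {r}) x = (jacobiSym (n * y) s : ℤ) := by
    intro r s y x n hr hs hcr hs2 hy hn hx hxn
    have hrs : r ∣ (s : 𝓞 K) := Ideal.mem_span_singleton.mp (natCast_mem_span hcr)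
    have h2r := two_notMem_span hr hs hrs hs2
    have hyr : (y : 𝓞 K) ∉ Ideal.span {r} := (intCast_mem_span_iff hr hs hrs).not.mpr hy
    have hy2 : (y : 𝓞 K) ^ 2 ∉ Ideal.span {r} := fun h =>
      hyr ((isPrime_span hr).mem_of_pow_mem _ h)
    rw [← powerChar_two_eq_jacobiSym hr hs hcr hs2 (x := x * (y : 𝓞 K) ^ 2) ?_ ?_,
      powerChar_mul Nat.prime_two isPrimitiveRoot_neg_one (isPrime_span hr)
        (span_ne_bot hr.ne_zero) h2r hx hy2, powerChar_pow Nat.prime_two isPrimitiveRoot_neg_one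
        (isPrime_span hr) (span_ne_bot hr.ne_zero) h2r hyr, mul_one]
    · push_cast
      rw [show x * (y : 𝓞 K) ^ 2 - n * y = (y * x - n) * y by ring]
      exact Ideal.mul_mem_right _ _ hxn
    · intro h
      exact ((Nat.prime_iff_prime_int.mp hs).dvd_or_dvd h).elim hn hy
  rw [key q l d π m hq hl hcardq hl2 hld hlm hπq' (by
      rw [e1]; exact Ideal.mul_mem_left _ _ (Ideal.mem_span_singleton_self q)),
    key π p b q (-m) hπ hp hcard hp2 hpb (by rwa [dvd_neg]) hqπ (by
      rw [show (b : 𝓞 K) * q - (-m : ℤ) = d * π by rw [← e1]; push_cast; ring]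
      exact Ideal.mul_mem_left _ _ (Ideal.mem_span_singleton_self π)),
    jacobiSym_form_reciprocity hpab hlcd ha hb hd hl2 hm hpb hld hpm hlm]

end Reciprocity

lemma dvd_of_intCast_dvd {n x y : ℤ} (h : (n : 𝓞 K) ∣ x + y * ωO) : n ∣ x ∧ n ∣ y := by
  obtain ⟨z, hz⟩ := h
  obtain ⟨u, v, rfl⟩ := exists_eq_add_mul_omegaO z
  have h1 : ((x - n * u : ℤ) : 𝓞 K) + (y - n * v : ℤ) * ωO = 0 := by
    push_cast; linear_combination hz
  obtain ⟨h2, h3⟩ := add_mul_omegaO_eq_zero h1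
  exact ⟨⟨u, by linarith⟩, ⟨v, by linarith⟩⟩

lemma exists_eq_add_mul_omegaO_of_four_dvd {π : 𝓞 K} (hπ4 : 4 ∣ π - 1) :
    ∃ a b : ℤ, π = a + b * ωO ∧ 4 ∣ a - 1 ∧ 4 ∣ b := by
  obtain ⟨a, b, rfl⟩ := exists_eq_add_mul_omegaO π
  refine ⟨a, b, rfl, dvd_of_intCast_dvd ?_⟩
  convert hπ4 using 1
  · push_cast; rfl
  · push_cast; ring

/-- A rational prime congruent to `1` modulo `3` does not stay prime in `ℤ[ω]`. -/
lemma mod_three_ne_one_of_prime {l : ℕ} (hl : l.Prime) (h : Prime (l : 𝓞 K)) : l % 3 ≠ 1 := by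
  intro h3
  have : Fact l.Prime := ⟨hl⟩
  have hcard : 3 ∣ Nat.card (ZMod l)ˣ := by
    rw [Nat.card_eq_fintype_card, ZMod.card_units]; omega
  have : Fact (Nat.Prime 3) := ⟨Nat.prime_three⟩
  obtain ⟨u, hu⟩ := exists_prime_orderOf_dvd_card' 3 hcard
  have h1 : (u : ZMod l) ^ 3 = 1 := by
    rw [← hu, ← Units.val_pow_eq_pow_val, pow_orderOf_eq_one, Units.val_one]
  have h2 : (u : ZMod l) ≠ 1 := fun h => by
    rw [Units.val_eq_one] at h
    rw [h, orderOf_one] at hu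
    norm_num at hu
  obtain ⟨n, hn⟩ := ZMod.intCast_surjective (u : ZMod l)
  have h4 : (u : ZMod l) ^ 2 + u + 1 = 0 := by
    refine (mul_eq_zero.mp (?_ : ((u : ZMod l) - 1) * (u ^ 2 + u + 1) = 0)).resolve_left
      (sub_ne_zero.mpr h2)
    linear_combination h1
  rw [← hn] at h4
  have h5 : (l : ℤ) ∣ n ^ 2 + n + 1 := by
    rw [← ZMod.intCast_zmod_eq_zero_iff_dvd _ l]; exact_mod_cast h4
  have h6 : (l : 𝓞 K) ∣ ((n : ℤ) + (-1 : ℤ) * ωO) * ((n + 1 : ℤ) + (1 : ℤ) * ωO) := by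
    obtain ⟨k, hk⟩ := h5
    refine ⟨k, ?_⟩
    have hk' : (n : 𝓞 K) ^ 2 + n + 1 = l * k := by exact_mod_cast hk
    push_cast
    linear_combination hk' - omegaO_sq
  have h7 (x : ℤ) (hx : (l : ℤ) ∣ x) (h1 : x = 1 ∨ x = -1) : False := by
    have : IsUnit (l : ℤ) := isUnit_of_dvd_unit hx (Int.isUnit_iff.mpr h1)
    exact (Nat.prime_iff_prime_int.mp hl).not_isUnit this
  rcases h.dvd_or_dvd h6 with h | h
  · exact h7 _ (dvd_of_intCast_dvd (n := l) (by exact_mod_cast h)).2 (Or.inr rfl)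
  · exact h7 _ (dvd_of_intCast_dvd (n := l) (by exact_mod_cast h)).2 (Or.inl rfl)

section Reciprocity

variable {π : 𝓞 K} {p : ℕ} {a b : ℤ}

/-- `π ^ (l + 1) ≡ π π̄` modulo an inert prime `l`. -/
lemma pow_add_one_sub_norm_mem {l : ℕ} (hl : l.Prime) (hl3 : l % 3 = 2) :
    (l : 𝓞 K) ∣ ((a : 𝓞 K) + b * ωO) ^ (l + 1) - (a ^ 2 - a * b + b ^ 2 : ℤ) := by
  have : Fact l.Prime := ⟨hl⟩
  have hfermat (n : ℤ) : ∃ k : ℤ, (n : 𝓞 K) ^ l = n + l * k := by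
    have : (l : ℤ) ∣ n ^ l - n := by
      rw [← ZMod.intCast_zmod_eq_zero_iff_dvd _ l]
      push_cast
      rw [ZMod.pow_card, sub_self]
    obtain ⟨k, hk⟩ := this
    exact ⟨k, by exact_mod_cast (by linarith : n ^ l = n + l * k)⟩
  obtain ⟨r, hr⟩ := exists_add_pow_prime_eq hl (a : 𝓞 K) (b * ωO)
  obtain ⟨u, hu⟩ := hfermat a
  obtain ⟨v, hv⟩ := hfermat b
  have hω : ωO ^ l = ωO ^ 2 := by
    rw [← Nat.div_add_mod l 3, hl3, pow_add, pow_mul, omegaO_pow_three, one_pow, one_mul]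
  rw [pow_succ, hr, mul_pow, hu, hv, hω]
  refine ⟨(u + v * ωO ^ 2 + a * (b * ωO) * r) * (a + b * ωO), ?_⟩
  push_cast
  linear_combination (a * b + b ^ 2 * (ωO - 1) : 𝓞 K) * omegaO_sq

/-- Quadratic reciprocity between a special prime and an inert rational prime. -/
lemma powerChar_two_reciprocity_of_inert (hπ : Prime π) (hp : p.Prime)
    (hcard : Nat.card (𝓞 K ⧸ Ideal.span {π}) = p) (hπab : π = a + b * ωO) (ha : 4 ∣ a - 1)
    (hb : 4 ∣ b) {l : ℕ} (hl : l.Prime) (hl2 : Odd l) (hlK : Prime (l : 𝓞 K)) (hl3 : l ≠ 3)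
    (hπl : ¬ Associated π (l : 𝓞 K)) :
    powerChar 2 (Ideal.span {(l : 𝓞 K)}) π = powerChar 2 (Ideal.span {π}) l := by
  have hpab := eq_form_of_card hcard hπab
  have hp4 := mod_four_eq_one hpab ha hb
  have hp2 : Odd p := Nat.odd_iff.mpr (by omega)
  have hl3' : l % 3 = 2 := by
    have h1 := mod_three_ne_one_of_prime hl hlK
    have h2 : l % 3 ≠ 0 := fun h => hl3
      ((Nat.prime_dvd_prime_iff_eq Nat.prime_three hl).mp (Nat.dvd_of_mod_eq_zero h)).symm
    omega
  have hπp : π ∣ (p : 𝓞 K) := Ideal.mem_span_singleton.mp (natCast_mem_span hcard)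
  have hpl : p ≠ l := by
    rintro rfl
    exact hπl (associated_of_prime_dvd hπ hlK hπp)
  have hlp : ¬ (l : ℤ) ∣ p := fun h =>
    hpl ((Nat.prime_dvd_prime_iff_eq hl hp).mp (by exact_mod_cast h)).symm
  have hpl' : ¬ (p : ℤ) ∣ l := fun h =>
    hpl ((Nat.prime_dvd_prime_iff_eq hp hl).mp (by exact_mod_cast h))
  have hcardl : Nat.card (𝓞 K ⧸ Ideal.span {(l : 𝓞 K)}) = l ^ 2 := by
    have := card_quotient_span l 0
    simp only [Int.cast_natCast, Int.cast_zero, zero_mul, add_zero] at this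
    rw [this]
    simp [Int.natAbs_pow]
  rw [powerChar_two_eq_jacobiSym hπ hp hcard hp2 (n := l) (by simp) hpl',
    ← jacobiSym.quadratic_reciprocity_one_mod_four hp4 hl2]
  refine powerChar_eq Nat.prime_two isPrimitiveRoot_neg_one (isPrime_span hlK)
    (span_ne_bot hlK.ne_zero) (two_notMem_span hlK hl dvd_rfl hl2) (jacobiSym_cast_sq hl hlp) ?_
  have e : (l ^ 2 - 1) / 2 = (l + 1) * ((l - 1) / 2) := by
    obtain ⟨k, rfl⟩ := hl2
    rw [show (2 * k + 1) ^ 2 - 1 = 2 * ((2 * k + 1 + 1) * k) by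
      rw [Nat.sub_eq_iff_eq_add (Nat.one_le_pow _ _ (by omega))]; ring]
    simp
  have h1 := pow_add_one_sub_norm_mem (a := a) (b := b) hl hl3'
  have h2 := pow_sub_jacobiSym_mem hl (dvd_refl (l : 𝓞 K)) hl2 p
  rw [← hπab, ← hpab, ← Ideal.mem_span_singleton, ← Ideal.Quotient.eq] at h1
  rw [hcardl, e, pow_mul]
  rw [← Ideal.Quotient.eq] at h2 ⊢
  rw [← h2, map_pow, h1, map_pow]

/-- The quadratic residue symbol of a special prime at the prime `2`. -/
lemma residueSymbolAt_two_eq (hπ : Prime π) (hp : p.Prime)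
    (hcard : Nat.card (𝓞 K ⧸ Ideal.span {π}) = p) (hπab : π = a + b * ωO) (ha : 4 ∣ a - 1)
    (hb : 4 ∣ b) (h2 : Prime (2 : 𝓞 K)) :
    residueSymbolAt 2 π (Ideal.span {2}) = emb (powerChar 2 (Ideal.span {π}) 2) := by
  have : Fact p.Prime := ⟨hp⟩
  have hpab := eq_form_of_card hcard hπab
  have hp4 := mod_four_eq_one hpab ha hb
  have hp2 : Odd p := Nat.odd_iff.mpr (by omega)
  have hp2' : ¬ (p : ℤ) ∣ 2 := fun h => by
    have h' : p ∣ 2 := by exact_mod_cast h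
    have := Nat.le_of_dvd two_pos h'
    have := hp.two_le
    omega
  rw [powerChar_two_eq_jacobiSym hπ hp hcard hp2 (n := 2) (by simp) hp2']
  obtain ⟨i, hi⟩ := ha
  obtain ⟨j, hj⟩ := hb
  rw [jacobiSym_two_eq_ite hpab ⟨i, hi⟩ hj]
  have hμ : π = 1 + 4 * ((i : 𝓞 K) + j * ωO) := by
    obtain rfl : a = 4 * i + 1 := by linarith
    rw [hπab, hj]; push_cast; ring
  obtain ⟨h3, h4⟩ := residueSymbolAt_two_span_two hμ hπ.ne_zero (isPrime_span h2)
  have e : ((i : 𝓞 K) + j * ωO) + ((i : 𝓞 K) + j * ωO) ^ 2 =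
      (i + i ^ 2 - j ^ 2 : ℤ) + (j + 2 * i * j - j ^ 2 : ℤ) * ωO := by
    push_cast; linear_combination (j ^ 2 : 𝓞 K) * omegaO_sq
  rw [e] at h3 h4
  have hii : Even (i + i ^ 2) := by
    rw [show i + i ^ 2 = i * (i + 1) by ring]; exact Int.even_mul_succ_self i
  split_ifs with hje
  · rw [h3]
    · simp
    · have h5 : Even (i + i ^ 2 - j ^ 2) := hii.sub ((Int.even_pow' two_ne_zero).mpr hje)
      have h6 : Even (j + 2 * i * j - j ^ 2) :=
        (hje.add (hje.mul_left _)).sub ((Int.even_pow' two_ne_zero).mpr hje)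
      obtain ⟨x, hx⟩ := h5
      obtain ⟨y, hy⟩ := h6
      exact ⟨x + y * ωO, by rw [hx, hy]; push_cast; ring⟩
  · rw [h4]
    · simp
    · intro h
      have h5 := (dvd_of_intCast_dvd (n := 2) (by exact_mod_cast h)).1
      have h6 : Even (i + i ^ 2 - j ^ 2) := even_iff_two_dvd.mpr h5
      have h7 := hii.sub h6
      rw [sub_sub_cancel, Int.even_pow' two_ne_zero] at h7
      exact hje h7

/-- Units are squares modulo a special prime. -/
lemma powerChar_two_unit (hπ : Prime π) (hp : p.Prime)
    (hcard : Nat.card (𝓞 K ⧸ Ideal.span {π}) = p) (hp4 : p % 4 = 1) {u : 𝓞 K} (hu : IsUnit u) :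
    powerChar 2 (Ideal.span {π}) u = 1 := by
  have hp2 : Odd p := Nat.odd_iff.mpr (by omega)
  have hπp : π ∣ (p : 𝓞 K) := Ideal.mem_span_singleton.mp (natCast_mem_span hcard)
  have h2 := two_notMem_span hπ hp hπp hp2
  have hunit {x : 𝓞 K} (hx : IsUnit x) : x ∉ Ideal.span {π} := fun h =>
    hπ.not_isUnit (isUnit_of_dvd_unit (Ideal.mem_span_singleton.mp h) hx)
  have hω (k : ℕ) : powerChar 2 (Ideal.span {π}) (ωO ^ k) = 1 := by
    have e : ωO ^ k = (ωO ^ (2 * k)) ^ 2 := by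
      rw [← pow_mul, show 2 * k * 2 = 3 * k + k by ring, pow_add, pow_mul, omegaO_pow_three,
        one_pow, one_mul]
    rw [e]
    exact powerChar_pow Nat.prime_two isPrimitiveRoot_neg_one (isPrime_span hπ)
      (span_ne_bot hπ.ne_zero) h2 (hunit (isUnit_omegaO.pow _))
  have hneg : powerChar 2 (Ideal.span {π}) (-1) = 1 := by
    rw [powerChar_two_eq_jacobiSym hπ hp hcard hp2 (n := -1) (by simp) fun h =>
      (Nat.prime_iff_prime_int.mp hp).not_isUnit (isUnit_of_dvd_unit h isUnit_one.neg),
      jacobiSym.at_neg_one hp2, ZMod.χ₄_nat_one_mod_four hp4, Int.cast_one]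
  obtain ⟨k, rfl | rfl⟩ := isUnit_cases hu
  · exact hω k
  · rw [← neg_one_mul, powerChar_mul Nat.prime_two isPrimitiveRoot_neg_one (isPrime_span hπ)
      (span_ne_bot hπ.ne_zero) h2 (hunit isUnit_one.neg) (hunit (isUnit_omegaO.pow _)), hω, hneg,
      one_mul]

/-- The quadratic residue symbol of a special prime `π` at `(β)` is the quadratic residue character
of `β` modulo `π`. -/
theorem residueSymbol_two_eq (hπ : Prime π) (hp : p.Prime)
    (hcard : Nat.card (𝓞 K ⧸ Ideal.span {π}) = p) (hπ4 : 4 ∣ π - 1) {β : 𝓞 K}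
    (hβ3 : ¬ (1 - ωO) ∣ β) (hπβ : ¬ π ∣ β) :
    residueSymbol 2 π (Ideal.span {β}) = emb (powerChar 2 (Ideal.span {π}) β) := by
  obtain ⟨a, b, hπab, ha, hb⟩ := exists_eq_add_mul_omegaO_of_four_dvd hπ4
  have hpab := eq_form_of_card hcard hπab
  have hp4 := mod_four_eq_one hpab ha hb
  have hp2 : Odd p := Nat.odd_iff.mpr (by omega)
  have hπp : π ∣ (p : 𝓞 K) := Ideal.mem_span_singleton.mp (natCast_mem_span hcard)
  have h2π := two_notMem_span hπ hp hπp hp2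
  have hprime := isPrime_span hπ
  have hbot := span_ne_bot hπ.ne_zero
  have hmem {x : 𝓞 K} : x ∈ Ideal.span {π} ↔ π ∣ x := Ideal.mem_span_singleton
  have hmul {x y : 𝓞 K} (hx : ¬ π ∣ x) (hy : ¬ π ∣ y) :=
    powerChar_mul Nat.prime_two isPrimitiveRoot_neg_one hprime hbot h2π (hmem.not.mpr hx)
      (hmem.not.mpr hy)
  let G : Submonoid (𝓞 K) :=
    { carrier := {x | ¬ π ∣ x}
      one_mem' := fun h => hπ.not_isUnit (isUnit_of_dvd_one h)
      mul_mem' := fun {x y} hx hy h => (hπ.dvd_or_dvd h).elim hx hy }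
  have hβ0 : β ≠ 0 := by rintro rfl; exact hπβ (dvd_zero π)
  obtain ⟨γ, hγπ, ⟨u, rfl⟩, h⟩ := exists_associated_residueSymbol_eq 2 π G
    (fun x => emb (powerChar 2 (Ideal.span {π}) x))
    (by simp only [powerChar_two_unit hπ hp hcard hp4 isUnit_one, map_one])
    (fun x hx y hy => by rw [hmul hx hy, map_mul]) hβ0 (fun q hq hqβ => by
      -- odd primes are covered by the reciprocity laws
      have hodd {q' : 𝓞 K} (hq' : Prime q') (hqq' : Associated q q') {l : ℕ} (hl : l.Prime)
          (hl2 : Odd l) (hql : q' ∣ (l : 𝓞 K)) (hrec : ¬ Associated π q' →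
            powerChar 2 (Ideal.span {q'}) π = powerChar 2 (Ideal.span {π}) q') :
          ∃ q'' ∈ G, Associated q q'' ∧ residueSymbolAt 2 π (Ideal.span {q''}) =
            emb (powerChar 2 (Ideal.span {π}) q'') := by
        have hπq : ¬ π ∣ q' := fun h => hπβ ((hqq'.dvd_iff_dvd_right.mpr h).trans hqβ)
        refine ⟨q', hπq, hqq', ?_⟩
        rw [residueSymbolAt_eq_powerChar Nat.prime_two isPrimitiveRoot_neg_one (isPrime_span hq')
          (span_ne_bot hq'.ne_zero) (two_notMem_span hq' hl hql hl2)
          (fun h => hπq (associated_of_prime_dvd hq' hπ (Ideal.mem_span_singleton.mp h)).symm.dvd),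
          hrec fun h => hπq h.dvd]
      obtain ⟨l, hl, hql⟩ := exists_prime_dvd hq
      rcases card_quotient_eq_or_associated hq hl hql with hcardq | hass
      · obtain ⟨c, d, hqcd⟩ := exists_eq_add_mul_omegaO q
        have hlcd := eq_form_of_card hcardq hqcd
        have hl2 : Odd l := by
          -- no element of `ℤ[ω]` has norm `2`
          rcases hl.eq_two_or_odd' with rfl | h
          · exfalso
            rcases Int.even_or_odd c with ⟨x, rfl⟩ | ⟨x, rfl⟩ <;>
            rcases Int.even_or_odd d with ⟨y, rfl⟩ | ⟨y, rfl⟩ <;>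
            ring_nf at hlcd <;> omega
          · exact h
        by_cases hd : Odd d
        · exact hodd hq (Associated.refl q) hl hl2 hql fun h =>
            powerChar_two_reciprocity_of_card_eq hπ hp hcard hπab ha hb hq hl hcardq hl2 hqcd hd h
        · -- multiplication by `ω` makes the second coordinate odd
          have hass : Associated q (ωO * q) := by
            rw [mul_comm]; exact associated_mul_unit_right q ωO isUnit_omegaO
          have hspan : Ideal.span {q} = Ideal.span {ωO * q} :=
            Ideal.span_singleton_eq_span_singleton.mpr hass
          have hc : Odd (c - d) := by
            rw [Int.not_odd_iff_even] at hd
            refine Int.odd_sub.mpr ⟨fun _ => hd, fun _ => ?_⟩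
            by_contra hc
            rw [Int.not_odd_iff_even] at hc
            have h1 : Even (l : ℤ) := by
              rw [hlcd]
              exact (((Int.even_pow' two_ne_zero).mpr hc).sub (hc.mul_right d)).add
                ((Int.even_pow' two_ne_zero).mpr hd)
            have h2 : Even l := by exact_mod_cast h1
            exact Nat.not_even_iff_odd.mpr hl2 h2
          refine hodd (hass.prime hq) hass hl hl2 (hass.dvd_iff_dvd_left.mp hql) fun h =>
            powerChar_two_reciprocity_of_card_eq hπ hp hcard hπab ha hb (hass.prime hq) hl
              (hspan ▸ hcardq) hl2 (c := -d) (d := c - d) ?_ hc h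
          rw [hqcd]; push_cast
          linear_combination (d : 𝓞 K) * omegaO_sq
      · have hlK : Prime (l : 𝓞 K) := hass.prime hq
        rcases hl.eq_two_or_odd' with rfl | hl2
        · refine ⟨2, fun h => h2π (hmem.mpr (by exact_mod_cast h)), by exact_mod_cast hass, ?_⟩
          exact residueSymbolAt_two_eq hπ hp hcard hπab ha hb (by exact_mod_cast hlK)
        · refine hodd hlK hass hl hl2 dvd_rfl fun h =>
            powerChar_two_reciprocity_of_inert hπ hp hcard hπab ha hb hl hl2 hlK ?_ h
          rintro rfl
          refine hβ3 ((one_sub_omegaO_dvd_three.trans ?_).trans hqβ)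
          exact_mod_cast hass.symm.dvd)
  rw [h, hmul hπβ fun h => hπ.not_isUnit (isUnit_of_dvd_unit h u.isUnit),
    powerChar_two_unit hπ hp hcard hp4 u.isUnit, mul_one]

end Reciprocity

end EisensteinTwists

/-! ### Periods, and averaging over a symmetric set of residues -/

namespace EisensteinTwists

section Periods

variable {L : PeriodPair} (hg₂ : L.g₂ = 0) (hg₃ : L.g₃ = 27) {Ω : ℝ}
  (hΩ : IsLeast {x : ℝ | 0 < x ∧ (x : ℂ) ∈ L.lattice} |Ω|)

include hg₂ in
lemma emb_mul_mem_lattice (x : 𝓞 K) {w : ℂ} (hw : w ∈ L.lattice) : emb x * w ∈ L.lattice := by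
  obtain ⟨a, b, rfl⟩ := exists_eq_add_mul_omegaO x
  have h1 := L.lattice.smul_mem a hw
  have h2 := L.lattice.smul_mem b (omega_mul_mem_of_g₂_eq_zero hg₂ w hw)
  rw [map_add, map_mul, map_intCast, map_intCast, emb_omegaO]
  convert add_mem h1 h2 using 1
  simp only [zsmul_eq_mul]
  ring

include hΩ in
/-- The real periods are the integral multiples of `Ω`. -/
lemma exists_eq_intCast_mul_period {x : ℝ} (hx : (x : ℂ) ∈ L.lattice) :
    ∃ m : ℤ, x = m * Ω := by
  have hpos := hΩ.1.1
  have hmem : ∀ k : ℤ, ((x - k * |Ω| : ℝ) : ℂ) ∈ L.lattice := fun k => by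
    have := sub_mem hx (L.lattice.smul_mem k hΩ.1.2)
    convert this using 1
    simp
  have h0 : x - ⌊x / |Ω|⌋ * |Ω| = 0 := by
    have h1 : (⌊x / |Ω|⌋ : ℝ) * |Ω| ≤ x := (le_div_iff₀ hpos).mp (Int.floor_le _)
    have h2 : x < (⌊x / |Ω|⌋ + 1 : ℝ) * |Ω| := (div_lt_iff₀ hpos).mp (Int.lt_floor_add_one _)
    by_contra hne
    have h3 : 0 < x - ⌊x / |Ω|⌋ * |Ω| := lt_of_le_of_ne (by linarith) (Ne.symm hne)
    have := hΩ.2 ⟨h3, hmem _⟩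
    linarith
  generalize ⌊x / |Ω|⌋ = k at h0
  rcases abs_choice Ω with e | e
  · exact ⟨k, by rw [e] at h0; linarith⟩
  · refine ⟨-k, ?_⟩
    rw [e] at h0
    push_cast
    linarith

include hg₂ hg₃ hΩ in
/-- The period lattice is contained in `ℤ[ω] Ω / 3`: the traces of `w` and `ω w` are real
periods. -/
lemma exists_three_mul_eq {w : ℂ} (hw : w ∈ L.lattice) : ∃ y : 𝓞 K, 3 * w = emb y * Ω := by
  have htr : ∀ v ∈ L.lattice, ∃ m : ℤ, v + conj v = m * Ω := fun v hv => by
    have h1 := add_mem hv (conj_mem_of_g₂_of_g₃ (by simp [hg₂])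
      (by rw [hg₃]; exact map_ofNat _ 27) v hv)
    rw [Complex.add_conj] at h1 ⊢
    obtain ⟨m, hm⟩ := exists_eq_intCast_mul_period hΩ h1
    exact ⟨m, by rw [hm]; push_cast; rfl⟩
  obtain ⟨m, hm⟩ := htr w hw
  obtain ⟨n, hn⟩ := htr _ (omega_mul_mem_of_g₂_eq_zero hg₂ w hw)
  rw [map_mul, conj_omega] at hn
  refine ⟨-(ωO - ωO ^ 2) * (n - m * ωO ^ 2), ?_⟩
  simp only [map_mul, map_neg, map_sub, map_pow, emb_omegaO, map_intCast]
  linear_combination (ω - ω ^ 2) * ω ^ 2 * hm - (ω - ω ^ 2) * hn +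
    w * (ω ^ 2 - 3 * ω + 3) * omega_sq

include hg₂ hg₃ hΩ in
/-- If `c` is prime to `D` and `D` is a nonunit prime to `3`, then `c Ω / D` is no period. -/
lemma div_notMem {c D : 𝓞 K} (hD : ¬ IsUnit D) (hD0 : D ≠ 0) (hD3 : IsCoprime D 3)
    (hcD : IsCoprime c D) : emb c * Ω / emb D ∉ L.lattice := fun h => by
  obtain ⟨x, y, hxy⟩ := hcD
  have h0 := emb_ne_zero hD0
  have hxy' : emb x * emb c + emb y * emb D = 1 := by
    rw [← map_mul, ← map_mul, ← map_add, hxy, map_one]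
  have h1 : (Ω : ℂ) / emb D ∈ L.lattice := by
    have := add_mem (emb_mul_mem_lattice hg₂ x h) (emb_mul_mem_lattice hg₂ y (period_mem hΩ))
    convert this using 1
    field_simp
    linear_combination -(Ω : ℂ) * hxy'
  obtain ⟨z, hz⟩ := exists_three_mul_eq hg₂ hg₃ hΩ h1
  have hΩ0 : (Ω : ℂ) ≠ 0 := by exact_mod_cast period_ne_zero hΩ
  have h3 : (3 : 𝓞 K) = D * z := emb_injective (by
    rw [map_mul, map_ofNat]
    field_simp at hz
    apply mul_left_cancel₀ hΩ0
    linear_combination (Ω : ℂ) * hz)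
  exact hD (hD3.isUnit_of_dvd' dvd_rfl ⟨z, h3⟩)

include hg₂ hΩ in
lemma div_add_third_notMem {c D : 𝓞 K} (hD0 : D ≠ 0) (hD3 : IsCoprime D 3) {e : ℤ}
    (he : e = 1 ∨ e = -1) : emb c * Ω / emb D + e * ((Ω : ℂ) / 3) ∉ L.lattice := fun h => by
  obtain ⟨x, y, hxy⟩ := hD3
  have h0 := emb_ne_zero hD0
  have hxy' : emb x * emb D + emb y * 3 = 1 := by
    rw [← map_ofNat emb, ← map_mul, ← map_mul, ← map_add, hxy, map_one]
  apply period_div_three_notMem hΩ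
  have h1 := emb_mul_mem_lattice hg₂ x (emb_mul_mem_lattice hg₂ D h)
  have h2 := emb_mul_mem_lattice hg₂ (e * y) (period_mem hΩ)
  have h3 := emb_mul_mem_lattice hg₂ (x * c) (period_mem hΩ)
  have h4 : e * ((Ω : ℂ) / 3) ∈ L.lattice := by
    convert add_mem (sub_mem h1 h3) h2 using 1
    simp only [map_mul, map_intCast]
    field_simp
    linear_combination -(e : ℂ) * (Ω : ℂ) * hxy'
  rcases he with rfl | rfl
  · simpa using h4
  · simpa using h4

end Periods

section Averaging

variable {L : PeriodPair} (hg₂ : L.g₂ = 0) (hg₃ : L.g₃ = 27) {Ω : ℝ}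
  (hΩ : IsLeast {x : ℝ | 0 < x ∧ (x : ℂ) ∈ L.lattice} |Ω|)

/-- A set of residues modulo `D` stable under negation can be summed over in the opposite order. -/
lemma exists_neg_involution {D : 𝓞 K} {S : Finset (𝓞 K)}
    (hinj : ∀ x ∈ S, ∀ y ∈ S, D ∣ x - y → x = y) (hsym : ∀ c ∈ S, ∃ c' ∈ S, D ∣ c + c') :
    ∃ τ : 𝓞 K → 𝓞 K, (∀ c ∈ S, D ∣ c + τ c) ∧ ∀ f : 𝓞 K → ℂ, ∑ c ∈ S, f (τ c) = ∑ c ∈ S, f c := by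
  classical
  choose! τ hτS hτ using hsym
  have hττ : ∀ c ∈ S, τ (τ c) = c := fun c hc => by
    refine hinj _ (hτS _ (hτS c hc)) c hc ?_
    have := dvd_sub (hτ _ (hτS c hc)) (hτ c hc)
    convert this using 1
    ring
  exact ⟨τ, hτ, fun f => Finset.sum_nbij' τ τ hτS hτS hττ hττ fun _ _ => rfl⟩

include hg₂ hg₃ hΩ in
/-- The averaged evaluation of `ℰ₁*`, together with the vanishing of the odd part. -/
lemma sum_E₁star_eq {D : 𝓞 K} (hD : ¬ IsUnit D) (hD0 : D ≠ 0) (hD3 : IsCoprime D 3)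
    {S : Finset (𝓞 K)} (hcop : ∀ c ∈ S, IsCoprime c D)
    (hinj : ∀ x ∈ S, ∀ y ∈ S, D ∣ x - y → x = y) (hsym : ∀ c ∈ S, ∃ c' ∈ S, D ∣ c + c') :
    ∑ c ∈ S, E₁star (emb c * Ω / emb D + Ω / 3) L.lattice =
      -(Real.sign Ω : ℂ) * ((1 / 2) * (∑ c ∈ S, 9 / (3 - L.weierstrassP (emb c * Ω / emb D)))
        - (S.card : ℂ)) ∧
    ∑ c ∈ S, L.derivWeierstrassP (emb c * Ω / emb D) /
      (3 - L.weierstrassP (emb c * Ω / emb D)) = 0 := by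
  obtain ⟨τ, hτ, hsum⟩ := exists_neg_involution hinj hsym
  have h0 := emb_ne_zero hD0
  have hz : ∀ c ∈ S, ∃ w ∈ L.lattice, emb (τ c) * Ω / emb D = -(emb c * Ω / emb D) + w := by
    intro c hc
    obtain ⟨x, hx⟩ := hτ c hc
    refine ⟨emb x * Ω, emb_mul_mem_lattice hg₂ x (period_mem hΩ), ?_⟩
    have : emb c + emb (τ c) = emb D * emb x := by rw [← map_add, hx, map_mul]
    field_simp
    linear_combination (Ω : ℂ) * this
  constructor
  · have h1 : ∑ c ∈ S, E₁star (emb c * Ω / emb D + Ω / 3) L.lattice +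
        ∑ c ∈ S, E₁star (emb c * Ω / emb D + Ω / 3) L.lattice =
        ∑ c ∈ S, -(Real.sign Ω : ℂ) * (9 / (3 - L.weierstrassP (emb c * Ω / emb D)) - 2) := by
      nth_rewrite 2 [← hsum fun c => E₁star (emb c * Ω / emb D + Ω / 3) L.lattice]
      rw [← Finset.sum_add_distrib]
      refine Finset.sum_congr rfl fun c hc => ?_
      obtain ⟨w, hw, e⟩ := hz c hc
      rw [e, add_right_comm, E₁star_add L _ hw]
      have n1 := div_add_third_notMem hg₂ hΩ (c := c) hD0 hD3 (Or.inl rfl)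
      have n2 := div_add_third_notMem hg₂ hΩ (c := c) hD0 hD3 (Or.inr rfl)
      exact E₁star_add_div_three_add_E₁star_neg_add_div_three hg₂ hg₃ hΩ
        (div_notMem hg₂ hg₃ hΩ hD hD0 hD3 (hcop c hc)) (by simpa using n1)
        (by simpa [sub_eq_add_neg] using n2)
    rw [← Finset.mul_sum, Finset.sum_sub_distrib, Finset.sum_const, nsmul_eq_mul] at h1
    linear_combination (1 / 2 : ℂ) * h1
  · have h1 := hsum fun c => L.derivWeierstrassP (emb c * Ω / emb D) /
      (3 - L.weierstrassP (emb c * Ω / emb D))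
    have h2 : ∑ c ∈ S, L.derivWeierstrassP (emb (τ c) * Ω / emb D) /
        (3 - L.weierstrassP (emb (τ c) * Ω / emb D)) =
        -∑ c ∈ S, L.derivWeierstrassP (emb c * Ω / emb D) /
        (3 - L.weierstrassP (emb c * Ω / emb D)) := by
      rw [← Finset.sum_neg_distrib]
      refine Finset.sum_congr rfl fun c hc => ?_
      obtain ⟨w, hw, e⟩ := hz c hc
      rw [e, L.derivWeierstrassP_add_coe _ ⟨w, hw⟩, L.weierstrassP_add_coe _ ⟨w, hw⟩,
        L.derivWeierstrassP_neg, L.weierstrassP_neg, neg_div]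
    rw [h2] at h1
    exact self_eq_neg.mp h1.symm

end Averaging

section SymmetricV

lemma RepresentsUnits.isCoprime {D : 𝓞 K} {C : Finset (𝓞 K)} (hC : RepresentsUnits D C) {c : 𝓞 K}
    (hc : c ∈ C) : IsCoprime c D := by
  have hu : IsUnit (Ideal.Quotient.mk (Ideal.span {D}) c) := hC.mapsTo hc
  obtain ⟨y, hy⟩ := Ideal.Quotient.mk_surjective hu.unit⁻¹.val
  have h : Ideal.Quotient.mk (Ideal.span {D}) (c * y) = Ideal.Quotient.mk _ 1 := by
    rw [map_mul, hy, map_one]; exact hu.mul_val_inv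
  rw [Ideal.Quotient.eq, Ideal.mem_span_singleton] at h
  obtain ⟨z, hz⟩ := h
  exact ⟨y, -z, by linear_combination hz⟩

lemma RepresentsUnits.eq_of_dvd_sub {D : 𝓞 K} {C : Finset (𝓞 K)} (hC : RepresentsUnits D C)
    {x y : 𝓞 K} (hx : x ∈ C) (hy : y ∈ C) (h : D ∣ x - y) : x = y :=
  hC.injOn hx hy (by rwa [Ideal.Quotient.eq, Ideal.mem_span_singleton])

/-- The set `V` is stable under negation modulo `D` as soon as the residue symbols defining it are
given by power residue characters that are trivial at `-1`. -/
lemma exists_neg_mem_V {m : ℕ} (hm : m.Prime) {ζ : 𝓞 K} (hζ : IsPrimitiveRoot ζ m) {n : ℕ}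
    {π : Fin n → 𝓞 K} {D : 𝓞 K} {C : Finset (𝓞 K)} (hC : RepresentsUnits D C)
    (hπ : ∀ j, Prime (π j)) (hπD : ∀ j, π j ∣ D) (hm𝔮 : ∀ j, (m : 𝓞 K) ∉ Ideal.span {π j})
    (h3 : ∀ j, ¬ π j ∣ 3) (hneg : ∀ j, powerChar m (Ideal.span {π j}) (-1) = 1)
    (hsymb : ∀ j c, ¬ π j ∣ 3 * c + D → residueSymbol m (π j) (Ideal.span {3 * c + D}) =
      emb (powerChar m (Ideal.span {π j}) (3 * c + D))) :
    ∀ c ∈ V m π D C, ∃ c' ∈ V m π D C, D ∣ c + c' := by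
  classical
  intro c hc
  rw [V, Finset.mem_filter] at hc
  obtain ⟨hcC, hcV⟩ := hc
  have hu : IsUnit (Ideal.Quotient.mk (Ideal.span {D}) c) := hC.mapsTo hcC
  obtain ⟨c', hc'C, hc'⟩ := hC.surjOn (show -Ideal.Quotient.mk (Ideal.span {D}) c ∈
    {u | IsUnit u} from hu.neg)
  have hD : D ∣ c + c' := by
    rw [← Ideal.mem_span_singleton, ← Ideal.Quotient.eq_zero_iff_mem, map_add, hc', add_neg_cancel]
  refine ⟨c', ?_, hD⟩
  rw [V, Finset.mem_filter]
  refine ⟨hc'C, fun j => ?_⟩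
  have hnot : ∀ x ∈ C, ¬ π j ∣ 3 * x + D := fun x hx h => by
    have h1 := (hπ j).dvd_or_dvd ((dvd_add_left (hπD j)).mp h)
    rcases h1 with h1 | h1
    · exact h3 j h1
    · exact (hπ j).not_isUnit ((hC.isCoprime hx).isUnit_of_dvd' h1 (hπD j))
  have hprime := isPrime_span (hπ j)
  have hbot := span_ne_bot (hπ j).ne_zero
  have hn1 := hnot c hcC
  have hn2 := hnot c' hc'C
  have e := hcV j
  rw [hsymb j c hn1] at e
  rw [hsymb j c' hn2, ← e]
  congr 1
  -- `3 c' + D ≡ -(3 c + D)` modulo `π j`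
  have hmul := powerChar_mul hm hζ hprime hbot (hm𝔮 j) (a := -1) (b := 3 * c + D)
    (fun h => (hπ j).not_isUnit (isUnit_of_dvd_unit (Ideal.mem_span_singleton.mp h)
      isUnit_one.neg)) (by rwa [Ideal.mem_span_singleton])
  rw [hneg j, one_mul] at hmul
  rw [← hmul]
  refine powerChar_congr hm hζ hprime hbot (hm𝔮 j) (by rwa [Ideal.mem_span_singleton]) ?_
  rw [Ideal.mem_span_singleton, show 3 * c' + D - -1 * (3 * c + D) = 3 * (c + c') + 2 * D by ring]
  exact dvd_add (((hπD j).trans hD).mul_left 3) ((hπD j).mul_left 2)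

end SymmetricV

end EisensteinTwists

/-! ### Quadratic and cubic twists -/

namespace EisensteinTwists

lemma card_mod_four_eq_one {π : 𝓞 K} {p : ℕ} (hcard : Nat.card (𝓞 K ⧸ Ideal.span {π}) = p)
    (hπ4 : 4 ∣ π - 1) : p % 4 = 1 := by
  obtain ⟨a, b, hπab, ha, hb⟩ := exists_eq_add_mul_omegaO_of_four_dvd hπ4
  exact mod_four_eq_one (eq_form_of_card hcard hπab) ha hb

/-- For quadratic twists, the set `V` is stable under negation modulo `D`. -/
lemma exists_neg_mem_V_two {n : ℕ} {π : Fin n → 𝓞 K} {C : Finset (𝓞 K)} (hπ : ∀ j, Prime (π j))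
    (hsplit : ∀ j, ∃ p : ℕ, IsSpecialSplit p ∧ π j ∣ (p : 𝓞 K)) (hπ4 : ∀ j, 4 ∣ π j - 1)
    (hD3 : IsCoprime (∏ j, π j) 3) (hC : RepresentsUnits (∏ j, π j) C) :
    ∀ c ∈ V 2 π (∏ j, π j) C, ∃ c' ∈ V 2 π (∏ j, π j) C, ∏ j, π j ∣ c + c' := by
  have hπD (j) : π j ∣ ∏ j, π j := Finset.dvd_prod_of_mem π (Finset.mem_univ j)
  choose p hp hπp using hsplit
  have hcard (j) := card_quotient_eq_of_isSpecialSplit (hp j) (hπ j) (hπp j)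
  have hp4 (j) := card_mod_four_eq_one (hcard j) (hπ4 j)
  refine exists_neg_mem_V Nat.prime_two isPrimitiveRoot_neg_one hC hπ hπD
    (fun j => two_notMem_span (hπ j) (hp j).1 (hπp j) (Nat.odd_iff.mpr (by have := hp4 j; omega)))
    (fun j h => (hπ j).not_isUnit (hD3.isUnit_of_dvd' (hπD j) h))
    (fun j => powerChar_two_unit (hπ j) (hp j).1 (hcard j) (hp4 j) isUnit_one.neg)
    fun j c hc => residueSymbol_two_eq (hπ j) (hp j).1 (hcard j) (hπ4 j) (fun h => ?_) hc
  exact not_isUnit_one_sub_omegaO (hD3.isUnit_of_dvd'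
    ((dvd_add_right (one_sub_omegaO_dvd_three.mul_right c)).mp h) one_sub_omegaO_dvd_three)

/-- For cubic twists, the set `V` is stable under negation modulo `D`. -/
lemma exists_neg_mem_V_three {n : ℕ} {π : Fin n → 𝓞 K} {D : 𝓞 K} {C : Finset (𝓞 K)}
    (hπ : ∀ j, Prime (π j)) (hπ3 : ∀ j, 3 ∣ π j - 1) (hπD : ∀ j, π j ∣ D) (hD3 : 3 ∣ D - 1)
    (hC : RepresentsUnits D C) : ∀ c ∈ V 3 π D C, ∃ c' ∈ V 3 π D C, D ∣ c + c' := by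
  have h3 (j) : ((3 : ℕ) : 𝓞 K) ∉ Ideal.span {π j} := by
    exact_mod_cast three_notMem_span (hπ j) (hπ3 j)
  refine exists_neg_mem_V Nat.prime_three isPrimitiveRoot_omegaO hC hπ hπD h3
    (fun j h => three_notMem_span (hπ j) (hπ3 j) (Ideal.mem_span_singleton.mpr h)) (fun j => ?_)
    fun j c hc => residueSymbol_three_eq (hπ j) (hπ3 j) ?_ hc
  · -- `-1` is a cube
    have := powerChar_pow Nat.prime_three isPrimitiveRoot_omegaO (isPrime_span (hπ j))
      (span_ne_bot (hπ j).ne_zero) (h3 j) (a := -1)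
      (fun h => (hπ j).not_isUnit (isUnit_of_dvd_unit (Ideal.mem_span_singleton.mp h)
        isUnit_one.neg))
    rwa [show (-1 : 𝓞 K) ^ 3 = -1 by ring] at this
  · rw [add_sub_assoc]
    exact dvd_add (dvd_mul_right 3 c) hD3

end EisensteinTwists

open EisensteinTwists

theorem mainTheorem8
    -- the period lattice `L.lattice` of `y² = 4x³ - 27`
    (L : PeriodPair) (hg₂ : L.g₂ = 0) (hg₃ : L.g₃ = 27)
    -- `Ω` is the least positive real period or its negative
    (Ω : ℝ) (hΩ : IsLeast {x : ℝ | 0 < x ∧ (x : ℂ) ∈ L.lattice} |Ω|) :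
    -- quadratic twists
    (∀ (n : ℕ) (π : Fin n → 𝓞 EisensteinTwists.K) (D : 𝓞 EisensteinTwists.K)
        (C : Finset (𝓞 EisensteinTwists.K)),
      0 < n →
      (∀ j, Prime (π j)) →
      (∀ j, ∃ p : ℕ, EisensteinTwists.IsSpecialSplit p ∧ π j ∣ (p : 𝓞 EisensteinTwists.K)) →
      (∀ j, (4 : 𝓞 EisensteinTwists.K) ∣ π j - 1) →
      (∀ i j, i ≠ j → Ideal.span {π i} ≠ Ideal.span {π j}) →
      D = ∏ j, π j →
      EisensteinTwists.RepresentsUnits D C →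
      (∀ c ∈ C, -c ∈ C) →
      ∑ c ∈ EisensteinTwists.V 2 π D C,
          EisensteinTwists.E₁star
            (((c : EisensteinTwists.K) : ℂ) * Ω / ((D : EisensteinTwists.K) : ℂ) + Ω / 3) L.lattice
        = -(Real.sign Ω : ℂ) *
          ((1 / 2) * (∑ c ∈ EisensteinTwists.V 2 π D C,
              9 / (3 - L.weierstrassP
                (((c : EisensteinTwists.K) : ℂ) * Ω / ((D : EisensteinTwists.K) : ℂ))))
            - ((EisensteinTwists.V 2 π D C).card : ℂ))) ∧
    -- cubic twists
    (∀ (n : ℕ) (π : Fin n → 𝓞 EisensteinTwists.K) (e : Fin n → ℕ) (D : 𝓞 EisensteinTwists.K)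
        (C : Finset (𝓞 EisensteinTwists.K)),
      0 < n →
      (∀ j, EisensteinTwists.IsCubicSpecial (Ideal.span {π j})) →
      (∀ j, (3 : 𝓞 EisensteinTwists.K) ∣ π j - 1) →
      (∀ i j, i ≠ j → Ideal.span {π i} ≠ Ideal.span {π j}) →
      (∀ j, e j = 1 ∨ e j = 2) →
      D = ∏ j, π j ^ e j →
      EisensteinTwists.RepresentsUnits D C →
      (∀ c ∈ C, EisensteinTwists.ωO * c ∈ C ∧ EisensteinTwists.ωO ^ 2 * c ∈ C) →
      ∑ c ∈ EisensteinTwists.V 3 π D C,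
          EisensteinTwists.E₁star
            (((c : EisensteinTwists.K) : ℂ) * Ω / ((D : EisensteinTwists.K) : ℂ) + Ω / 3) L.lattice
        = -(Real.sign Ω : ℂ) *
          ((1 / 2) * (∑ c ∈ EisensteinTwists.V 3 π D C,
              (9 - L.derivWeierstrassP
                  (((c : EisensteinTwists.K) : ℂ) * Ω / ((D : EisensteinTwists.K) : ℂ)))
                / (3 - L.weierstrassP
                  (((c : EisensteinTwists.K) : ℂ) * Ω / ((D : EisensteinTwists.K) : ℂ))))
            - ((EisensteinTwists.V 3 π D C).card : ℂ))) := by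
  constructor
  · rintro n π D C hn hπ hsplit hπ4 - rfl hC -
    have hπD (j) : π j ∣ ∏ j, π j := Finset.dvd_prod_of_mem π (Finset.mem_univ j)
    have hD3 : IsCoprime (∏ j, π j) 3 := by
      refine IsCoprime.prod_left fun j _ => (hπ j).coprime_iff_not_dvd.mpr fun h => ?_
      obtain ⟨p, hp, hπp⟩ := hsplit j
      have hp4 := card_mod_four_eq_one (card_quotient_eq_of_isSpecialSplit hp (hπ j) hπp) (hπ4 j)
      have hp3 : (p : ℤ) ∣ 3 := (intCast_mem_span_iff (hπ j) hp.1 hπp).mp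
        (Ideal.mem_span_singleton.mpr (by exact_mod_cast h))
      have : p ∣ 3 := by exact_mod_cast hp3
      rw [Nat.dvd_prime Nat.prime_three] at this
      rcases this with rfl | rfl
      · exact Nat.not_prime_one hp.1
      · omega
    refine (sum_E₁star_eq hg₂ hg₃ hΩ
      (fun h => (hπ ⟨0, hn⟩).not_isUnit (isUnit_of_dvd_unit (hπD _) h))
      (Finset.prod_ne_zero_iff.mpr fun j _ => (hπ j).ne_zero) hD3
      (fun c hc => hC.isCoprime (Finset.mem_filter.mp hc).1)
      (fun x hx y hy => hC.eq_of_dvd_sub (Finset.mem_filter.mp hx).1 (Finset.mem_filter.mp hy).1)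
      (exists_neg_mem_V_two hπ hsplit hπ4 hD3 hC)).1
  · intro n π e D C hn hspecial hπ3 _ he hDe hC _
    have hπ (j) : Prime (π j) := by
      obtain ⟨h1, h2, -⟩ := hspecial j
      exact (Ideal.span_singleton_prime fun h => h2 (by rw [h, Ideal.span_singleton_zero])).mp h1
    have he0 (j) : e j ≠ 0 := by have := he j; omega
    have hπD (j) : π j ∣ D := by
      rw [hDe]
      exact (dvd_pow_self _ (he0 j)).trans
        (Finset.dvd_prod_of_mem (fun j => π j ^ e j) (Finset.mem_univ j))
    have hD3 : 3 ∣ D - 1 := by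
      rw [hDe, ← Ideal.mem_span_singleton, ← Ideal.Quotient.eq, map_prod, map_one]
      refine Finset.prod_eq_one fun j _ => ?_
      have : Ideal.Quotient.mk (Ideal.span {3}) (π j) = Ideal.Quotient.mk _ 1 := by
        rw [Ideal.Quotient.eq, Ideal.mem_span_singleton]; exact hπ3 j
      rw [map_pow, this, map_one, one_pow]
    have hcop : IsCoprime D 3 := by
      obtain ⟨x, hx⟩ := hD3
      exact ⟨1, -x, by linear_combination hx⟩
    obtain ⟨h1, h2⟩ := sum_E₁star_eq (S := V 3 π D C) hg₂ hg₃ hΩ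
      (fun h => (hπ ⟨0, hn⟩).not_isUnit (isUnit_of_dvd_unit (hπD _) h))
      (by rw [hDe]; exact Finset.prod_ne_zero_iff.mpr fun j _ => pow_ne_zero _ (hπ j).ne_zero) hcop
      (fun c hc => hC.isCoprime (Finset.mem_filter.mp hc).1)
      (fun x hx y hy => hC.eq_of_dvd_sub (Finset.mem_filter.mp hx).1 (Finset.mem_filter.mp hy).1)
      (exists_neg_mem_V_three hπ hπ3 hπD hD3 hC)
    simp only [sub_div, Finset.sum_sub_distrib]
    simp only [emb_apply] at h1 h2
    rw [h2, sub_zero]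
    exact h1
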